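/- Conventions. A vertex algebra is a complex super vector space $V=V_0\oplus V_1$ with a vector $\mathbf 1\in V_0$ and even bilinear products $(a,b)\mapsto a_{(n)}b$, $n\in\mathbb Z$, such that $a_{(n)}b=0$ for $n\gg 0$; $\mathbf 1_{(n)}=\delta_{n,-1}\mathrm{Id}$, $a_{(-1)}\mathbf 1=a$, $a_{(n)}\mathbf 1=0$ for $n\ge 0$; and, for all $m,n,k\in\mathbb Z$, all $c$ and all homogeneous $a,b$ of parities $\tilde a,\tilde b$, $$\sum_{j\ge 0}\binom mj (a_{(n+j)}b)_{(m+k-j)}c=\sum_{j\ge 0}(-1)^j\binom nj\Big\{a_{(m+n-j)}(b_{(k+j)}c)-(-1)^n(-1)^{\tilde a\tilde b}\,b_{(n+k-j)}(a_{(m+j)}c)\Big\}.$$ Let $X$ be a Noetherian topological space (for example a smooth algebraic variety over $\mathbb C$ with its Zariski topology), and let $\mathcal V=\mathcal V_0\oplus\mathcal V_1$ be a sheaf of vertex algebras on $X$, that is, a sheaf of complex vector spaces whose spaces of sections are vertex algebras and whose restriction maps are morphisms of vertex algebras. Write $m_n:\mathcal V\otimes_{\mathbb C}\mathcal V\to\mathcal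 V$ for the $n$-th product. There are bilinear maps $$h(m_n): H^p(X,\mathcal V)\times H^q(X,\mathcal V)\to H^{p+q}(X,\mathcal V)\qquad(n\in\mathbb Z,\ p,q\ge 0)$$ with the following properties. (1) (Injective resolutions.) For every injective resolution $\mathcal V\to\mathcal I^\bullet$, each $m_n$ extends to a morphism of complexes $M:\mathcal I^\bullet\otimes_{\mathbb C}\mathcal I^\bullet\to\mathcal I^\bullet$, and for every such $M$ and all cocycles $x\in\Gamma(X,\mathcal I^p)$, $y\in\Gamma(X,\mathcal I^q)$ one has $h(m_n)([x],[y])=[M(x\otimes y)]$. In particular $h(m_n)$ is uniquely determined. (2) (Čech cochains.) Let $\mathfrak U=(U_i)$ be an open cover of $X$, and consider the canonical map $\check H^\bullet(\mathfrak U,\mathcal V)\to H^\bullet(X,\mathcal V)$ induced by any morphism from the Čech resolution to an injective resolution of $\mathcal V$ which is the identity on $\mathcal V$. This map is well defined, and it carries the product induced by the cup product $$(f\ast g)(i_0,\dots,i_{p+q})=f(i_0,\dots,i_p)_{(n)}\,g(i_p,\dots,i_{p+q})$$ of Čech cocycles to $h(m_n)$. If $H^i(U_{i_0}\cap\dots\cap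 U_{i_r},\mathcal V)=0$ for all $i>0$, $r\ge 0$ and all $i_0,\dots,i_r$, then it is bijective, so that $h(m_n)$ is the product defined through Čech cochains of $\mathfrak U$. (3) There is exactly one vertex algebra structure on $H^\bullet(X,\mathcal V)=\bigoplus_p H^p(X,\mathcal V)$ for which the parity of $H^p(X,\mathcal V_i)$ is $p+i$ modulo $2$, the vacuum vector is the image of $\mathbf 1\in\Gamma(X,\mathcal V)=H^0(X,\mathcal V)$, and $$\alpha_{(n)}\beta=(-1)^{iq}\,h(m_n)(\alpha,\beta)\qquad\text{for }\alpha\in H^p(X,\mathcal V_i),\ \beta\in H^q(X,\mathcal V),\ n\in\mathbb Z.$$ (If $\mathcal V$ is purely even, there is no sign: the products are exactly the maps $h(m_n)$, and the parity is the cohomological degree modulo $2$.) -/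

import Mathlib

open CategoryTheory TopologicalSpace Opposite
open scoped DirectSum

noncomputable section

/-! ### Vertex (super)algebras -/

/-- The Koszul sign `(-1)^{ij}` of two parities. -/
def koszulSign (i j : ZMod 2) : ℤ := if i = 1 ∧ j = 1 then -1 else 1

/-- A vertex algebra: a complex super vector space `V = V₀ ⊕ V₁` with a vacuum vector and
even bilinear products `a ₍ₙ₎ b`, `n ∈ ℤ`, subject to the nilpotency condition, the vacuum
axioms and the Borcherds identity. The sums in the Borcherds identity have finitely many nonzero
terms because of the nilpotency condition. -/
@[ext]
structure VertexAlgebra (V : Type*) [AddCommGroup V] [Module ℂ V] where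
  /-- the even (`0`) and odd (`1`) subspaces -/
  grading : ZMod 2 → Submodule ℂ V
  isInternal : DirectSum.IsInternal grading
  /-- the vacuum vector -/
  vac : V
  vac_mem : vac ∈ grading 0
  /-- `mul n a b` is the product `a ₍ₙ₎ b` -/
  mul : ℤ → V →ₗ[ℂ] V →ₗ[ℂ] V
  mul_mem : ∀ (n : ℤ) (i j : ZMod 2) (a b : V),
    a ∈ grading i → b ∈ grading j → mul n a b ∈ grading (i + j)
  nilpotent : ∀ a b : V, ∃ N : ℤ, ∀ n : ℤ, N ≤ n → mul n a b = 0
  vac_mul : ∀ (n : ℤ) (a : V), mul n vac a = if n = -1 then a else 0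
  mul_vac : ∀ a : V, mul (-1) a vac = a
  mul_vac_of_nonneg : ∀ (n : ℤ) (a : V), 0 ≤ n → mul n a vac = 0
  borcherds : ∀ (m n k : ℤ) (i j : ZMod 2) (a b c : V), a ∈ grading i → b ∈ grading j →
    ∑ᶠ l : ℕ, Ring.choose m l • mul (m + k - l) (mul (n + l) a b) c =
      ∑ᶠ l : ℕ, ((-1 : ℤ) ^ l * Ring.choose n l) •
        (mul (m + n - l) a (mul (k + l) b c) -
          ((n.negOnePow : ℤ) * koszulSign i j) • mul (n + k - l) b (mul (m + l) a c))

namespace VertexAlgebra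

variable {V : Type*} [AddCommGroup V] [Module ℂ V] (A : VertexAlgebra V)

/-- The projection of `V = V₀ ⊕ V₁` onto its part of parity `i`. -/
def proj (i : ZMod 2) : V →ₗ[ℂ] V :=
  (A.grading i).subtype ∘ₗ DirectSum.component ℂ (ZMod 2) (fun j => A.grading j) i ∘ₗ
    (LinearEquiv.ofBijective (DirectSum.coeLinearMap A.grading) A.isInternal).symm.toLinearMap

theorem proj_coe (i : ZMod 2) (x : ⨁ j, A.grading j) :
    A.proj i (DirectSum.coeLinearMap A.grading x) = x i := by
  have h : (LinearEquiv.ofBijective (DirectSum.coeLinearMap A.grading) A.isInternal).symm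
      (DirectSum.coeLinearMap A.grading x) = x :=
    (LinearEquiv.ofBijective (DirectSum.coeLinearMap A.grading) A.isInternal).symm_apply_apply x
  simp only [proj, LinearMap.comp_apply, LinearEquiv.coe_coe, h]
  rfl

theorem proj_of_mem (i j : ZMod 2) {a : V} (ha : a ∈ A.grading j) :
    A.proj i a = if i = j then a else 0 := by
  have h := A.proj_coe i (DirectSum.of (fun j => A.grading j) j ⟨a, ha⟩)
  rw [DirectSum.coeLinearMap_of] at h
  rw [h, DirectSum.coe_of_apply]
  by_cases hij : i = j
  · simp [hij]
  · simp [hij, Ne.symm hij]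

/-- An even linear map commutes with the projections to the parts of given parity. -/
theorem map_proj {W : Type*} [AddCommGroup W] [Module ℂ W] (B : VertexAlgebra W)
    (f : V →ₗ[ℂ] W) (hf : ∀ (i : ZMod 2) (a : V), a ∈ A.grading i → f a ∈ B.grading i)
    (i : ZMod 2) (a : V) : f (A.proj i a) = B.proj i (f a) := by
  obtain ⟨x, rfl⟩ := A.isInternal.2 a
  induction x using DirectSum.induction_on with
  | zero => simp
  | of j b =>
    have e : (DirectSum.coeAddMonoidHom A.grading) (DirectSum.of (fun j => A.grading j) j b)
        = (b : V) := DirectSum.coeAddMonoidHom_of _ _ _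
    rw [e, A.proj_of_mem i j b.2, B.proj_of_mem i j (hf j _ b.2)]
    split_ifs <;> simp
  | add x y hx hy => simp only [map_add, hx, hy]

end VertexAlgebra

/-! ### Sheaves of complex vector spaces and their cohomology -/

/-- Sheaves of complex vector spaces on `X`. -/
abbrev VectSheaf (X : TopCat.{0}) :=
  Sheaf (Opens.grothendieckTopology X) (ModuleCat.{0} ℂ)

variable {X : TopCat.{0}}

namespace VectSheaf

/-- The sections `F(U)`. -/
abbrev sec (F : VectSheaf X) (U : Opens X) : Type := F.obj.obj (op U)

/-- The restriction map `F(U) → F(W)` for `W ⊆ U`. -/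
def res (F : VectSheaf X) {U W : Opens X} (h : W ≤ U) : F.sec U →ₗ[ℂ] F.sec W :=
  (F.obj.map (homOfLE h).op).hom

/-- The map on sections over `U` of a morphism of sheaves. -/
def secMap {F G : VectSheaf X} (φ : F ⟶ G) (U : Opens X) : F.sec U →ₗ[ℂ] G.sec U :=
  (φ.hom.app (op U)).hom

/-- The functor `F ↦ F(U)`. -/
def secFunctor (X : TopCat.{0}) (U : Opens X) : VectSheaf X ⥤ ModuleCat.{0} ℂ :=
  sheafToPresheaf _ _ ⋙ (evaluation _ _).obj (op U)

instance (U : Opens X) : (secFunctor X U).Additive where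
  map_add := rfl

/-- The sheaf cohomology `Hⁿ(U, F)`: the right derived functors of `F ↦ F(U)`. -/
abbrev cohOn (U : Opens X) (F : VectSheaf X) (n : ℕ) : ModuleCat.{0} ℂ :=
  ((secFunctor X U).rightDerived n).obj F

/-- The sheaf cohomology `Hⁿ(X, F)`. -/
abbrev coh (F : VectSheaf X) (n : ℕ) : ModuleCat.{0} ℂ := cohOn ⊤ F n

/-- The map induced on `Hⁿ(X, -)` by a morphism of sheaves. -/
def cohMap {F G : VectSheaf X} (φ : F ⟶ G) (n : ℕ) : F.coh n →ₗ[ℂ] G.coh n :=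
  (((secFunctor X ⊤).rightDerived n).map φ).hom

/-- The canonical map `Γ(X, F) → H⁰(X, F)`. -/
def cohZero (F : VectSheaf X) : F.sec ⊤ →ₗ[ℂ] F.coh 0 :=
  ((secFunctor X ⊤).toRightDerivedZero.app F).hom

/-- The total cohomology `H^•(X, F) = ⨁ₙ Hⁿ(X, F)`. -/
abbrev totalCoh (F : VectSheaf X) : Type := ⨁ n : ℕ, F.coh n

/-- The augmentation `F → I⁰` of an injective resolution. -/
def aug {F : VectSheaf X} (I : InjectiveResolution F) : F ⟶ I.cocomplex.X 0 := I.ι.f 0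

/-- `Represents I x α`: the global section `x` of `Iⁿ` is a cocycle, and its class under
the canonical isomorphism `Hⁿ(Γ(X, I^•)) ≅ Hⁿ(X, F)` is `α`. -/
def Represents {F : VectSheaf X} (I : InjectiveResolution F) {n : ℕ}
    (x : sec (I.cocomplex.X n) ⊤) (α : F.coh n) : Prop :=
  ∃ z : (((secFunctor X ⊤).mapHomologicalComplex _).obj I.cocomplex).cycles n,
    ((((secFunctor X ⊤).mapHomologicalComplex _).obj I.cocomplex).iCycles n).hom z = x ∧
    (I.isoRightDerivedObj (secFunctor X ⊤) n).inv.hom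
      (((((secFunctor X ⊤).mapHomologicalComplex _).obj I.cocomplex).homologyπ n).hom z) = α

/-! ### Multiplications and their extension to injective resolutions -/

/-- A bilinear pairing of sheaves `F × G → K`; by the universal property of the tensor product
and of sheafification it is the same as a morphism of sheaves `F ⊗ G → K`. -/
structure Pairing (F G K : VectSheaf X) where
  map : ∀ U : Opens X, F.sec U →ₗ[ℂ] G.sec U →ₗ[ℂ] K.sec U
  res_map : ∀ {U W : Opens X} (h : W ≤ U) (a : F.sec U) (b : G.sec U),
    K.res h (map U a b) = map W (F.res h a) (G.res h b)

/-- An extension of a multiplication `m : F ⊗ F → F` to an injective resolution `F → I^•`: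
a morphism of complexes `I^• ⊗ I^• → I^•` (from the total complex of the tensor product)
which restricts to `m` on `F ⊗ F`. -/
structure PairingExtension {F : VectSheaf X} (m : Pairing F F F) (I : InjectiveResolution F) where
  /-- the component `I^p ⊗ I^q → I^n`, `n = p + q` -/
  mul : ∀ p q n : ℕ, p + q = n →
    Pairing (I.cocomplex.X p) (I.cocomplex.X q) (I.cocomplex.X n)
  leibniz : ∀ (p q n : ℕ) (h : p + q = n) (U : Opens X)
    (x : sec (I.cocomplex.X p) U) (y : sec (I.cocomplex.X q) U),
    secMap (I.cocomplex.d n (n + 1)) U ((mul p q n h).map U x y) =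
      (mul (p + 1) q (n + 1) (by omega)).map U (secMap (I.cocomplex.d p (p + 1)) U x) y +
      (-1 : ℤ) ^ p • (mul p (q + 1) (n + 1) (by omega)).map U x
        (secMap (I.cocomplex.d q (q + 1)) U y)
  mul_aug : ∀ (U : Opens X) (a b : F.sec U),
    (mul 0 0 0 rfl).map U (secMap (aug I) U a) (secMap (aug I) U b) =
      secMap (aug I) U (m.map U a b)

/-- `c` is the multiplication induced on `H^•(X, F)` by `m : F ⊗ F → F`: the multiplication `m`
extends to every injective resolution `F → I^•`, and, whatever the resolution and the
extension, the product of the classes of two cocycles `x`, `y` of `Γ(X, I^•)` is the class of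
their product. -/
def IsCupProduct {F : VectSheaf X} (m : Pairing F F F)
    (c : ∀ p q : ℕ, F.coh p →ₗ[ℂ] F.coh q →ₗ[ℂ] F.coh (p + q)) : Prop :=
  ∀ I : InjectiveResolution F, Nonempty (PairingExtension m I) ∧
    ∀ (M : PairingExtension m I) (p q : ℕ)
      (x : sec (I.cocomplex.X p) ⊤) (y : sec (I.cocomplex.X q) ⊤) (α : F.coh p) (β : F.coh q),
      Represents I x α → Represents I y β →
        Represents I ((M.mul p q (p + q) rfl).map ⊤ x y) (c p q α β)

/-! ### Čech cochains -/

variable {ι : Type} (U : ι → Opens X) (F : VectSheaf X)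

/-- The sections over `W` of the sheaf of Čech `p`-cochains of the cover `U`: families
`f(i₀, …, i_p) ∈ F(W ∩ U_{i₀} ∩ … ∩ U_{i_p})`. For `W = X` these are the Čech cochains. -/
abbrev CechCochain (p : ℕ) (W : Opens X) : Type :=
  ∀ σ : Fin (p + 1) → ι, F.sec (W ⊓ ⨅ k, U (σ k))

variable {U F}

/-- Restriction of Čech cochains from `W` to `W' ⊆ W`. -/
def cechRes {p : ℕ} {W W' : Opens X} (h : W' ≤ W) (f : CechCochain U F p W) :
    CechCochain U F p W' :=
  fun σ => F.res (inf_le_inf_right _ h) (f σ)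

/-- The augmentation `F(W) → C⁰(W)`. -/
def cechAug {W : Opens X} (a : F.sec W) : CechCochain U F 0 W :=
  fun _ => F.res inf_le_left a

/-- The Čech differential
`(df)(i₀, …, i_{p+1}) = ∑ₖ (-1)^k f(i₀, …, î_k, …, i_{p+1})`. -/
def cechD {p : ℕ} {W : Opens X} (f : CechCochain U F p W) : CechCochain U F (p + 1) W :=
  fun σ => ∑ k : Fin (p + 2), (-1 : ℤ) ^ (k : ℕ) •
    F.res (inf_le_inf_left W (le_iInf fun l => iInf_le (fun l => U (σ l)) (k.succAbove l)))
      (f fun l => σ (k.succAbove l))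

/-- The cup product of Čech cochains
`(f ∗ g)(i₀, …, i_{p+q}) = m(f(i₀, …, i_p), g(i_p, …, i_{p+q}))`. -/
def cechCup (m : Pairing F F F) {p q : ℕ} {W : Opens X}
    (f : CechCochain U F p W) (g : CechCochain U F q W) : CechCochain U F (p + q) W :=
  fun σ =>
    let front : Fin (p + 1) → Fin (p + q + 1) := fun l => ⟨l, by omega⟩
    let back : Fin (q + 1) → Fin (p + q + 1) := fun l => ⟨p + l, by omega⟩
    m.map (W ⊓ ⨅ k, U (σ k))
      (F.res (inf_le_inf_left W (le_iInf fun l => iInf_le (fun k => U (σ k)) (front l)))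
        (f (σ ∘ front)))
      (F.res (inf_le_inf_left W (le_iInf fun l => iInf_le (fun k => U (σ k)) (back l)))
        (g (σ ∘ back)))

/-- `f` is a Čech coboundary. -/
def IsCechCoboundary {W : Opens X} : ∀ {p : ℕ}, CechCochain U F p W → Prop
  | 0, f => f = 0
  | _ + 1, f => ∃ g, cechD g = f

variable (U) in
/-- A morphism from the Čech resolution `F → C^•(U, F)` to an injective resolution `F → I^•`
which is the identity on `F`. -/
structure CechMorphism (I : InjectiveResolution F) where
  map : ∀ (p : ℕ) (W : Opens X), CechCochain U F p W →ₗ[ℂ] sec (I.cocomplex.X p) W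
  map_res : ∀ (p : ℕ) {W W' : Opens X} (h : W' ≤ W) (f : CechCochain U F p W),
    map p W' (cechRes h f) = res (I.cocomplex.X p) h (map p W f)
  map_d : ∀ (p : ℕ) (W : Opens X) (f : CechCochain U F p W),
    map (p + 1) W (cechD f) = secMap (I.cocomplex.d p (p + 1)) W (map p W f)
  map_aug : ∀ (W : Opens X) (a : F.sec W), map 0 W (cechAug a) = secMap (aug I) W a

/-- `α ∈ H^p(X, F)` is the class of the Čech cocycle `f`: the image of the Čech class of `f`
under the canonical map from Čech cohomology to sheaf cohomology, which is induced by
a morphism from the Čech resolution to an injective resolution. -/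
def IsCechClass {p : ℕ} (f : CechCochain U F p ⊤) (α : F.coh p) : Prop :=
  cechD f = 0 ∧
    ∃ (I : InjectiveResolution F) (φ : CechMorphism U I), Represents I (φ.map p ⊤ f) α

variable (U F) in
/-- The nonempty finite intersections of members of `U` have no higher cohomology with
coefficients in `F`. -/
def IsAcyclicCover : Prop :=
  ∀ (p : ℕ) (σ : Fin (p + 1) → ι) (i : ℕ), 0 < i → Subsingleton (cohOn (⨅ k, U (σ k)) F i)

end VectSheaf

/-! ### Sheaves of vertex algebras -/

/-- A sheaf of vertex algebras on `X`: a sheaf of vector spaces whose spaces of sections are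
vertex algebras and whose restriction maps are morphisms of vertex algebras. -/
structure VertexAlgebraSheaf (X : TopCat.{0}) where
  sheaf : VectSheaf X
  alg : ∀ U : Opens X, VertexAlgebra (sheaf.sec U)
  res_mem : ∀ {U W : Opens X} (h : W ≤ U) (i : ZMod 2) (a : sheaf.sec U),
    a ∈ (alg U).grading i → sheaf.res h a ∈ (alg W).grading i
  res_vac : ∀ {U W : Opens X} (h : W ≤ U), sheaf.res h (alg U).vac = (alg W).vac
  res_mul : ∀ {U W : Opens X} (h : W ≤ U) (n : ℤ) (a b : sheaf.sec U),
    sheaf.res h ((alg U).mul n a b) = (alg W).mul n (sheaf.res h a) (sheaf.res h b)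

namespace VertexAlgebraSheaf

variable (𝒱 : VertexAlgebraSheaf X)

/-- The product `₍ₙ₎` as a pairing of sheaves. -/
def product (n : ℤ) : VectSheaf.Pairing 𝒱.sheaf 𝒱.sheaf 𝒱.sheaf where
  map U := (𝒱.alg U).mul n
  res_map h a b := 𝒱.res_mul h n a b

/-- The projection of the sheaf `𝒱 = 𝒱₀ ⊕ 𝒱₁` onto its part of parity `i`. -/
def parityProj (i : ZMod 2) : 𝒱.sheaf ⟶ 𝒱.sheaf :=
  ⟨{ app := fun U => ModuleCat.ofHom ((𝒱.alg U.unop).proj i)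
     naturality := fun U W f => by
      ext a
      exact ((𝒱.alg U.unop).map_proj (𝒱.alg W.unop) (𝒱.sheaf.res (leOfHom f.unop))
        (𝒱.res_mem (leOfHom f.unop)) i a).symm }⟩

/-- The part `H^p(X, 𝒱ᵢ)` of `H^p(X, 𝒱) = H^p(X, 𝒱₀) ⊕ H^p(X, 𝒱₁)`. -/
def cohParity (p : ℕ) (i : ZMod 2) : Submodule ℂ (𝒱.sheaf.coh p) :=
  LinearMap.range (VectSheaf.cohMap (𝒱.parityProj i) p)

/-- The part of parity `j` of `H^•(X, 𝒱)`: the direct sum of the `H^p(X, 𝒱ᵢ)` with `p + i = j`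
modulo `2`. -/
def totalParity (j : ZMod 2) : Submodule ℂ 𝒱.sheaf.totalCoh :=
  ⨆ p : ℕ, (𝒱.cohParity p (j - p)).map
    (DirectSum.lof ℂ ℕ (fun p => 𝒱.sheaf.coh p) p)

end VertexAlgebraSheaf

end

/-!
The proof works with presheaves of complex vector spaces and their sectionwise tensor products; no
sheaf tensor product and no total complex is needed. The reason is that an injective sheaf is also
injective as a presheaf, because sheafification is exact (`Psh.injective_obj`).

*Products.* Call an augmented sequence of presheaves `0 → E⁰ → E¹ → ⋯` locally exact if its
stalks are exact. Chain maps from a locally exact sequence to a complex of injective sheaves can be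
built degree by degree and are unique up to homotopy. Tensoring over a field with a fixed presheaf
preserves local exactness, so a pairing `F × F → F` extends to a pairing of injective resolutions
one variable at a time, and a pairing that extends zero sends a pair of cocycles to a coboundary.
This gives `cup`, its independence of all choices (`isCupProduct_cup`) and its naturality
(`cohMap_cup`).

*Universal triple products.* The same argument in three variables gives, for three classes
`α`, `β`, `γ`, one class `u` in the cohomology of the sheaf associated with `F ⊗ F ⊗ F` whose
images under the morphisms `(a ⊗ b) ⊗ c ↦ (a b) c`, `a (b c)`, `b (a c)` are the iterated products
of the classes, with the sign `(-1)^{pq}` in the last case (`exists_tripleProduct`). Hence linear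
relations among iterated products of sections pass to cohomology.

*Infinitely many relations at once.* The nilpotency condition and the Borcherds identity involve
bounds that depend on the sections. They say that certain sequences of morphisms out of
`𝒱 ⊗ 𝒱 ⊗ 𝒱` eventually kill every section. On a Noetherian space such a sequence eventually kills
every cohomology class (`exists_cohMap_eq_zero`): cohomology commutes with sequential colimits; this
is proved here for systems with zero colimit by induction on the degree, with a
Mayer–Vietoris argument for flasque sheaves. So the classes of a vertex algebra sheaf satisfy both
axioms, and the parity of `H^p` absorbs the sign `(-1)^{pq}` above (`totalVertexAlgebra`).

*Čech cochains.* The Čech complex of a cover, as a complex of presheaves, is locally exact because a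
choice of a member of the cover contracts it over every open set inside that member, so it maps to
any injective resolution, compatibly with the cup products (`existsUnique_isCechClass`,
`IsCechClass.cup`). For an injective sheaf the Čech complex of a cover is exact over the whole
space. With an acyclic cover the double complex of Čech cochains with values in an injective
resolution therefore has exact rows and columns, and a zigzag through it compares Čech cohomology
with sheaf cohomology (`IsAcyclicCover.exists_isCechClass`, `IsAcyclicCover.isCechCoboundary`).
-/

open scoped TensorProduct

noncomputable section

/-! ### Presheaves of complex vector spaces -/

/-- Presheaves of complex vector spaces on `X`. -/
abbrev Psh (X : TopCat.{0}) := (Opens X)ᵒᵖ ⥤ ModuleCat.{0} ℂ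

variable {X : TopCat.{0}}

namespace Psh

/-- The sections `P(U)`. -/
abbrev sec (P : Psh X) (U : Opens X) : Type := P.obj (op U)

/-- The restriction map `P(U) → P(W)` for `W ⊆ U`. -/
def res (P : Psh X) {U W : Opens X} (h : W ≤ U) : P.sec U →ₗ[ℂ] P.sec W :=
  (P.map (homOfLE h).op).hom

/-- The map on sections over `U` of a morphism of presheaves. -/
def app {P Q : Psh X} (f : P ⟶ Q) (U : Opens X) : P.sec U →ₗ[ℂ] Q.sec U := (f.app (op U)).hom

variable {P Q R : Psh X}

@[simp] lemma res_res {U V W : Opens X} (h : V ≤ U) (h' : W ≤ V) (x : P.sec U) :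
    P.res h' (P.res h x) = P.res (h'.trans h) x := by
  simp only [res, ← LinearMap.comp_apply, ← ModuleCat.hom_comp, ← Functor.map_comp]
  rfl

@[simp] lemma res_self {U : Opens X} (h : U ≤ U) (x : P.sec U) : P.res h x = x := by
  simp [res]

lemma app_res (f : P ⟶ Q) {U W : Opens X} (h : W ≤ U) (x : P.sec U) :
    app f W (P.res h x) = Q.res h (app f U x) := by
  simp only [res, app, ← LinearMap.comp_apply, ← ModuleCat.hom_comp, f.naturality]

@[simp] lemma app_comp (f : P ⟶ Q) (g : Q ⟶ R) (U : Opens X) (x : P.sec U) :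
    app (f ≫ g) U x = app g U (app f U x) := rfl

@[simp] lemma app_id (U : Opens X) (x : P.sec U) : app (𝟙 P) U x = x := rfl

@[simp] lemma app_zero (U : Opens X) (x : P.sec U) : app (0 : P ⟶ Q) U x = 0 := rfl

@[simp] lemma app_add (f g : P ⟶ Q) (U : Opens X) (x : P.sec U) :
    app (f + g) U x = app f U x + app g U x := rfl

@[simp] lemma app_sub (f g : P ⟶ Q) (U : Opens X) (x : P.sec U) :
    app (f - g) U x = app f U x - app g U x := rfl

@[simp] lemma app_zsmul (n : ℤ) (f : P ⟶ Q) (U : Opens X) (x : P.sec U) :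
    app (n • f) U x = n • app f U x := rfl

lemma hom_ext {f g : P ⟶ Q} (h : ∀ U x, app f U x = app g U x) : f = g := by
  ext U x
  exact h U.unop x

/-- A morphism of presheaves from its maps on sections. -/
def homMk (φ : ∀ U : Opens X, P.sec U →ₗ[ℂ] Q.sec U)
    (hφ : ∀ {U W : Opens X} (h : W ≤ U) (x : P.sec U), φ W (P.res h x) = Q.res h (φ U x)) :
    P ⟶ Q where
  app U := ModuleCat.ofHom (φ U.unop)
  naturality U W f := by
    ext x
    exact hφ (leOfHom f.unop) x

/-- A presheaf is separated if a section which is locally zero is zero. -/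
def IsSep (P : Psh X) : Prop :=
  ∀ (U : Opens X) (x : P.sec U),
    (∀ p ∈ U, ∃ (W : Opens X) (h : W ≤ U), p ∈ W ∧ P.res h x = 0) → x = 0

lemma isSep_of_sheaf (F : VectSheaf X) : IsSep F.obj := by
  intro U x hx
  choose! W hW hp h0 using hx
  refine TopCat.Sheaf.eq_of_locally_eq' F (fun p : U => W p) U (fun p => homOfLE (hW p p.2))
    (fun p hpU => Opens.mem_iSup.2 ⟨⟨p, hpU⟩, hp p hpU⟩) x 0 (fun p => ?_)
  rw [map_zero]
  exact h0 p p.2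

/-- Sections of a sheaf over two open sets which agree on the intersection come from a section
over the union. -/
lemma exists_glue (F : VectSheaf X) {U V : Opens X} (x : sec F.obj U) (y : sec F.obj V)
    (h : res F.obj (inf_le_left : U ⊓ V ≤ U) x = res F.obj (inf_le_right : U ⊓ V ≤ V) y) :
    ∃ z : sec F.obj (U ⊔ V), res F.obj le_sup_left z = x ∧ res F.obj le_sup_right z = y := by
  let T : Bool → Opens X := fun b => cond b U V
  let s : ∀ b, sec F.obj (T b) := fun b => match b with
    | true => x
    | false => y
  obtain ⟨z, hz, -⟩ := TopCat.Sheaf.existsUnique_gluing' F T (U ⊔ V)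
    (fun b => homOfLE (match b with
      | true => le_sup_left
      | false => le_sup_right))
    (sup_le (le_iSup T true) (le_iSup T false)) s (by
      rintro (_ | _) (_ | _)
      · rfl
      · have := congrArg (res F.obj (le_of_eq (inf_comm V U))) h
        rw [res_res, res_res] at this
        exact this.symm
      · exact h
      · rfl)
  exact ⟨z, hz true, hz false⟩

instance injective_obj (F : VectSheaf X) [Injective F] : Injective F.obj :=
  Injective.injective_of_adjoint
    (sheafificationAdjunction (Opens.grothendieckTopology X) (ModuleCat.{0} ℂ)) F

/-- A morphism `f : A ⟶ J` to an injective presheaf extends along `u : A ⟶ B` as soon as it kills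
the kernel of `u`. -/
lemma exists_extension {A B J : Psh X} [Injective J] (u : A ⟶ B) (f : A ⟶ J)
    (h : ∀ U (a : A.sec U), app u U a = 0 → app f U a = 0) : ∃ g : B ⟶ J, u ≫ g = f := by
  have hk : Limits.kernel.ι u ≫ f = 0 := by
    refine hom_ext fun U x => ?_
    rw [app_comp]
    refine (h U _ ?_).trans (app_zero U x).symm
    rw [← app_comp, Limits.kernel.condition, app_zero]
  let f' : Abelian.coimage u ⟶ J := Limits.cokernel.desc _ f hk
  refine ⟨Injective.factorThru f' (Abelian.factorThruCoimage u), ?_⟩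
  calc u ≫ Injective.factorThru f' (Abelian.factorThruCoimage u)
      = (Abelian.coimage.π u ≫ Abelian.factorThruCoimage u) ≫
          Injective.factorThru f' (Abelian.factorThruCoimage u) := by rw [Abelian.coimage.fac]
    _ = f := by
      rw [Category.assoc, Injective.comp_factorThru]
      exact Limits.cokernel.π_desc _ _ _

end Psh

/-! ### Resolutions by presheaves -/

/-- A sequence `P⁰ → P¹ → P² → ⋯` of presheaves. -/
structure PshSeq (X : TopCat.{0}) where
  obj : ℕ → Psh X
  d : ∀ n, obj n ⟶ obj (n + 1)

namespace PshSeq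

open Psh

/-- The sequence `0 → E⁰ → E¹ → ⋯` becomes exact after sheafification (apart from the condition
that it be a complex): sections killed by the differential are locally in its image. -/
structure LocExact (E : PshSeq X) : Prop where
  zero : ∀ (U : Opens X) (x : (E.obj 0).sec U), app (E.d 0) U x = 0 →
    ∀ p ∈ U, ∃ (W : Opens X) (h : W ≤ U), p ∈ W ∧ (E.obj 0).res h x = 0
  succ : ∀ (n : ℕ) (U : Opens X) (x : (E.obj (n + 1)).sec U), app (E.d (n + 1)) U x = 0 →
    ∀ p ∈ U, ∃ (W : Opens X) (h : W ≤ U), p ∈ W ∧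
      ∃ w : (E.obj n).sec W, app (E.d n) W w = (E.obj (n + 1)).res h x

/-- A complex of separated presheaves which are injective objects. -/
structure IsInjSep (J : PshSeq X) : Prop where
  d_d : ∀ n, J.d n ≫ J.d (n + 1) = 0
  inj : ∀ n, Injective (J.obj n)
  sep : ∀ n, IsSep (J.obj n)

variable {E J : PshSeq X}

lemma LocExact.exists_d_zero_comp (hE : LocExact E) {K : Psh X} [Injective K] (hK : IsSep K)
    (f : E.obj 0 ⟶ K) : ∃ g, E.d 0 ≫ g = f := by
  refine exists_extension _ _ fun U a ha => hK U _ fun p hp => ?_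
  obtain ⟨W, h, hpW, h0⟩ := hE.zero U a ha p hp
  exact ⟨W, h, hpW, by rw [← app_res, h0, map_zero]⟩

lemma LocExact.exists_d_succ_comp (hE : LocExact E) {K : Psh X} [Injective K] (hK : IsSep K)
    {n : ℕ} (f : E.obj (n + 1) ⟶ K) (hf : E.d n ≫ f = 0) : ∃ g, E.d (n + 1) ≫ g = f := by
  refine exists_extension _ _ fun U a ha => hK U _ fun p hp => ?_
  obtain ⟨W, h, hpW, w, hw⟩ := hE.succ n U a ha p hp
  exact ⟨W, h, hpW, by rw [← app_res, ← hw, ← app_comp, hf, app_zero]⟩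

lemma _root_.exists_dependent_seq {S : ℕ → Type*} (R : ∀ n, S n → S (n + 1) → Prop) (a : S 0)
    (h : ∀ n (x : S n), ∃ y, R n x y) : ∃ s : ∀ n, S n, s 0 = a ∧ ∀ n, R n (s n) (s (n + 1)) := by
  choose next hnext using h
  exact ⟨fun n => Nat.rec a (fun n x => next n x) n, rfl, fun n => hnext n _⟩

/-- A morphism `E⁰ ⟶ J⁰` which is killed by the differential of `J` extends to a chain map
`E^{• + 1} ⟶ J^•`. -/
theorem LocExact.exists_lift (hE : LocExact E) (hJ : IsInjSep J) (g : E.obj 0 ⟶ J.obj 0)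
    (hg : g ≫ J.d 0 = 0) : ∃ θ : ∀ p, E.obj (p + 1) ⟶ J.obj p, E.d 0 ≫ θ 0 = g ∧
      ∀ p, θ p ≫ J.d p = E.d (p + 1) ≫ θ (p + 1) := by
  have := hJ.inj
  obtain ⟨θ₀, h₀⟩ := hE.exists_d_zero_comp (hJ.sep 0) g
  let S : ℕ → Type := fun p => {θ : E.obj (p + 1) ⟶ J.obj p // E.d p ≫ θ ≫ J.d p = 0}
  obtain ⟨s, hs, hR⟩ := exists_dependent_seq (S := S)
    (fun p a b => a.1 ≫ J.d p = E.d (p + 1) ≫ b.1)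
    ⟨θ₀, by rw [← Category.assoc, h₀, hg]⟩ (fun p a => by
      obtain ⟨b, hb⟩ := hE.exists_d_succ_comp (hJ.sep (p + 1)) (a.1 ≫ J.d p) a.2
      exact ⟨⟨b, by rw [← Category.assoc, hb, Category.assoc, hJ.d_d, Limits.comp_zero]⟩,
        hb.symm⟩)
  exact ⟨fun p => (s p).1, by simp only [hs]; exact h₀, hR⟩

/-- A chain map from a locally exact sequence to a complex of injectives is null-homotopic. -/
theorem LocExact.exists_homotopy (hE : LocExact E) (hJ : IsInjSep J)
    (D : ∀ p, E.obj p ⟶ J.obj p) (hD : ∀ p, D p ≫ J.d p = E.d p ≫ D (p + 1)) :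
    ∃ k : ∀ p, E.obj (p + 1) ⟶ J.obj p, D 0 = E.d 0 ≫ k 0 ∧
      ∀ p, D (p + 1) = k p ≫ J.d p + E.d (p + 1) ≫ k (p + 1) := by
  have := hJ.inj
  obtain ⟨k₀, h₀⟩ := hE.exists_d_zero_comp (hJ.sep 0) (D 0)
  let S : ℕ → Type := fun p => {k : E.obj (p + 1) ⟶ J.obj p //
    E.d p ≫ (D (p + 1) - k ≫ J.d p) = 0}
  obtain ⟨s, hs, hR⟩ := exists_dependent_seq (S := S)
    (fun p a b => D (p + 1) = a.1 ≫ J.d p + E.d (p + 1) ≫ b.1)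
    ⟨k₀, by rw [Preadditive.comp_sub, ← Category.assoc, h₀, hD, sub_self]⟩ (fun p a => by
      obtain ⟨b, hb⟩ := hE.exists_d_succ_comp (hJ.sep (p + 1)) (D (p + 1) - a.1 ≫ J.d p) a.2
      refine ⟨⟨b, ?_⟩, ?_⟩
      · rw [Preadditive.comp_sub, ← Category.assoc _ b, hb, Preadditive.sub_comp, Category.assoc,
          hJ.d_d, Limits.comp_zero, sub_zero, hD, sub_self]
      · rw [hb]; abel)
  exact ⟨fun p => (s p).1, by simp only [hs]; exact h₀.symm, hR⟩

/-- Let `E^{p,q}` be a double complex, the sequence `E^{0,q} → E^{1,q} → ⋯` being locally exact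
for each `q`. A chain map `E^{0,•} ⟶ J^•` to a complex of injectives extends to a chain map from
the total complex of the `E^{p+1,q}` to `J^•`. Each component is chosen by extending a morphism
from the image of the first differential, where it is determined by the previous components;
there is no compatibility between different `q` to take care of. -/
theorem exists_lift_bicomplex (E : ℕ → PshSeq X) (hE : ∀ q, LocExact (E q))
    (d₂ : ∀ p q, (E q).obj p ⟶ (E (q + 1)).obj p)
    (comm : ∀ p q, d₂ p q ≫ (E (q + 1)).d p = (E q).d p ≫ d₂ (p + 1) q)
    (d₂_d₂ : ∀ p q, d₂ p q ≫ d₂ p (q + 1) = 0)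
    (hJ : IsInjSep J) (f : ∀ q, (E q).obj 0 ⟶ J.obj q)
    (hf : ∀ q, f q ≫ J.d q = d₂ 0 q ≫ f (q + 1)) :
    ∃ M : ∀ p q n, p + q = n → ((E q).obj (p + 1) ⟶ J.obj n),
      (∀ q, (E q).d 0 ≫ M 0 q q (zero_add q) = f q) ∧
      ∀ p q n (h : p + q = n), M p q n h ≫ J.d n =
        (E q).d (p + 1) ≫ M (p + 1) q (n + 1) (by omega) +
          (-1 : ℤ) ^ p • (d₂ (p + 1) q ≫ M p (q + 1) (n + 1) (by omega)) := by
  have := hJ.inj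
  have h₀ : ∀ q n, 0 + q = n → ∃ m : (E q).obj 1 ⟶ J.obj n,
      ∀ h' : q = n, (E q).d 0 ≫ m = f q ≫ eqToHom (by rw [h']) := by
    rintro q n h
    obtain rfl : q = n := by omega
    obtain ⟨m, hm⟩ := (hE q).exists_d_zero_comp (hJ.sep q) (f q)
    exact ⟨m, fun _ => by simpa using hm⟩
  choose m₀ hm₀ using h₀
  have hm₀' : ∀ q h, (E q).d 0 ≫ m₀ q q h = f q := fun q h => by simpa using hm₀ q q h rfl
  let S : ℕ → Type := fun p => {M : ∀ q n, p + q = n → ((E q).obj (p + 1) ⟶ J.obj n) //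
    ∀ q n h, (E q).d p ≫ (M q n h ≫ J.d n -
      (-1 : ℤ) ^ p • (d₂ (p + 1) q ≫ M (q + 1) (n + 1) (by omega))) = 0}
  obtain ⟨s, hs, hR⟩ := exists_dependent_seq (S := S)
    (fun p a b => ∀ q n (h : p + q = n), a.1 q n h ≫ J.d n =
        (E q).d (p + 1) ≫ b.1 q (n + 1) (by omega) +
          (-1 : ℤ) ^ p • (d₂ (p + 1) q ≫ a.1 (q + 1) (n + 1) (by omega)))
    ⟨m₀, fun q n h => by
      obtain rfl : q = n := by omega
      rw [Preadditive.comp_sub, ← Category.assoc, hm₀', pow_zero, one_smul, ← Category.assoc,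
        ← comm, Category.assoc, hm₀', hf, sub_self]⟩
    (fun p a => by
      have step : ∀ q n, p + 1 + q = n → ∃ b : (E q).obj (p + 2) ⟶ J.obj n,
          ∀ n' (h' : p + q = n') (e : n = n' + 1), (E q).d (p + 1) ≫ b = (a.1 q n' h' ≫ J.d n' -
            (-1 : ℤ) ^ p • (d₂ (p + 1) q ≫ a.1 (q + 1) (n' + 1) (by omega))) ≫
              eqToHom (by rw [e]) := by
        rintro q n h
        obtain ⟨n', rfl⟩ : ∃ n', n = n' + 1 := ⟨p + q, by omega⟩
        obtain ⟨b, hb⟩ := (hE q).exists_d_succ_comp (hJ.sep (n' + 1)) _ (a.2 q n' (by omega))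
        refine ⟨b, fun n'' h' e => ?_⟩
        obtain rfl : n' = n'' := by omega
        simpa using hb
      choose b hb using step
      have hb' : ∀ q n h h', (E q).d (p + 1) ≫ b q (n + 1) h = a.1 q n h' ≫ J.d n -
            (-1 : ℤ) ^ p • (d₂ (p + 1) q ≫ a.1 (q + 1) (n + 1) (by omega)) :=
        fun q n h h' => by simpa using hb q (n + 1) h n h' rfl
      refine ⟨⟨b, fun q n h => ?_⟩, fun q n h => ?_⟩
      · obtain ⟨n', rfl⟩ : ∃ n', n = n' + 1 := ⟨p + q, by omega⟩
        have e1 := hb' q n' h (by omega)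
        have e2 := hb' (q + 1) (n' + 1) (by omega) (by omega)
        rw [Preadditive.comp_sub, ← Category.assoc, e1, Preadditive.comp_zsmul,
          ← Category.assoc _ (d₂ (p + 1 + 1) q), ← comm, Category.assoc, e2]
        simp only [Preadditive.sub_comp, Preadditive.comp_sub, Category.assoc, hJ.d_d,
          Limits.comp_zero, Preadditive.zsmul_comp, Preadditive.comp_zsmul]
        rw [← Category.assoc (d₂ (p + 1) q) (d₂ (p + 1) (q + 1)), d₂_d₂, Limits.zero_comp, pow_succ]
        simp
      · rw [hb' q n (by omega) h]; abel)
  refine ⟨fun p => (s p).1, fun q => ?_, fun p q n h => hR p q n h⟩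
  simp only [hs]
  exact hm₀' q _

end PshSeq

namespace Psh

/-! ### Tensor products of presheaves -/

/-- The tensor product `U ↦ P(U) ⊗ Q(U)` of presheaves, without sheafification. -/
def tens (P Q : Psh X) : Psh X where
  obj U := ModuleCat.of ℂ (P.obj U ⊗[ℂ] Q.obj U)
  map f := ModuleCat.ofHom (TensorProduct.map (P.map f).hom (Q.map f).hom)
  map_id U := by
    ext : 1
    exact TensorProduct.ext' fun x y => by simp
  map_comp f g := by
    ext : 1
    exact TensorProduct.ext' fun x y => by simp

variable {P Q R P' Q' : Psh X}

/-- The pure tensor of two sections. -/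
def tmul {U : Opens X} (x : P.sec U) (y : Q.sec U) : (tens P Q).sec U :=
  (x ⊗ₜ[ℂ] y : P.sec U ⊗[ℂ] Q.sec U)

@[simp] lemma res_tmul {U W : Opens X} (h : W ≤ U) (x : P.sec U) (y : Q.sec U) :
    (tens P Q).res h (tmul x y) = tmul (P.res h x) (Q.res h y) := rfl

lemma tens_induction {U : Opens X} {C : (tens P Q).sec U → Prop} (t : (tens P Q).sec U)
    (zero : C 0) (tmul : ∀ x y, C (tmul x y)) (add : ∀ s t, C s → C t → C (s + t)) : C t :=
  TensorProduct.induction_on (motive := C) t zero tmul add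

lemma tens_hom_ext {f g : tens P Q ⟶ R}
    (h : ∀ U (x : P.sec U) (y : Q.sec U), app f U (tmul x y) = app g U (tmul x y)) : f = g := by
  refine hom_ext fun U t => ?_
  induction t using tens_induction with
  | zero => simp
  | tmul x y => exact h U x y
  | add s t hs ht => rw [map_add, map_add, hs, ht]

/-- The morphism from a tensor product given by a bilinear map. -/
def tensLift (φ : ∀ U : Opens X, P.sec U →ₗ[ℂ] Q.sec U →ₗ[ℂ] R.sec U)
    (hφ : ∀ {U W : Opens X} (h : W ≤ U) (x : P.sec U) (y : Q.sec U),
      φ W (P.res h x) (Q.res h y) = R.res h (φ U x y)) : tens P Q ⟶ R :=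
  let ψ : ∀ U, (tens P Q).sec U →ₗ[ℂ] R.sec U := fun U => TensorProduct.lift (φ U)
  homMk ψ fun {U W} h t => by
    induction t using tens_induction with
    | zero => rw [map_zero, map_zero, map_zero, map_zero]
    | tmul x y =>
      rw [res_tmul]
      exact hφ h x y
    | add s t hs ht => rw [map_add, map_add, hs, ht, map_add, map_add]

/-- The bilinear map `P(U) → Q(U) → (P ⊗ Q)(U)`. -/
def tmulBilin (P Q : Psh X) (U : Opens X) : P.sec U →ₗ[ℂ] Q.sec U →ₗ[ℂ] (tens P Q).sec U :=
  TensorProduct.mk ℂ (P.sec U) (Q.sec U)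

@[simp] lemma tmulBilin_apply (U : Opens X) (x : P.sec U) (y : Q.sec U) :
    tmulBilin P Q U x y = tmul x y := rfl

lemma tmul_zero {U : Opens X} (x : P.sec U) : tmul x (0 : Q.sec U) = 0 :=
  TensorProduct.tmul_zero _ _

/-- The tensor product of two morphisms of presheaves. -/
def tensMap (f : P ⟶ P') (g : Q ⟶ Q') : tens P Q ⟶ tens P' Q' :=
  tensLift (fun U => (tmulBilin P' Q' U).compl₁₂ (app f U) (app g U)) fun h x y => by
    simp [app_res]

@[simp] lemma tensMap_tmul (f : P ⟶ P') (g : Q ⟶ Q') (U : Opens X) (x : P.sec U) (y : Q.sec U) :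
    app (tensMap f g) U (tmul x y) = tmul (app f U x) (app g U y) := rfl

/-- The symmetry `P ⊗ Q ⟶ Q ⊗ P`. -/
def tensSwap (P Q : Psh X) : tens P Q ⟶ tens Q P :=
  tensLift (fun U => (tmulBilin Q P U).flip) fun _ _ _ => rfl

/-- The morphism `P ⟶ P ⊗ Q`, `x ↦ x ⊗ y`, given by a global section `y` of `Q`. -/
def tensWith (P : Psh X) (y : Q.sec ⊤) : P ⟶ tens P Q :=
  homMk (fun U => (tmulBilin P Q U).flip (Q.res le_top y)) fun {U W} h x => by
    simp

end Psh

namespace PshSeq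

open Psh

/-- The tensor product `G ⊗ E⁰ → G ⊗ E¹ → ⋯` of a presheaf and a sequence. -/
abbrev tensL (G : Psh X) (E : PshSeq X) : PshSeq X where
  obj n := tens G (E.obj n)
  d n := tensMap (𝟙 G) (E.d n)

lemma exists_of_tensMap_eq_zero {G P Q : Psh X} (f : P ⟶ Q) (U : Opens X)
    (C : (tens G P).sec U → Prop) (zero : C 0) (add : ∀ s t, C s → C t → C (s + t))
    (h : ∀ (g : G.sec U) (x : P.sec U), app f U x = 0 → C (tmul g x))
    (t : (tens G P).sec U) (ht : app (tensMap (𝟙 G) f) U t = 0) : C t := by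
  have ht' : (LinearMap.lTensor (G.sec U) (app f U)) t = 0 := ht
  have := (Module.Flat.lTensor_exact (G.sec U)
    (LinearMap.exact_subtype_ker_map (app f U)) t).1 ht'
  obtain ⟨s, rfl⟩ := this
  clear ht ht'
  induction s using TensorProduct.induction_on with
  | zero => rw [map_zero]; exact zero
  | tmul g x => exact h g x x.2
  | add s t hs ht => rw [map_add]; exact add _ _ hs ht

/-- Tensor products over a field preserve local exactness. -/
theorem LocExact.tensL {E : PshSeq X} (hE : LocExact E) (G : Psh X) : LocExact (tensL G E) where
  zero U x hx := by
    refine exists_of_tensMap_eq_zero (E.d 0) U (fun t => ∀ p ∈ U, ∃ (W : Opens X) (h : W ≤ U),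
      p ∈ W ∧ (tens G (E.obj 0)).res h t = 0) ?_ ?_ ?_ x hx
    · exact fun p hp => ⟨U, le_rfl, hp, map_zero _⟩
    · intro s t hs ht p hp
      obtain ⟨W, h, hpW, e⟩ := hs p hp
      obtain ⟨W', h', hpW', e'⟩ := ht p hp
      refine ⟨W ⊓ W', inf_le_left.trans h, ⟨hpW, hpW'⟩, ?_⟩
      rw [map_add, ← res_res h inf_le_left, e, ← res_res h' inf_le_right, e']
      simp
    · intro g x hx p hp
      obtain ⟨W, h, hpW, e⟩ := hE.zero U x hx p hp
      exact ⟨W, h, hpW, by rw [res_tmul, e, tmul_zero]⟩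
  succ n U x hx := by
    refine exists_of_tensMap_eq_zero (E.d (n + 1)) U (fun t => ∀ p ∈ U, ∃ (W : Opens X)
      (h : W ≤ U), p ∈ W ∧ ∃ w : (tens G (E.obj n)).sec W,
        app (tensMap (𝟙 G) (E.d n)) W w = (tens G (E.obj (n + 1))).res h t) ?_ ?_ ?_ x hx
    · exact fun p hp => ⟨U, le_rfl, hp, 0, by simp⟩
    · intro s t hs ht p hp
      obtain ⟨W, h, hpW, w, e⟩ := hs p hp
      obtain ⟨W', h', hpW', w', e'⟩ := ht p hp
      refine ⟨W ⊓ W', inf_le_left.trans h, ⟨hpW, hpW'⟩,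
        (tens G (E.obj n)).res inf_le_left w + (tens G (E.obj n)).res inf_le_right w', ?_⟩
      rw [map_add, app_res, app_res, e, e', res_res, res_res, map_add]
    · intro g x hx p hp
      obtain ⟨W, h, hpW, w, e⟩ := hE.succ n U x hx p hp
      exact ⟨W, h, hpW, tmul (G.res h g) w, by rw [tensMap_tmul, e, res_tmul, app_id]⟩

/-- The sequence `0 → J⁰ → J¹ → ⋯`, indexed from `0`. -/
abbrev hat (J : PshSeq X) : PshSeq X where
  obj n := match n with
    | 0 => Limits.HasZeroObject.zero' (Psh X) |>.zero
    | n + 1 => J.obj n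
  d n := match n with
    | 0 => 0
    | n + 1 => J.d n

/-- The sequence `Jˢ → Jˢ⁺¹ → ⋯`. -/
abbrev shift (s : ℕ) (J : PshSeq X) : PshSeq X where
  obj n := J.obj (s + n)
  d n := J.d (s + n)

lemma isZero_hat_zero (J : PshSeq X) : Limits.IsZero (J.hat.obj 0) := Limits.isZero_zero _

lemma hat_zero_eq_zero (J : PshSeq X) {U : Opens X} (x : (J.hat.obj 0).sec U) : x = 0 := by
  rw [← app_id U x, J.isZero_hat_zero.eq_of_src (𝟙 _) 0, app_zero]

lemma IsInjSep.hat {J : PshSeq X} (hJ : IsInjSep J) : IsInjSep J.hat where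
  d_d n := match n with
    | 0 => Limits.zero_comp
    | n + 1 => hJ.d_d n
  inj n := match n with
    | 0 => J.isZero_hat_zero.injective
    | n + 1 => hJ.inj n
  sep n := match n with
    | 0 => fun _ x _ => J.hat_zero_eq_zero x
    | n + 1 => hJ.sep n

lemma IsInjSep.shift {J : PshSeq X} (hJ : IsInjSep J) (s : ℕ) : IsInjSep (J.shift s) where
  d_d n := hJ.d_d (s + n)
  inj n := hJ.inj (s + n)
  sep n := hJ.sep (s + n)

/-- The section `x` of `Jⁿ` is a coboundary; for `n = 0` this means `x = 0`. -/
def IsCob (J : PshSeq X) {n : ℕ} {U : Opens X} (x : (J.obj n).sec U) : Prop :=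
  ∃ w : (J.hat.obj n).sec U, app (J.hat.d n) U w = x

lemma IsCob.add {J : PshSeq X} {n : ℕ} {U : Opens X} {x y : (J.obj n).sec U} (hx : J.IsCob x)
    (hy : J.IsCob y) : J.IsCob (x + y) := by
  obtain ⟨w, rfl⟩ := hx
  obtain ⟨v, rfl⟩ := hy
  exact ⟨w + v, map_add _ _ _⟩

lemma IsCob.smul {J : PshSeq X} {n : ℕ} {U : Opens X} {x : (J.obj n).sec U} (hx : J.IsCob x)
    (c : ℂ) : J.IsCob (c • x) := by
  obtain ⟨w, rfl⟩ := hx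
  exact ⟨c • w, map_smul _ _ _⟩

lemma IsCob.zero {J : PshSeq X} {n : ℕ} {U : Opens X} : J.IsCob (0 : (J.obj n).sec U) :=
  ⟨0, map_zero _⟩

lemma IsCob.neg {J : PshSeq X} {n : ℕ} {U : Opens X} {x : (J.obj n).sec U} (hx : J.IsCob x) :
    J.IsCob (-x) := by
  simpa using hx.smul (-1)

lemma isCob_zero_iff {J : PshSeq X} {U : Opens X} {x : (J.obj 0).sec U} : J.IsCob x ↔ x = 0 := by
  refine ⟨?_, fun h => h ▸ IsCob.zero⟩
  rintro ⟨w, rfl⟩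
  rfl

lemma isCob_succ_iff {J : PshSeq X} {n : ℕ} {U : Opens X} {x : (J.obj (n + 1)).sec U} :
    J.IsCob x ↔ ∃ w : (J.obj n).sec U, app (J.d n) U w = x := Iff.rfl

lemma IsCob.d_eq_zero {J : PshSeq X} (hJ : IsInjSep J) {n : ℕ} {U : Opens X}
    {x : (J.obj n).sec U} (hx : J.IsCob x) : app (J.d n) U x = 0 := by
  obtain ⟨w, rfl⟩ := hx
  exact (congrArg (fun f => app f U w) (hJ.hat.d_d n)).trans (app_zero U w)

/-- Chain maps preserve coboundaries. -/
lemma IsCob.map {J K : PshSeq X} (φ : ∀ n, J.obj n ⟶ K.obj n)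
    (hφ : ∀ n, φ n ≫ K.d n = J.d n ≫ φ (n + 1)) {n : ℕ} {U : Opens X} {x : (J.obj n).sec U}
    (hx : J.IsCob x) : K.IsCob (app (φ n) U x) := by
  cases n with
  | zero => rw [isCob_zero_iff.1 hx, map_zero]; exact IsCob.zero
  | succ n =>
    obtain ⟨w, rfl⟩ := isCob_succ_iff.1 hx
    exact isCob_succ_iff.2 ⟨app (φ n) U w, by rw [← app_comp, hφ, app_comp]⟩

end PshSeq

/-! ### Injective resolutions as sequences of presheaves -/

namespace VectSheaf

open Psh

instance preservesLimits_secFunctor (U : Opens X) :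
    Limits.PreservesFiniteLimits (secFunctor X U) := by
  unfold secFunctor
  infer_instance

/-- Exactness of sheaves in terms of sections. -/
lemma exists_local_lift {S : ShortComplex (VectSheaf X)} (hS : S.Exact) (U : Opens X)
    (x : S.X₂.sec U) (hx : secMap S.g U x = 0) (p : X) (hp : p ∈ U) :
    ∃ (W : Opens X) (h : W ≤ U), p ∈ W ∧ ∃ w : S.X₁.sec W, secMap S.f W w = S.X₂.res h x := by
  have hK : (ShortComplex.mk (Limits.kernel.ι S.g) S.g (Limits.kernel.condition _)).Exact :=
    ShortComplex.exact_of_f_is_kernel _ (Limits.kernelIsKernel _)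
  have hK' := hK.map_of_mono_of_preservesKernel (secFunctor X U)
    (by dsimp; infer_instance) (by dsimp; infer_instance)
  obtain ⟨y, hy⟩ := (ShortComplex.moduleCat_exact_iff _).1 hK' x hx
  have hepi := (S.exact_iff_epi_kernel_lift).1 hS
  obtain ⟨W, h, ⟨w, hw⟩, hpW⟩ := (TopCat.Presheaf.isLocallySurjective_iff _).1
    ((TopCat.Sheaf.isLocallySurjective_iff_epi (Limits.kernel.lift S.g S.f S.zero)).2 hepi)
    U y p hp
  refine ⟨W, h, hpW, w, ?_⟩
  have e1 : secMap S.f W w = secMap (Limits.kernel.ι S.g) W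
      (secMap (Limits.kernel.lift S.g S.f S.zero) W w) := by
    conv_lhs => rw [← Limits.kernel.lift_ι S.g S.f S.zero]
    rfl
  rw [e1]
  refine (congrArg (secMap (Limits.kernel.ι S.g) W) hw).trans ?_
  refine (app_res (Limits.kernel.ι S.g).hom h y).trans ?_
  exact congrArg (S.X₂.res h) hy

lemma secMap_injective {F G : VectSheaf X} (f : F ⟶ G) [Mono f] (U : Opens X) :
    Function.Injective (secMap f U) := by
  have : Mono ((secFunctor X U).map f) := inferInstance
  exact (ModuleCat.mono_iff_injective _).1 this

variable {F G : VectSheaf X}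

/-- The complex `I⁰ → I¹ → ⋯` of an injective resolution. -/
abbrev seq (I : InjectiveResolution F) : PshSeq X where
  obj n := (I.cocomplex.X n).obj
  d n := (I.cocomplex.d n (n + 1)).hom

/-- The sequence `F → I⁰ → I¹ → ⋯` of an injective resolution, starting with `F` in degree `0`. -/
abbrev augSeq (I : InjectiveResolution F) : PshSeq X where
  obj n := match n with
    | 0 => F.obj
    | n + 1 => (I.cocomplex.X n).obj
  d n := match n with
    | 0 => (aug I).hom
    | n + 1 => (I.cocomplex.d n (n + 1)).hom

lemma isInjSep_seq (I : InjectiveResolution F) : (seq I).IsInjSep where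
  d_d n := congrArg (fun f => f.hom) (I.cocomplex.d_comp_d n (n + 1) (n + 2))
  inj _ := injective_obj _
  sep _ := isSep_of_sheaf _

lemma aug_d (I : InjectiveResolution F) : (aug I).hom ≫ (seq I).d 0 = 0 :=
  congrArg (fun f => f.hom) I.ι_f_zero_comp_complex_d

instance mono_aug (I : InjectiveResolution F) : Mono (aug I) :=
  inferInstanceAs (Mono (I.ι.f 0))

lemma locExact_augSeq (I : InjectiveResolution F) : (augSeq I).LocExact where
  zero U x hx p hp := ⟨U, le_rfl, hp, by
    have : x = 0 := secMap_injective (aug I) U (hx.trans (map_zero _).symm)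
    rw [this, map_zero]⟩
  succ n := match n with
    | 0 => exists_local_lift I.exact₀
    | n + 1 => exists_local_lift (I.exact_succ n)

end VectSheaf

/-! ### Cohomology classes and cocycles -/

section Complex

variable (K : CochainComplex (ModuleCat.{0} ℂ) ℕ)

lemma CochainComplex.exists_iCycles_eq (n : ℕ) (x : K.X n) (hx : (K.d n (n + 1)).hom x = 0) :
    ∃ z : K.cycles n, (K.iCycles n).hom z = x :=
  (ShortComplex.moduleCat_exact_iff _).1 (ShortComplex.exact_of_f_is_kernel
    (ShortComplex.mk (K.iCycles n) (K.d n (n + 1)) (by simp))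
    (K.cyclesIsKernel n (n + 1) (by simp))) x hx

lemma CochainComplex.d_iCycles_apply (n m : ℕ) (z : K.cycles n) :
    (K.d n m).hom ((K.iCycles n).hom z) = 0 := by
  rw [← LinearMap.comp_apply, ← ModuleCat.hom_comp, K.iCycles_d]
  rfl

lemma CochainComplex.iCycles_injective (n : ℕ) : Function.Injective (K.iCycles n).hom :=
  (ModuleCat.mono_iff_injective _).1 inferInstance

lemma CochainComplex.homologyπ_surjective (n : ℕ) : Function.Surjective (K.homologyπ n).hom :=
  (ModuleCat.epi_iff_surjective _).1 inferInstance

lemma CochainComplex.homologyπ_eq_zero_iff_prev {m n : ℕ} (hmn : (ComplexShape.up ℕ).prev n = m)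
    (z : K.cycles n) :
    (K.homologyπ n).hom z = 0 ↔ ∃ w : K.X m, (K.d m n).hom w = (K.iCycles n).hom z := by
  have he := ShortComplex.exact_of_g_is_cokernel
    (ShortComplex.mk (K.toCycles m n) (K.homologyπ n) (by simp)) (K.homologyIsCokernel m n hmn)
  have hi : ∀ w : K.X m, (K.iCycles n).hom ((K.toCycles m n).hom w) = (K.d m n).hom w := by
    intro w
    rw [← LinearMap.comp_apply, ← ModuleCat.hom_comp, K.toCycles_i]
  constructor
  · intro h
    obtain ⟨w, hw⟩ := (ShortComplex.moduleCat_exact_iff _).1 he z h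
    exact ⟨w, by rw [← hi]; exact congrArg _ hw⟩
  · rintro ⟨w, hw⟩
    rw [← hi] at hw
    rw [← K.iCycles_injective n hw]
    exact (ShortComplex.mk (K.toCycles m n) (K.homologyπ n) (by simp)).moduleCat_zero_apply w

lemma CochainComplex.homologyπ_zero_eq_zero_iff (z : K.cycles 0) :
    (K.homologyπ 0).hom z = 0 ↔ (K.iCycles 0).hom z = 0 := by
  rw [K.homologyπ_eq_zero_iff_prev (m := 0) (by simp), K.shape 0 0 (by simp)]
  exact ⟨fun ⟨w, hw⟩ => hw.symm, fun h => ⟨0, by rw [h]; rfl⟩⟩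

lemma CochainComplex.homologyπ_succ_eq_zero_iff {n : ℕ} (z : K.cycles (n + 1)) :
    (K.homologyπ (n + 1)).hom z = 0 ↔
      ∃ w : K.X n, (K.d n (n + 1)).hom w = (K.iCycles (n + 1)).hom z :=
  K.homologyπ_eq_zero_iff_prev (by simp) z

end Complex

namespace VectSheaf

open Psh

variable {F G : VectSheaf X} (I : InjectiveResolution F) (I' : InjectiveResolution G)

/-- The complex `Γ(U, I^•)`. -/
abbrev secComplex (U : Opens X) : CochainComplex (ModuleCat.{0} ℂ) ℕ :=
  ((secFunctor X U).mapHomologicalComplex _).obj I.cocomplex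

/-- The class in `Hⁿ(X, F)` of a cocycle of `Γ(X, I^•)`. -/
def cocycleClass (n : ℕ) : (secComplex I ⊤).cycles n →ₗ[ℂ] F.coh n :=
  (I.isoRightDerivedObj (secFunctor X ⊤) n).inv.hom ∘ₗ ((secComplex I ⊤).homologyπ n).hom

variable {I I'} {n : ℕ}

lemma represents_iff {x : sec (I.cocomplex.X n) ⊤} {α : F.coh n} : Represents I x α ↔
    ∃ z, ((secComplex I ⊤).iCycles n).hom z = x ∧ cocycleClass I n z = α := Iff.rfl

lemma Represents.d_eq_zero {x : sec (I.cocomplex.X n) ⊤} {α : F.coh n} (h : Represents I x α) :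
    app ((seq I).d n) ⊤ x = 0 := by
  obtain ⟨z, rfl, -⟩ := h
  exact (secComplex I ⊤).d_iCycles_apply n (n + 1) z

variable (I) in
lemma exists_represents (α : F.coh n) : ∃ x, Represents I x α := by
  obtain ⟨z, hz⟩ := (secComplex I ⊤).homologyπ_surjective n
    ((I.isoRightDerivedObj (secFunctor X ⊤) n).hom.hom α)
  refine ⟨_, z, rfl, ?_⟩
  rw [hz]
  exact Iso.hom_inv_id_apply (I.isoRightDerivedObj (secFunctor X ⊤) n) α

lemma exists_represents_of_d_eq_zero (x : sec (I.cocomplex.X n) ⊤)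
    (hx : app ((seq I).d n) ⊤ x = 0) : ∃ α, Represents I x α := by
  obtain ⟨z, hz⟩ := (secComplex I ⊤).exists_iCycles_eq n x hx
  exact ⟨_, z, hz, rfl⟩

lemma Represents.add {x y : sec (I.cocomplex.X n) ⊤} {α β : F.coh n} (hx : Represents I x α)
    (hy : Represents I y β) : Represents I (x + y) (α + β) := by
  obtain ⟨z, rfl, rfl⟩ := represents_iff.1 hx
  obtain ⟨w, rfl, rfl⟩ := represents_iff.1 hy
  exact represents_iff.2 ⟨z + w, map_add _ _ _, map_add _ _ _⟩

lemma Represents.smul {x : sec (I.cocomplex.X n) ⊤} {α : F.coh n} (hx : Represents I x α)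
    (c : ℂ) : Represents I (c • x) (c • α) := by
  obtain ⟨z, rfl, rfl⟩ := represents_iff.1 hx
  exact represents_iff.2 ⟨c • z, map_smul _ _ _, map_smul _ _ _⟩

lemma Represents.sub {x y : sec (I.cocomplex.X n) ⊤} {α β : F.coh n} (hx : Represents I x α)
    (hy : Represents I y β) : Represents I (x - y) (α - β) := by
  simpa [sub_eq_add_neg] using hx.add (hy.smul (-1))

lemma Represents.zsmul {x : sec (I.cocomplex.X n) ⊤} {α : F.coh n} (hx : Represents I x α)
    (c : ℤ) : Represents I (c • x) (c • α) := by
  rw [← Int.cast_smul_eq_zsmul ℂ, ← Int.cast_smul_eq_zsmul ℂ]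
  exact hx.smul (c : ℂ)

lemma represents_zero_iff {x : sec (I.cocomplex.X n) ⊤} :
    Represents I x 0 ↔ (seq I).IsCob x := by
  have key : ∀ z : (secComplex I ⊤).cycles n, ((secComplex I ⊤).homologyπ n).hom z = 0 ↔
      (seq I).IsCob (((secComplex I ⊤).iCycles n).hom z : sec (I.cocomplex.X n) ⊤) := by
    intro z
    cases n with
    | zero =>
      rw [(secComplex I ⊤).homologyπ_zero_eq_zero_iff]
      exact (PshSeq.isCob_zero_iff (J := seq I) (U := ⊤)).symm
    | succ n => exact (secComplex I ⊤).homologyπ_succ_eq_zero_iff z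
  constructor
  · intro h
    obtain ⟨z, rfl, hz⟩ := h
    refine (key z).1 ?_
    have := congrArg (I.isoRightDerivedObj (secFunctor X ⊤) n).hom.hom hz
    exact (Iso.inv_hom_id_apply (I.isoRightDerivedObj (secFunctor X ⊤) n) _).symm.trans
      (this.trans (map_zero _))
  · intro hx
    obtain ⟨z, rfl⟩ := (secComplex I ⊤).exists_iCycles_eq n x (hx.d_eq_zero (isInjSep_seq I))
    refine represents_iff.2 ⟨z, rfl, ?_⟩
    exact (congrArg (I.isoRightDerivedObj (secFunctor X ⊤) n).inv.hom ((key z).2 hx)).trans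
      (map_zero _)

lemma Represents.unique {x : sec (I.cocomplex.X n) ⊤} {α β : F.coh n} (h : Represents I x α)
    (h' : Represents I x β) : α = β := by
  obtain ⟨z, hz, rfl⟩ := h
  obtain ⟨w, hw, rfl⟩ := h'
  rw [(secComplex I ⊤).iCycles_injective n (hz.trans hw.symm)]

/-- Two cocycles represent the same class if they differ by a coboundary. -/
lemma Represents.of_isCob_sub {x y : sec (I.cocomplex.X n) ⊤} {α : F.coh n}
    (h : Represents I x α) (hxy : (seq I).IsCob (y - x)) : Represents I y α := by
  simpa using (represents_zero_iff.2 hxy).add h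

lemma Represents.isCob_sub {x y : sec (I.cocomplex.X n) ⊤} {α : F.coh n}
    (h : Represents I x α) (h' : Represents I y α) : (seq I).IsCob (x - y) := by
  rw [← represents_zero_iff]
  simpa using h.sub h'

lemma Represents.map {f : F ⟶ G} (φ : I.cocomplex ⟶ I'.cocomplex)
    (comm : I.ι.f 0 ≫ φ.f 0 = f ≫ I'.ι.f 0) {x : sec (I.cocomplex.X n) ⊤} {α : F.coh n}
    (h : Represents I x α) : Represents I' (secMap (φ.f n) ⊤ x) (cohMap f n α) := by
  obtain ⟨z, rfl, rfl⟩ := h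
  let ψ : secComplex I ⊤ ⟶ secComplex I' ⊤ :=
    ((secFunctor X ⊤).mapHomologicalComplex _).map φ
  refine ⟨(HomologicalComplex.cyclesMap ψ n).hom z, ?_, ?_⟩
  · have := congrArg (fun f => f.hom z) (HomologicalComplex.cyclesMap_i ψ n)
    exact this
  · have e1 := congrArg (fun f => f.hom z) (HomologicalComplex.homologyπ_naturality ψ n)
    have e2 := congrArg (fun f => f.hom (((secComplex I ⊤).homologyπ n).hom z))
      (InjectiveResolution.isoRightDerivedObj_inv_naturality f I I' φ comm (secFunctor X ⊤) n)
    refine Eq.trans ?_ e2.symm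
    exact congrArg (I'.isoRightDerivedObj (secFunctor X ⊤) n).inv.hom e1.symm

variable (I) in
lemma represents_aug (s : F.sec ⊤) : Represents I (n := 0) (secMap (aug I) ⊤ s) (cohZero F s) := by
  refine ⟨(I.toRightDerivedZero' (secFunctor X ⊤)).hom s, ?_, ?_⟩
  · exact congrArg (fun f => f.hom s) (I.toRightDerivedZero'_comp_iCycles (secFunctor X ⊤))
  · exact congrArg (fun f => f.hom s) (I.toRightDerivedZero_eq (secFunctor X ⊤)).symm

/-- If `Hⁿ(U, F) = 0` for some `n > 0`, then `Γ(U, I^•)` is exact in degree `n`. -/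
lemma exists_d_eq_of_subsingleton {U : Opens X} (h : Subsingleton (cohOn U F (n + 1)))
    (x : sec (I.cocomplex.X (n + 1)) U) (hx : app ((seq I).d (n + 1)) U x = 0) :
    ∃ w : sec (I.cocomplex.X n) U, app ((seq I).d n) U w = x := by
  obtain ⟨z, rfl⟩ := (secComplex I U).exists_iCycles_eq (n + 1) x hx
  refine ((secComplex I U).homologyπ_succ_eq_zero_iff z).1 ?_
  have e := Iso.inv_hom_id_apply (I.isoRightDerivedObj (secFunctor X U) (n + 1))
    (((secComplex I U).homologyπ (n + 1)).hom z)
  have e0 : (I.isoRightDerivedObj (secFunctor X U) (n + 1)).inv.hom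
      (((secComplex I U).homologyπ (n + 1)).hom z) = 0 := h.elim _ _
  exact e.symm.trans ((congrArg (I.isoRightDerivedObj (secFunctor X U) (n + 1)).hom.hom e0).trans
    (map_zero _))

/-! ### Chain maps between injective resolutions -/

lemma desc_seq_comm (φ : I.cocomplex ⟶ I'.cocomplex) (n : ℕ) :
    (φ.f n).hom ≫ (seq I').d n = (seq I).d n ≫ (φ.f (n + 1)).hom :=
  congrArg (fun f => f.hom) (φ.comm n (n + 1))

lemma cohMap_add (f g : F ⟶ G) (n : ℕ) (α : F.coh n) :
    cohMap (f + g) n α = cohMap f n α + cohMap g n α := by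
  let I := injectiveResolution F
  let I' := injectiveResolution G
  obtain ⟨x, hx⟩ := exists_represents I α
  have hf := hx.map (InjectiveResolution.desc f I' I)
    (InjectiveResolution.desc_commutes_zero f I' I)
  have hg := hx.map (InjectiveResolution.desc g I' I)
    (InjectiveResolution.desc_commutes_zero g I' I)
  have hfg := hx.map (f := f + g)
    (InjectiveResolution.desc f I' I + InjectiveResolution.desc g I' I) (by
      rw [HomologicalComplex.add_f_apply, Preadditive.comp_add,
        InjectiveResolution.desc_commutes_zero, InjectiveResolution.desc_commutes_zero]
      exact (Preadditive.add_comp _ _ _ f g (aug I')).symm)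
  exact hfg.unique (hf.add hg)

lemma cohMap_comp {H : VectSheaf X} (f : F ⟶ G) (g : G ⟶ H) (n : ℕ) (α : F.coh n) :
    cohMap (f ≫ g) n α = cohMap g n (cohMap f n α) :=
  congrArg (fun f => f.hom α) (((secFunctor X ⊤).rightDerived n).map_comp f g)

lemma cohMap_id (n : ℕ) (α : F.coh n) : cohMap (𝟙 F) n α = α :=
  congrArg (fun f => f.hom α) (((secFunctor X ⊤).rightDerived n).map_id F)

lemma cohMap_zero (n : ℕ) (α : F.coh n) : cohMap (0 : F ⟶ G) n α = 0 := by
  simpa using cohMap_add (0 : F ⟶ G) 0 n α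

end VectSheaf

/-! ### Pairings of complexes -/

open Psh

namespace PshSeq.LocExact

variable {E K : PshSeq X}

/-- A morphism of complexes from a resolution of `E⁰` to a complex `K` of injectives, the map from
`E⁰` being lifted to `h₀ : E⁰ ⟶ K⁰`, sends cocycles to coboundaries. -/
lemma exists_d_eq (hE : E.LocExact) (hK : K.IsInjSep) (h₀ : E.obj 0 ⟶ K.obj 0)
    (D : ∀ p, E.obj (p + 1) ⟶ K.obj (p + 1)) (e₀ : h₀ ≫ K.d 0 = E.d 0 ≫ D 0)
    (e : ∀ p, D p ≫ K.d (p + 1) = E.d (p + 1) ≫ D (p + 1)) {p : ℕ} {U : Opens X}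
    (x : (E.obj (p + 1)).sec U) (hx : app (E.d (p + 1)) U x = 0) :
    ∃ w : (K.obj p).sec U, app (K.d p) U w = app (D p) U x := by
  obtain ⟨k, -, hk⟩ := hE.exists_homotopy hK
    (fun p => match p with
      | 0 => h₀
      | p + 1 => D p) (fun p => match p with
      | 0 => e₀
      | p + 1 => e p)
  refine ⟨app (k p) U x, ?_⟩
  have := congrArg (fun f => app f U x) (hk p)
  simp only [app_add, app_comp, hx, map_zero, add_zero] at this
  exact this.symm

/-- A version of `exists_d_eq` with a parameter in a presheaf `G`. -/
lemma exists_comp_d_eq (hE : E.LocExact) (hK : K.IsInjSep) {G : Psh X}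
    (h₀ : tens G (E.obj 0) ⟶ K.obj 0)
    (D : ∀ p, tens G (E.obj (p + 1)) ⟶ K.obj (p + 1))
    (e₀ : ∀ U (g : G.sec U) (x : (E.obj 0).sec U), app (K.d 0) U (app h₀ U (tmul g x)) =
      app (D 0) U (tmul g (app (E.d 0) U x)))
    (e : ∀ p U (g : G.sec U) (x : (E.obj (p + 1)).sec U),
      app (K.d (p + 1)) U (app (D p) U (tmul g x)) =
        app (D (p + 1)) U (tmul g (app (E.d (p + 1)) U x)))
    {p : ℕ} (y : (E.obj (p + 1)).sec ⊤) (hy : app (E.d (p + 1)) ⊤ y = 0) :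
    ∃ h : G ⟶ K.obj p, ∀ U (g : G.sec U),
      app (K.d p) U (app h U g) = app (D p) U (tmul g ((E.obj (p + 1)).res le_top y)) := by
  obtain ⟨k, -, hk⟩ := (hE.tensL G).exists_homotopy hK
    (fun p => match p with
      | 0 => h₀
      | p + 1 => D p) (fun p => match p with
      | 0 => tens_hom_ext e₀
      | p + 1 => tens_hom_ext (e p))
  refine ⟨tensWith G y ≫ k p, fun U g => ?_⟩
  have := congrArg (fun f => app f U (tmul g ((E.obj (p + 1)).res le_top y))) (hk p)
  simp only [app_add, app_comp, tensMap_tmul, app_res, hy, map_zero, tmul_zero, add_zero] at this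
  exact this.symm

end PshSeq.LocExact

/-- A pairing of the complexes `A^{•+1}`, `B^{•+1}` with values in the complex `J`: bilinear maps
`A^{p+1} × B^{q+1} → J^{p+q}` satisfying the Leibniz rule. In the applications `A` and `B` are
resolutions of `A⁰` and `B⁰`. -/
structure BiPairing (A B J : PshSeq X) where
  map : ∀ p q n : ℕ, p + q = n → ∀ U : Opens X,
    (A.obj (p + 1)).sec U →ₗ[ℂ] (B.obj (q + 1)).sec U →ₗ[ℂ] (J.obj n).sec U
  res_map : ∀ (p q n : ℕ) (h : p + q = n) {U W : Opens X} (hW : W ≤ U)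
    (a : (A.obj (p + 1)).sec U) (b : (B.obj (q + 1)).sec U),
    map p q n h W ((A.obj (p + 1)).res hW a) ((B.obj (q + 1)).res hW b) =
      (J.obj n).res hW (map p q n h U a b)
  leibniz : ∀ (p q n : ℕ) (h : p + q = n) (U : Opens X)
    (a : (A.obj (p + 1)).sec U) (b : (B.obj (q + 1)).sec U),
    app (J.d n) U (map p q n h U a b) =
      map (p + 1) q (n + 1) (by omega) U (app (A.d (p + 1)) U a) b +
      (-1 : ℤ) ^ p • map p (q + 1) (n + 1) (by omega) U a (app (B.d (q + 1)) U b)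

namespace BiPairing

variable {A B J : PshSeq X}

/-- The difference of two pairings of complexes. -/
def sub (M N : BiPairing A B J) : BiPairing A B J where
  map p q n h U := M.map p q n h U - N.map p q n h U
  res_map p q n h U W hW a b := by
    simp only [LinearMap.sub_apply, M.res_map, N.res_map, map_sub]
  leibniz p q n h U a b := by
    simp only [LinearMap.sub_apply, map_sub, M.leibniz, N.leibniz, smul_sub]
    abel

/-- A pairing with values in `J` followed by a chain map `J ⟶ K`. -/
def postcomp {K : PshSeq X} (N : BiPairing A B J) (φ : ∀ n, J.obj n ⟶ K.obj n)
    (hφ : ∀ n, φ n ≫ K.d n = J.d n ≫ φ (n + 1)) : BiPairing A B K where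
  map p q n h U := (N.map p q n h U).compr₂ (app (φ n) U)
  res_map p q n h U W hW a b := by
    simp only [LinearMap.compr₂_apply, N.res_map, app_res]
  leibniz p q n h U a b := by
    simp only [LinearMap.compr₂_apply]
    rw [← app_comp, hφ, app_comp, N.leibniz, map_add, map_zsmul]

/-- A pairing of `A` and `B` composed with chain maps `A' ⟶ A` and `B' ⟶ B`. -/
def precomp {A' B' : PshSeq X} (N : BiPairing A B J)
    (φ : ∀ n, A'.obj (n + 1) ⟶ A.obj (n + 1))
    (hφ : ∀ n, φ n ≫ A.d (n + 1) = A'.d (n + 1) ≫ φ (n + 1))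
    (ψ : ∀ n, B'.obj (n + 1) ⟶ B.obj (n + 1))
    (hψ : ∀ n, ψ n ≫ B.d (n + 1) = B'.d (n + 1) ≫ ψ (n + 1)) : BiPairing A' B' J where
  map p q n h U := (N.map p q n h U).compl₁₂ (app (φ p) U) (app (ψ q) U)
  res_map p q n h U W hW a b := by
    simp only [LinearMap.compl₁₂_apply, app_res, N.res_map]
  leibniz p q n h U a b := by
    simp only [LinearMap.compl₁₂_apply]
    rw [N.leibniz, ← app_comp, ← app_comp, hφ, hψ, app_comp, app_comp]

/-- Any morphism `A⁰ ⊗ B⁰ ⟶ J⁰` whose values are cocycles extends to a pairing of complexes. -/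
theorem exists_extension (hA : A.LocExact) (hB : B.LocExact) (hdB : ∀ n, B.d n ≫ B.d (n + 1) = 0)
    (hJ : J.IsInjSep) (g : tens (A.obj 0) (B.obj 0) ⟶ J.obj 0) (hg : g ≫ J.d 0 = 0) :
    ∃ N : BiPairing A B J, ∀ U (a : (A.obj 0).sec U) (b : (B.obj 0).sec U),
      N.map 0 0 0 rfl U (app (A.d 0) U a) (app (B.d 0) U b) = app g U (tmul a b) := by
  obtain ⟨θ, hθ₀, hθ⟩ := (hB.tensL (A.obj 0)).exists_lift hJ g hg
  obtain ⟨M, hM₀, hM⟩ := PshSeq.exists_lift_bicomplex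
    (fun q => PshSeq.tensL (B.obj (q + 1)) A) (fun q => hA.tensL _)
    (fun p q => tensMap (B.d (q + 1)) (𝟙 (A.obj p)))
    (fun p q => tens_hom_ext fun U x y => rfl)
    (fun p q => tens_hom_ext fun U x y => by
      have := congrArg (fun f => app f U x) (hdB (q + 1))
      simp only [app_comp] at this
      rw [app_comp, tensMap_tmul, tensMap_tmul, this]
      exact TensorProduct.zero_tmul _ _)
    hJ (fun q => tensSwap _ _ ≫ θ q) (fun q => by
      rw [Category.assoc, hθ]
      exact tens_hom_ext fun U x y => rfl)
  refine ⟨⟨fun p q n h U => ((tmulBilin _ _ U).compr₂ (app (M p q n h) U)).flip,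
    fun p q n h U W hW a b => ?_, fun p q n h U a b => ?_⟩, fun U a b => ?_⟩
  · exact app_res (M p q n h) hW (tmul b a)
  · exact congrArg (fun f => app f U (tmul b a)) (hM p q n h)
  · refine (congrArg (fun f => app f U (tmul (app (B.d 0) U b) a)) (hM₀ 0)).trans ?_
    exact congrArg (fun f => app f U (tmul a b)) hθ₀

/-- A pairing of resolutions which vanishes on `A⁰ × B⁰` induces zero in cohomology. The
null-homotopy is constructed in one variable at a time: after the first step the second variable
can be fixed to be the given cocycle. -/
theorem isCob_of_aug_eq_zero (N : BiPairing A B J) (hA : A.LocExact) (hB : B.LocExact)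
    (hdA : A.d 0 ≫ A.d 1 = 0) (hJ : J.IsInjSep)
    (h₀ : ∀ U (a : (A.obj 0).sec U) (b : (B.obj 0).sec U),
      N.map 0 0 0 rfl U (app (A.d 0) U a) (app (B.d 0) U b) = 0)
    {p q n : ℕ} (h : p + q = n) (x : (A.obj (p + 1)).sec ⊤) (hx : app (A.d (p + 1)) ⊤ x = 0)
    (y : (B.obj (q + 1)).sec ⊤) (hy : app (B.d (q + 1)) ⊤ y = 0) :
    J.IsCob (N.map p q n h ⊤ x y) := by
  obtain rfl : n = q + p := by omega
  have hε : ∀ U (a : (A.obj 0).sec U), app (A.d 1) U (app (A.d 0) U a) = 0 := fun U a => by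
    rw [← app_comp, hdA, app_zero]
  have hy' : ∀ U : Opens X, app (B.d (q + 1)) U ((B.obj (q + 1)).res le_top y) = 0 := fun U => by
    rw [app_res, hy, map_zero]
  obtain ⟨k, hk⟩ := hB.exists_comp_d_eq hJ.hat (0 : tens (A.obj 0) (B.obj 0) ⟶ J.hat.obj 0)
    (fun r => tensLift (fun U => N.map 0 r r (zero_add r) U ∘ₗ app (A.d 0) U) (by
      intro U W h a b
      simp only [LinearMap.comp_apply]
      rw [app_res, N.res_map]))
    (fun U a b => (h₀ U a b).symm)
    (fun r U a b => by
      refine (N.leibniz 0 r r (zero_add r) U _ b).trans ?_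
      rw [hε, map_zero, LinearMap.zero_apply, zero_add, pow_zero, one_smul]
      rfl) y hy
  obtain ⟨w, hw⟩ := hA.exists_d_eq (hJ.hat.shift q) k
    (fun r => tensWith (A.obj (r + 1)) y ≫ tensLift (fun U => N.map r q (q + r) (add_comm r q) U)
        (fun h a b => N.res_map r q _ _ h a b))
    (hom_ext fun U a => hk U a)
    (fun r => hom_ext fun U a => by
      refine (N.leibniz r q (q + r) (add_comm r q) U a _).trans ?_
      rw [hy', map_zero, smul_zero, add_zero]
      rfl) x hx
  refine ⟨w, hw.trans ?_⟩
  change N.map p q (q + p) _ ⊤ x ((B.obj (q + 1)).res le_top y) = _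
  rw [res_self]

end BiPairing

/-! ### The cup product -/

namespace VectSheaf

variable {F : VectSheaf X} {m : Pairing F F F} {I I' : InjectiveResolution F}

/-- An extension of a multiplication to an injective resolution as a pairing of complexes. -/
def PairingExtension.toBiPairing (M : PairingExtension m I) :
    BiPairing (augSeq I) (augSeq I) (seq I) where
  map p q n h U := (M.mul p q n h).map U
  res_map p q n h _ _ hW a b := ((M.mul p q n h).res_map hW a b).symm
  leibniz := M.leibniz

lemma augSeq_d_d (I : InjectiveResolution F) (n : ℕ) :
    (augSeq I).d n ≫ (augSeq I).d (n + 1) = 0 := by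
  cases n with
  | zero => exact aug_d I
  | succ n => exact (isInjSep_seq I).d_d n

variable (m I) in
lemma nonempty_pairingExtension : Nonempty (PairingExtension m I) := by
  obtain ⟨N, hN⟩ := BiPairing.exists_extension (locExact_augSeq I) (locExact_augSeq I)
    (augSeq_d_d I) (isInjSep_seq I)
    (tensLift (R := F.obj) m.map (fun h x y => (m.res_map h x y).symm) ≫ (aug I).hom) (by
      rw [Category.assoc, aug_d, Limits.comp_zero])
  exact ⟨{
    mul := fun p q n h => ⟨N.map p q n h, fun hW a b => (N.res_map p q n h hW a b).symm⟩
    leibniz := N.leibniz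
    mul_aug := fun U a b => hN U a b }⟩

lemma PairingExtension.isCob_mul_left (M : PairingExtension m I) {p q n : ℕ} (h : p + q = n)
    {x : sec (I.cocomplex.X p) ⊤} {y : sec (I.cocomplex.X q) ⊤} (hx : (seq I).IsCob x)
    (hy : app ((seq I).d q) ⊤ y = 0) : (seq I).IsCob ((M.mul p q n h).map ⊤ x y) := by
  obtain ⟨w, rfl⟩ := hx
  cases p with
  | zero =>
    have : app ((seq I).hat.d 0) ⊤ w = 0 := rfl
    rw [this, map_zero]
    exact PshSeq.IsCob.zero
  | succ p =>
    obtain ⟨n', rfl⟩ : ∃ n', n = n' + 1 := ⟨p + q, by omega⟩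
    refine ⟨(M.mul p q n' (by omega)).map ⊤ w y, ?_⟩
    refine (M.leibniz p q n' (by omega) ⊤ w y).trans ?_
    have e : secMap (I.cocomplex.d q (q + 1)) ⊤ y = 0 := hy
    rw [e, map_zero, smul_zero, add_zero]
    rfl

lemma PairingExtension.isCob_mul_right (M : PairingExtension m I) {p q n : ℕ} (h : p + q = n)
    {x : sec (I.cocomplex.X p) ⊤} {y : sec (I.cocomplex.X q) ⊤}
    (hx : app ((seq I).d p) ⊤ x = 0) (hy : (seq I).IsCob y) :
    (seq I).IsCob ((M.mul p q n h).map ⊤ x y) := by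
  obtain ⟨v, rfl⟩ := hy
  cases q with
  | zero =>
    have : app ((seq I).hat.d 0) ⊤ v = 0 := rfl
    rw [this, map_zero]
    exact PshSeq.IsCob.zero
  | succ q =>
    obtain ⟨n', rfl⟩ : ∃ n', n = n' + 1 := ⟨p + q, by omega⟩
    have h3 : (seq I).IsCob (n := n' + 1) ((-1 : ℤ) ^ p • (M.mul p (q + 1) (n' + 1) h).map ⊤
        x (app ((seq I).hat.d (q + 1)) ⊤ v)) := by
      refine ⟨(M.mul p q n' (by omega)).map ⊤ x v, ?_⟩
      refine (M.leibniz p q n' (by omega) ⊤ _ v).trans ?_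
      have e : secMap (I.cocomplex.d p (p + 1)) ⊤ x = 0 := hx
      rw [e, map_zero, LinearMap.zero_apply, zero_add]
      rfl
    rcases neg_one_pow_eq_or ℤ p with h4 | h4
    · simpa only [h4, one_smul] using h3
    · rw [h4, neg_one_smul] at h3
      simpa using h3.neg

/-- If `m'(f a, g b) = k m(a, b)`, then the products of cocycles computed with extensions of `m`
and `m'` to injective resolutions satisfy the same relation in cohomology. -/
theorem represents_mul_map {m' : Pairing F F F} (M : PairingExtension m I)
    (M' : PairingExtension m' I') {f g k : F ⟶ F}
    (hm : ∀ U a b, secMap k U (m.map U a b) = m'.map U (secMap f U a) (secMap g U b))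
    {p q n : ℕ} (h : p + q = n) {x : sec (I.cocomplex.X p) ⊤} {y : sec (I.cocomplex.X q) ⊤}
    {x' : sec (I'.cocomplex.X p) ⊤} {y' : sec (I'.cocomplex.X q) ⊤}
    {α : F.coh p} {β : F.coh q} {γ : F.coh n}
    (hx : Represents I x α) (hy : Represents I y β)
    (hx' : Represents I' x' (cohMap f p α)) (hy' : Represents I' y' (cohMap g q β))
    (hγ : Represents I ((M.mul p q n h).map ⊤ x y) γ) :
    Represents I' ((M'.mul p q n h).map ⊤ x' y') (cohMap k n γ) := by
  let φ := fun f : F ⟶ F => InjectiveResolution.desc f I' I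
  have hφ : ∀ f, I.ι.f 0 ≫ (φ f).f 0 = f ≫ I'.ι.f 0 :=
    fun f => InjectiveResolution.desc_commutes_zero f I' I
  have hφ' : ∀ f U (a : F.sec U), secMap ((φ f).f 0) U (secMap (aug I) U a) =
      secMap (aug I') U (secMap f U a) := fun f U a => congrArg (fun t => secMap t U a) (hφ f)
  let N₁ : BiPairing (augSeq I) (augSeq I) (seq I') := M.toBiPairing.postcomp
    (fun n => ((φ k).f n).hom) (desc_seq_comm (φ k))
  let N₂ : BiPairing (augSeq I) (augSeq I) (seq I') := M'.toBiPairing.precomp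
    (fun n => ((φ f).f n).hom) (desc_seq_comm (φ f))
    (fun n => ((φ g).f n).hom) (desc_seq_comm (φ g))
  have h1 : (seq I').IsCob ((N₂.sub N₁).map p q n h ⊤ x y) := by
    refine (N₂.sub N₁).isCob_of_aug_eq_zero (locExact_augSeq I) (locExact_augSeq I)
      (augSeq_d_d I 0) (isInjSep_seq I') (fun U a b => ?_) h x hx.d_eq_zero y hy.d_eq_zero
    refine sub_eq_zero.2 ?_
    change (M'.mul 0 0 0 rfl).map U (secMap ((φ f).f 0) U (secMap (aug I) U a))
      (secMap ((φ g).f 0) U (secMap (aug I) U b)) =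
        secMap ((φ k).f 0) U ((M.mul 0 0 0 rfl).map U (secMap (aug I) U a) (secMap (aug I) U b))
    rw [hφ', hφ', M'.mul_aug, M.mul_aug, hφ', hm]
  have hfx := hx.map (φ f) (hφ f)
  have hgy := hy.map (φ g) (hφ g)
  have h2 := (hγ.map (φ k) (hφ k)).of_isCob_sub (y := (M'.mul p q n h).map ⊤
    (secMap ((φ f).f p) ⊤ x) (secMap ((φ g).f q) ⊤ y)) h1
  refine h2.of_isCob_sub ?_
  have e := (M'.isCob_mul_left h (hx'.isCob_sub hfx) hy'.d_eq_zero).add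
    (M'.isCob_mul_right h hfx.d_eq_zero (hy'.isCob_sub hgy))
  rw [map_sub, map_sub, LinearMap.sub_apply, sub_add_sub_cancel] at e
  exact e

variable (m) in
lemma exists_cup : ∃ c : ∀ p q : ℕ, F.coh p →ₗ[ℂ] F.coh q →ₗ[ℂ] F.coh (p + q),
    IsCupProduct m c := by
  let I₀ := injectiveResolution F
  let M₀ : PairingExtension m I₀ := (nonempty_pairingExtension m I₀).some
  choose rep hrep using fun n => exists_represents (F := F) (n := n) I₀
  have hd : ∀ p q (α : F.coh p) (β : F.coh q), app ((seq I₀).d (p + q)) ⊤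
      ((M₀.mul p q (p + q) rfl).map ⊤ (rep p α) (rep q β)) = 0 := by
    intro p q α β
    refine (M₀.leibniz p q _ rfl ⊤ _ _).trans ?_
    have e1 : secMap (I₀.cocomplex.d p (p + 1)) ⊤ (rep p α) = 0 := (hrep p α).d_eq_zero
    have e2 : secMap (I₀.cocomplex.d q (q + 1)) ⊤ (rep q β) = 0 := (hrep q β).d_eq_zero
    rw [e1, e2, map_zero, map_zero, LinearMap.zero_apply, smul_zero, add_zero]
  choose c hc using fun p q (α : F.coh p) (β : F.coh q) =>
    exists_represents_of_d_eq_zero _ (hd p q α β)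
  have key : ∀ (I : InjectiveResolution F) (M : PairingExtension m I) (p q : ℕ)
      (x : sec (I.cocomplex.X p) ⊤) (y : sec (I.cocomplex.X q) ⊤) (α : F.coh p) (β : F.coh q),
      Represents I x α → Represents I y β →
        Represents I ((M.mul p q (p + q) rfl).map ⊤ x y) (c p q α β) := by
    intro I M p q x y α β hx hy
    have := represents_mul_map M₀ M (f := 𝟙 F) (g := 𝟙 F) (k := 𝟙 F) (fun U a b => rfl) rfl
      (hrep p α) (hrep q β) (by rwa [cohMap_id]) (by rwa [cohMap_id]) (hc p q α β)
    rwa [cohMap_id] at this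
  refine ⟨fun p q => LinearMap.mk₂ ℂ (c p q) ?_ ?_ ?_ ?_,
    fun I => ⟨nonempty_pairingExtension m I, fun M p q x y α β hx hy => key I M p q x y α β hx hy⟩⟩
  · intro α α' β
    have h := key I₀ M₀ p q _ _ _ _ ((hrep p α).add (hrep p α')) (hrep q β)
    rw [map_add, LinearMap.add_apply] at h
    exact h.unique ((hc p q α β).add (hc p q α' β))
  · intro t α β
    have h := key I₀ M₀ p q _ _ _ _ ((hrep p α).smul t) (hrep q β)
    rw [map_smul, LinearMap.smul_apply] at h
    exact h.unique ((hc p q α β).smul t)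
  · intro α β β'
    have h := key I₀ M₀ p q _ _ _ _ (hrep p α) ((hrep q β).add (hrep q β'))
    rw [map_add] at h
    exact h.unique ((hc p q α β).add (hc p q α β'))
  · intro t α β
    have h := key I₀ M₀ p q _ _ _ _ (hrep p α) ((hrep q β).smul t)
    rw [map_smul] at h
    exact h.unique ((hc p q α β).smul t)

variable (m) in
/-- The multiplication on cohomology induced by a multiplication of the sheaf. -/
def cup (p q : ℕ) : F.coh p →ₗ[ℂ] F.coh q →ₗ[ℂ] F.coh (p + q) := (exists_cup m).choose p q

variable (m) in
lemma isCupProduct_cup : IsCupProduct m (cup m) := (exists_cup m).choose_spec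

lemma Represents.cup {p q : ℕ} {x : sec (I.cocomplex.X p) ⊤} {y : sec (I.cocomplex.X q) ⊤}
    {α : F.coh p} {β : F.coh q} (hx : Represents I x α) (hy : Represents I y β)
    (M : PairingExtension m I) :
    Represents I ((M.mul p q (p + q) rfl).map ⊤ x y) (VectSheaf.cup m p q α β) :=
  (isCupProduct_cup m I).2 M p q x y α β hx hy

/-- Naturality of the cup product. -/
theorem cohMap_cup {m' : Pairing F F F} {f g k : F ⟶ F}
    (hm : ∀ U a b, secMap k U (m.map U a b) = m'.map U (secMap f U a) (secMap g U b))
    {p q : ℕ} (α : F.coh p) (β : F.coh q) :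
    cohMap k (p + q) (cup m p q α β) = cup m' p q (cohMap f p α) (cohMap g q β) := by
  let I := injectiveResolution F
  obtain ⟨x, hx⟩ := exists_represents I α
  obtain ⟨y, hy⟩ := exists_represents I β
  obtain ⟨x', hx'⟩ := exists_represents I (cohMap f p α)
  obtain ⟨y', hy'⟩ := exists_represents I (cohMap g q β)
  obtain ⟨M⟩ := nonempty_pairingExtension m I
  obtain ⟨M'⟩ := nonempty_pairingExtension m' I
  exact (represents_mul_map M M' hm rfl hx hy hx' hy' (hx.cup hy M)).unique (hx'.cup hy' M')

end VectSheaf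

/-! ### Trilinear maps -/

namespace Psh

variable {P Q R T : Psh X}

/-- The morphism from a triple tensor product given by a trilinear map. -/
def tensLift₃ (φ : ∀ U : Opens X, P.sec U →ₗ[ℂ] Q.sec U →ₗ[ℂ] R.sec U →ₗ[ℂ] T.sec U)
    (hφ : ∀ {U W : Opens X} (h : W ≤ U) (x : P.sec U) (y : Q.sec U) (z : R.sec U),
      φ W (P.res h x) (Q.res h y) (R.res h z) = T.res h (φ U x y z)) :
    tens (tens P Q) R ⟶ T :=
  let ψ : ∀ U, (tens P Q).sec U →ₗ[ℂ] R.sec U →ₗ[ℂ] T.sec U := fun U => TensorProduct.lift (φ U)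
  tensLift ψ fun {U W} h s z => by
    induction s using tens_induction with
    | zero => simp only [map_zero, LinearMap.zero_apply]
    | tmul x y => exact hφ h x y z
    | add s t hs ht => simp only [map_add, LinearMap.add_apply, hs, ht]

@[simp] lemma tensLift₃_tmul
    (φ : ∀ U : Opens X, P.sec U →ₗ[ℂ] Q.sec U →ₗ[ℂ] R.sec U →ₗ[ℂ] T.sec U)
    (hφ : ∀ {U W : Opens X} (h : W ≤ U) (x : P.sec U) (y : Q.sec U) (z : R.sec U),
      φ W (P.res h x) (Q.res h y) (R.res h z) = T.res h (φ U x y z)) (U : Opens X)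
    (x : P.sec U) (y : Q.sec U) (z : R.sec U) :
    app (tensLift₃ φ hφ) U (tmul (tmul x y) z) = φ U x y z := rfl

lemma zero_tmul {U : Opens X} (y : Q.sec U) : tmul (0 : P.sec U) y = 0 :=
  TensorProduct.zero_tmul _ _

lemma add_tmul {U : Opens X} (x x' : P.sec U) (y : Q.sec U) :
    tmul (x + x') y = tmul x y + tmul x' y := TensorProduct.add_tmul _ _ _

end Psh

/-- The trilinear analogue of `BiPairing`. -/
structure TriPairing (A B C J : PshSeq X) where
  map : ∀ p q r n : ℕ, p + q + r = n → ∀ U : Opens X, (A.obj (p + 1)).sec U →ₗ[ℂ]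
    (B.obj (q + 1)).sec U →ₗ[ℂ] (C.obj (r + 1)).sec U →ₗ[ℂ] (J.obj n).sec U
  res_map : ∀ (p q r n : ℕ) (h : p + q + r = n) {U W : Opens X} (hW : W ≤ U)
    (a : (A.obj (p + 1)).sec U) (b : (B.obj (q + 1)).sec U) (c : (C.obj (r + 1)).sec U),
    map p q r n h W ((A.obj (p + 1)).res hW a) ((B.obj (q + 1)).res hW b)
      ((C.obj (r + 1)).res hW c) = (J.obj n).res hW (map p q r n h U a b c)
  leibniz : ∀ (p q r n : ℕ) (h : p + q + r = n) (U : Opens X)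
    (a : (A.obj (p + 1)).sec U) (b : (B.obj (q + 1)).sec U) (c : (C.obj (r + 1)).sec U),
    app (J.d n) U (map p q r n h U a b c) =
      map (p + 1) q r (n + 1) (by omega) U (app (A.d (p + 1)) U a) b c +
      (-1 : ℤ) ^ p • map p (q + 1) r (n + 1) (by omega) U a (app (B.d (q + 1)) U b) c +
      (-1 : ℤ) ^ (p + q) • map p q (r + 1) (n + 1) (by omega) U a b (app (C.d (r + 1)) U c)

namespace TriPairing

variable {A B C J K : PshSeq X}

/-- Let `g : A⁰ ⊗ B⁰ ⊗ C⁰ ⟶ K⁰` have values in cocycles. For cocycles `x`, `y`, `z` there is a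
cocycle `u` of `K`, which plays the role of `g(x ⊗ y ⊗ z)`: whenever a trilinear pairing `N` of
complexes with values in `J` restricts to `φ ∘ g` for a chain map `φ : K ⟶ J`, then `φ(u)` and
`N(x, y, z)` are cohomologous. Both the construction of `u` and the comparison proceed one
variable at a time, starting with the last one. -/
theorem exists_universal (hA : A.LocExact) (hB : B.LocExact) (hC : C.LocExact)
    (hdA : A.d 0 ≫ A.d 1 = 0) (hdB : B.d 0 ≫ B.d 1 = 0) (hK : K.IsInjSep)
    (g : tens (tens (A.obj 0) (B.obj 0)) (C.obj 0) ⟶ K.obj 0) (hg : g ≫ K.d 0 = 0)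
    {p q r n : ℕ} (h : p + q + r = n)
    (x : (A.obj (p + 1)).sec ⊤) (hx : app (A.d (p + 1)) ⊤ x = 0)
    (y : (B.obj (q + 1)).sec ⊤) (hy : app (B.d (q + 1)) ⊤ y = 0)
    (z : (C.obj (r + 1)).sec ⊤) (hz : app (C.d (r + 1)) ⊤ z = 0) :
    ∃ u : (K.obj n).sec ⊤, app (K.d n) ⊤ u = 0 ∧
      ∀ (J : PshSeq X) (_ : J.IsInjSep) (φ : ∀ n, K.obj n ⟶ J.obj n)
        (_ : ∀ n, φ n ≫ J.d n = K.d n ≫ φ (n + 1)) (N : TriPairing A B C J),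
        (∀ U (a : (A.obj 0).sec U) (b : (B.obj 0).sec U) (c : (C.obj 0).sec U),
          N.map 0 0 0 0 rfl U (app (A.d 0) U a) (app (B.d 0) U b) (app (C.d 0) U c) =
            app (φ 0) U (app g U (tmul (tmul a b) c))) →
        J.IsCob (app (φ n) ⊤ u - N.map p q r n h ⊤ x y z) := by
  obtain rfl : n = r + q + p := by omega
  have hεA : ∀ U (a : (A.obj 0).sec U), app (A.d 1) U (app (A.d 0) U a) = 0 := fun U a => by
    rw [← app_comp, hdA, app_zero]
  have hεB : ∀ U (b : (B.obj 0).sec U), app (B.d 1) U (app (B.d 0) U b) = 0 := fun U b => by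
    rw [← app_comp, hdB, app_zero]
  have hy' : ∀ U : Opens X, app (B.d (q + 1)) U ((B.obj (q + 1)).res le_top y) = 0 := fun U => by
    rw [app_res, hy, map_zero]
  have hz' : ∀ U : Opens X, app (C.d (r + 1)) U ((C.obj (r + 1)).res le_top z) = 0 := fun U => by
    rw [app_res, hz, map_zero]
  -- the construction of `u`
  obtain ⟨θ₃, h₃, e₃⟩ := (hC.tensL (tens (A.obj 0) (B.obj 0))).exists_lift hK g hg
  have E₃ : ∀ c U t (s : (C.obj (c + 1)).sec U), app (K.d c) U (app (θ₃ c) U (tmul t s)) =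
      app (θ₃ (c + 1)) U (tmul t (app (C.d (c + 1)) U s)) := fun c U t s =>
    congrArg (fun f => app f U (tmul t s)) (e₃ c)
  obtain ⟨θ₂, h₂, e₂⟩ := (hB.tensL (A.obj 0)).exists_lift (hK.shift r)
    (tensWith (tens (A.obj 0) (B.obj 0)) z ≫ θ₃ r) (hom_ext fun U t => by
      refine (E₃ r U t _).trans ?_
      rw [hz', tmul_zero, map_zero, app_zero])
  have E₂ : ∀ b U t (s : (B.obj (b + 1)).sec U), app (K.d (r + b)) U (app (θ₂ b) U (tmul t s)) =
      app (θ₂ (b + 1)) U (tmul t (app (B.d (b + 1)) U s)) := fun b U t s =>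
    congrArg (fun f => app f U (tmul t s)) (e₂ b)
  obtain ⟨θ₁, h₁, e₁⟩ := hA.exists_lift (hK.shift (r + q))
    (tensWith (A.obj 0) y ≫ θ₂ q) (hom_ext fun U t => by
      refine (E₂ q U t _).trans ?_
      rw [hy', tmul_zero, map_zero, app_zero])
  have E₁ : ∀ a U (s : (A.obj (a + 1)).sec U), app (K.d (r + q + a)) U (app (θ₁ a) U s) =
      app (θ₁ (a + 1)) U (app (A.d (a + 1)) U s) := fun a U s =>
    congrArg (fun f => app f U s) (e₁ a)
  refine ⟨app (θ₁ p) ⊤ x, by rw [E₁, hx, map_zero], fun J hJ φ hφ N hN => ?_⟩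
  have hφ' : ∀ n U (s : (K.obj n).sec U), app (J.d n) U (app (φ n) U s) =
      app (φ (n + 1)) U (app (K.d n) U s) := fun n U s => congrArg (fun f => app f U s) (hφ n)
  -- the comparison
  obtain ⟨k₃, hk₃⟩ := hC.exists_comp_d_eq hJ.hat
    (0 : tens (tens (A.obj 0) (B.obj 0)) (C.obj 0) ⟶ J.hat.obj 0)
    (fun c => θ₃ c ≫ φ c - tensLift₃ (fun U => (N.map 0 0 c c (by omega) U).compl₁₂
      (app (A.d 0) U) (app (B.d 0) U)) (fun {U W} h a b s => by
        simp only [LinearMap.compl₁₂_apply]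
        rw [app_res, app_res, N.res_map]))
    (fun U t c => by
      refine Eq.symm ?_
      induction t using tens_induction with
      | zero => rw [zero_tmul, map_zero]; rfl
      | tmul a b =>
        refine sub_eq_zero.2 (Eq.trans ?_ (hN U a b c).symm)
        exact congrArg (app (φ 0) U) (congrArg (fun f => app f U (tmul (tmul a b) c)) h₃)
      | add s t hs ht => rw [add_tmul, map_add, hs, ht]; exact add_zero _)
    (fun c U t s => by
      induction t using tens_induction with
      | zero => simp only [zero_tmul, map_zero]
      | tmul a b =>
        simp only [app_sub, app_comp, map_sub]
        refine congrArg₂ _ ?_ ?_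
        · rw [hφ', E₃]
        · refine (N.leibniz 0 0 c c (by omega) U _ _ _).trans ?_
          rw [hεA, hεB]
          simp
      | add t t' ht ht' => simp only [add_tmul, map_add, ht, ht']) z hz
  obtain ⟨k₂, hk₂⟩ := hB.exists_comp_d_eq (hJ.hat.shift r) k₃
    (fun b => θ₂ b ≫ φ (r + b) - tensLift
      (fun U => ((N.map 0 b r (r + b) (by omega) U ∘ₗ app (A.d 0) U).flip.compr₂
        (LinearMap.applyₗ ((C.obj (r + 1)).res le_top z))).flip) (fun {U W} h a b => by
        simp only [LinearMap.flip_apply, LinearMap.compr₂_apply, LinearMap.comp_apply,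
          LinearMap.applyₗ_apply_apply]
        rw [app_res, ← res_res le_top h, N.res_map]))
    (fun U a b => by
      refine (hk₃ U (tmul a b)).trans ?_
      refine congrArg₂ _ (congrArg (app (φ r) U) ?_) rfl
      exact (congrArg (fun f => app f U (tmul a b)) h₂).symm)
    (fun c U a s => by
      simp only [app_sub, app_comp, map_sub]
      refine congrArg₂ _ ?_ ?_
      · refine (hφ' (r + c + 1 - 1) U _).trans ?_
        exact congrArg (app (φ (r + c + 1)) U) (E₂ c U a s)
      · refine (N.leibniz 0 c r (r + c) (by omega) U _ _ _).trans ?_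
        rw [hεA, hz']
        simp
        rfl) y hy
  obtain ⟨w, hw⟩ := hA.exists_d_eq (hJ.hat.shift (r + q)) k₂
    (fun a => θ₁ a ≫ φ (r + q + a) - homMk (fun U =>
      LinearMap.applyₗ ((C.obj (r + 1)).res le_top z) ∘ₗ
        (N.map a q r (r + q + a) (by omega) U).flip ((B.obj (q + 1)).res le_top y))
      (fun {U W} h a => by
        simp only [LinearMap.flip_apply, LinearMap.comp_apply, LinearMap.applyₗ_apply_apply]
        rw [← res_res le_top h, ← res_res le_top h, N.res_map]))
    (hom_ext fun U a => by
      refine (hk₂ U a).trans ?_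
      refine congrArg₂ _ (congrArg (app (φ (r + q)) U) ?_) rfl
      exact (congrArg (fun f => app f U a) h₁).symm)
    (fun a => hom_ext fun U s => by
      simp only [app_sub, app_comp, map_sub]
      refine congrArg₂ _ ?_ ?_
      · refine (hφ' (r + q + a) U _).trans ?_
        exact congrArg (app (φ (r + q + a + 1)) U) (E₁ a U s)
      · refine (N.leibniz a q r (r + q + a) (by omega) U _ _ _).trans ?_
        rw [hy', hz']
        simp
        rfl) x hx
  refine ⟨w, hw.trans ?_⟩
  change app (φ _) ⊤ (app (θ₁ p) ⊤ x) - N.map p q r _ _ ⊤ x ((B.obj (q + 1)).res le_top y)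
    ((C.obj (r + 1)).res le_top z) = _
  rw [res_self, res_self]

end TriPairing

namespace VectSheaf

variable {F : VectSheaf X} {I : InjectiveResolution F}

lemma _root_.BiPairing.map_map_left (M M' : BiPairing (augSeq I) (augSeq I) (seq I))
    {p q k k' r n : ℕ} (hk : p + q = k) (hk' : p + q = k') (h : k + r = n) (h' : k' + r = n)
    {U : Opens X} (a : sec (I.cocomplex.X p) U) (b : sec (I.cocomplex.X q) U)
    (c : sec (I.cocomplex.X r) U) :
    M.map k r n h U (M'.map p q k hk U a b) c = M.map k' r n h' U (M'.map p q k' hk' U a b) c := by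
  subst hk hk'
  rfl

lemma _root_.BiPairing.map_map_right (M M' : BiPairing (augSeq I) (augSeq I) (seq I))
    {p q k k' r n : ℕ} (hk : q + r = k) (hk' : q + r = k') (h : p + k = n) (h' : p + k' = n)
    {U : Opens X} (a : sec (I.cocomplex.X p) U) (b : sec (I.cocomplex.X q) U)
    (c : sec (I.cocomplex.X r) U) :
    M.map p k n h U a (M'.map q r k hk U b c) = M.map p k' n h' U a (M'.map q r k' hk' U b c) := by
  subst hk hk'
  rfl

/-- The trilinear pairing `M(M'(a, b), c)`. -/
def triLeft (M M' : BiPairing (augSeq I) (augSeq I) (seq I)) :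
    TriPairing (augSeq I) (augSeq I) (augSeq I) (seq I) where
  map p q r n h U := (M'.map p q (p + q) rfl U).compr₂ (M.map (p + q) r n h U)
  res_map p q r n h U W hW a b c := by
    simp only [LinearMap.compr₂_apply]
    rw [M'.res_map]
    exact M.res_map (p + q) r n h hW _ c
  leibniz p q r n h U a b c := by
    simp only [LinearMap.compr₂_apply]
    rw [M.leibniz]
    have e := M'.leibniz p q (p + q) rfl U a b
    refine congrArg₂ _ ((congrArg (fun t => M.map (p + q + 1) r (n + 1) (by omega) U t c) e).trans
      ?_) rfl
    rw [map_add, map_zsmul, LinearMap.add_apply, LinearMap.smul_apply]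
    refine congrArg₂ _ ?_ rfl
    exact M.map_map_left M' _ _ _ _ _ _ _

/-- The trilinear pairing `M(a, M'(b, c))`. -/
def triRight (M M' : BiPairing (augSeq I) (augSeq I) (seq I)) :
    TriPairing (augSeq I) (augSeq I) (augSeq I) (seq I) where
  map p q r n h U := LinearMap.mk₂ ℂ
    (fun a b => M.map p (q + r) n (by omega) U a ∘ₗ M'.map q r (q + r) rfl U b)
    (fun a a' b => by ext; simp) (fun t a b => by ext; simp) (fun a b b' => by ext; simp)
    (fun t a b => by ext; simp)
  res_map p q r n h U W hW a b c := by
    simp only [LinearMap.mk₂_apply, LinearMap.comp_apply]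
    rw [M'.res_map]
    exact M.res_map p (q + r) n (by omega) hW a _
  leibniz p q r n h U a b c := by
    simp only [LinearMap.mk₂_apply, LinearMap.comp_apply]
    rw [M.leibniz]
    refine Eq.trans ?_ (add_assoc _ _ _).symm
    have e := M'.leibniz q r (q + r) rfl U b c
    refine congrArg₂ _ rfl ((congrArg (fun t => (-1 : ℤ) ^ p •
      M.map p (q + r + 1) (n + 1) (by omega) U a t) e).trans ?_)
    rw [map_add, map_zsmul, smul_add, smul_smul, pow_add]
    refine congrArg₂ _ (congrArg _ ?_) rfl
    exact M.map_map_right M' _ _ _ _ _ _ _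

/-- The trilinear pairing `(-1)^{pq} M(b, M'(a, c))`, where `a` and `b` have degrees `p`
and `q`. -/
def triSwap (M M' : BiPairing (augSeq I) (augSeq I) (seq I)) :
    TriPairing (augSeq I) (augSeq I) (augSeq I) (seq I) where
  map p q r n h U := LinearMap.mk₂ ℂ
    (fun a b => (-1 : ℤ) ^ (p * q) •
      (M.map q (p + r) n (by omega) U b ∘ₗ M'.map p r (p + r) rfl U a))
    (fun a a' b => by ext; simp) (fun t a b => by ext; simp [smul_comm _ t])
    (fun a b b' => by ext; simp)
    (fun t a b => by ext; simp [smul_comm _ t])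
  res_map p q r n h U W hW a b c := by
    simp only [LinearMap.mk₂_apply, LinearMap.comp_apply, LinearMap.smul_apply]
    rw [M'.res_map, map_zsmul]
    exact congrArg _ (M.res_map q (p + r) n (by omega) hW b _)
  leibniz p q r n h U a b c := by
    simp only [LinearMap.mk₂_apply, LinearMap.comp_apply, LinearMap.smul_apply]
    rw [map_zsmul, M.leibniz]
    have e := M'.leibniz p r (p + r) rfl U a c
    have e' : app ((seq I).d n) U (M.map q (p + r) n (by omega) U b (M'.map p r (p + r) rfl U a c))
        = M.map (q + 1) (p + r) (n + 1) (by omega) U (app ((augSeq I).d (q + 1)) U b)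
          (M'.map p r (p + r) rfl U a c) +
        (-1 : ℤ) ^ q • (M.map q (p + 1 + r) (n + 1) (by omega) U b
          (M'.map (p + 1) r (p + 1 + r) rfl U (app ((augSeq I).d (p + 1)) U a) c) +
        (-1 : ℤ) ^ p • M.map q (p + r + 1) (n + 1) (by omega) U b
          (M'.map p (r + 1) (p + r + 1) rfl U a (app ((augSeq I).d (r + 1)) U c))) := by
      rw [M.leibniz]
      refine congrArg₂ _ rfl (congrArg _ ?_)
      refine (congrArg (fun t => M.map q (p + r + 1) (n + 1) (by omega) U b t) e).trans ?_
      rw [map_add, map_zsmul]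
      refine congrArg₂ _ ?_ rfl
      exact M.map_map_right M' _ _ _ _ _ _ _
    rw [M.leibniz] at e'
    refine (congrArg (fun t => (-1 : ℤ) ^ (p * q) • t) e').trans ?_
    simp only [smul_add, smul_smul]
    have h1 : (-1 : ℤ) ^ ((p + 1) * q) = (-1) ^ (p * q) * (-1) ^ q := by
      rw [← pow_add]; ring_nf
    have h2 : (-1 : ℤ) ^ p * (-1) ^ (p * (q + 1)) = (-1) ^ (p * q) := by
      rw [mul_add, pow_add, mul_one, mul_left_comm, ← mul_pow]
      simp
    have h3 : (-1 : ℤ) ^ (p + q) * (-1) ^ (p * q) = (-1) ^ (p * q) * ((-1) ^ q * (-1) ^ p) := by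
      rw [← pow_add, ← pow_add, ← pow_add]; ring_nf
    rw [h1, h2, h3]
    abel

/-- The sheaf `F ⊗ F ⊗ F`. -/
def tripleTensor (F : VectSheaf X) : VectSheaf X :=
  (presheafToSheaf (Opens.grothendieckTopology X) (ModuleCat.{0} ℂ)).obj
    (tens (tens F.obj F.obj) F.obj)

/-- The canonical morphism from the presheaf tensor product to `F ⊗ F ⊗ F`. -/
def toTripleTensor (F : VectSheaf X) :
    tens (tens F.obj F.obj) F.obj ⟶ (tripleTensor F).obj :=
  toSheafify (Opens.grothendieckTopology X) (tens (tens F.obj F.obj) F.obj)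

/-- The section `a ⊗ b ⊗ c` of `F ⊗ F ⊗ F`. -/
def tmul₃ {U : Opens X} (a b c : F.sec U) : (tripleTensor F).sec U :=
  app (toTripleTensor F) U (tmul (tmul (P := F.obj) (Q := F.obj) a b) (c : Psh.sec F.obj U))

/-- A trilinear map of sheaves as a morphism from `F ⊗ F ⊗ F`. -/
def tripleLift (φ : ∀ U : Opens X, F.sec U →ₗ[ℂ] F.sec U →ₗ[ℂ] F.sec U →ₗ[ℂ] F.sec U)
    (hφ : ∀ {U W : Opens X} (h : W ≤ U) (x y z : F.sec U),
      φ W (F.res h x) (F.res h y) (F.res h z) = F.res h (φ U x y z)) : tripleTensor F ⟶ F :=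
  ⟨sheafifyLift (Opens.grothendieckTopology X)
    (tensLift₃ (P := F.obj) (Q := F.obj) (R := F.obj) (T := F.obj) φ hφ) F.property⟩

lemma tripleLift_tmul₃ (φ : ∀ U : Opens X, F.sec U →ₗ[ℂ] F.sec U →ₗ[ℂ] F.sec U →ₗ[ℂ] F.sec U)
    (hφ : ∀ {U W : Opens X} (h : W ≤ U) (x y z : F.sec U),
      φ W (F.res h x) (F.res h y) (F.res h z) = F.res h (φ U x y z)) (U : Opens X)
    (a b c : F.sec U) : secMap (tripleLift φ hφ) U (tmul₃ a b c) = φ U a b c :=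
  congrArg (fun f => app f U (tmul (tmul (P := F.obj) (Q := F.obj) a b) (c : Psh.sec F.obj U)))
    (toSheafify_sheafifyLift (Opens.grothendieckTopology X)
      (tensLift₃ (P := F.obj) (Q := F.obj) (R := F.obj) (T := F.obj) φ hφ) F.property)

lemma Represents.lof_cup {m : Pairing F F F} (M : PairingExtension m I) {p q n : ℕ}
    (h : p + q = n) {x : sec (I.cocomplex.X p) ⊤} {y : sec (I.cocomplex.X q) ⊤} {α : F.coh p}
    {β : F.coh q} {γ : F.coh n} (hx : Represents I x α) (hy : Represents I y β)
    (hγ : Represents I ((M.mul p q n h).map ⊤ x y) γ) :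
    DirectSum.lof ℂ ℕ (fun n => F.coh n) n γ =
      DirectSum.lof ℂ ℕ (fun n => F.coh n) (p + q) (VectSheaf.cup m p q α β) := by
  subst h
  rw [hγ.unique (hx.cup hy M)]

lemma Represents.cup' {m : Pairing F F F} (M : PairingExtension m I) {p q n : ℕ}
    (h : p + q = n) {x : sec (I.cocomplex.X p) ⊤} {y : sec (I.cocomplex.X q) ⊤} {α : F.coh p}
    {β : F.coh q} (hx : Represents I x α) (hy : Represents I y β) :
    ∃ γ : F.coh n, Represents I ((M.mul p q n h).map ⊤ x y) γ := by
  subst h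
  exact ⟨_, hx.cup hy M⟩

/-- Cohomology classes `α`, `β`, `γ` of `F` have a product `u` in the cohomology of `F ⊗ F ⊗ F`,
from which all iterated cup products of `α`, `β`, `γ` are obtained by applying morphisms of
sheaves. -/
theorem exists_tripleProduct {p q r : ℕ} (α : F.coh p) (β : F.coh q) (γ : F.coh r) :
    ∃ u : (tripleTensor F).coh (p + q + r), ∀ (m m' : Pairing F F F) (f : tripleTensor F ⟶ F),
      ((∀ U (a b c : F.sec U), secMap f U (tmul₃ a b c) = m.map U (m'.map U a b) c) →
        cohMap f _ u = VectSheaf.cup m (p + q) r (VectSheaf.cup m' p q α β) γ) ∧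
      ((∀ U (a b c : F.sec U), secMap f U (tmul₃ a b c) = m.map U a (m'.map U b c)) →
        DirectSum.lof ℂ ℕ (fun n => F.coh n) _ (cohMap f _ u) =
          DirectSum.lof ℂ ℕ (fun n => F.coh n) _
            (VectSheaf.cup m p (q + r) α (VectSheaf.cup m' q r β γ))) ∧
      ((∀ U (a b c : F.sec U), secMap f U (tmul₃ a b c) = m.map U b (m'.map U a c)) →
        DirectSum.lof ℂ ℕ (fun n => F.coh n) _ (cohMap f _ u) =
          (-1 : ℤ) ^ (p * q) • DirectSum.lof ℂ ℕ (fun n => F.coh n) _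
            (VectSheaf.cup m q (p + r) β (VectSheaf.cup m' p r α γ))) := by
  let I := injectiveResolution F
  let K := injectiveResolution (tripleTensor F)
  obtain ⟨x, hx⟩ := exists_represents I α
  obtain ⟨y, hy⟩ := exists_represents I β
  obtain ⟨z, hz⟩ := exists_represents I γ
  obtain ⟨v, hv, hN⟩ := TriPairing.exists_universal (locExact_augSeq I) (locExact_augSeq I)
    (locExact_augSeq I) (augSeq_d_d I 0) (augSeq_d_d I 0) (isInjSep_seq K)
    (toTripleTensor F ≫ (aug K).hom) (by rw [Category.assoc, aug_d, Limits.comp_zero])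
    (n := p + q + r) rfl x hx.d_eq_zero y hy.d_eq_zero z hz.d_eq_zero
  obtain ⟨u, hu⟩ := exists_represents_of_d_eq_zero (I := K) v hv
  have key : ∀ (f : tripleTensor F ⟶ F)
      (N : TriPairing (augSeq I) (augSeq I) (augSeq I) (seq I)),
      (∀ U (a b c : F.sec U), N.map 0 0 0 0 rfl U (secMap (aug I) U a) (secMap (aug I) U b)
        (secMap (aug I) U c) = secMap (aug I) U (secMap f U (tmul₃ a b c))) →
      Represents I (N.map p q r (p + q + r) rfl ⊤ x y z) (cohMap f _ u) := by
    intro f N hf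
    let φ := InjectiveResolution.desc f I K
    have hφ : K.ι.f 0 ≫ φ.f 0 = f ≫ I.ι.f 0 := InjectiveResolution.desc_commutes_zero f I K
    refine (hu.map φ hφ).of_isCob_sub ?_
    have := (hN (seq I) (isInjSep_seq I) (fun n => (φ.f n).hom) (desc_seq_comm φ) N
      (fun U a b c => (hf U a b c).trans
        (congrArg (fun t => secMap t U (tmul₃ a b c)) hφ).symm)).neg
    rw [neg_sub] at this
    exact this
  refine ⟨u, fun m m' f => ?_⟩
  obtain ⟨M⟩ := nonempty_pairingExtension m I
  obtain ⟨M'⟩ := nonempty_pairingExtension m' I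
  refine ⟨fun hf => ?_, fun hf => ?_, fun hf => ?_⟩
  · refine (key f (triLeft M.toBiPairing M'.toBiPairing) fun U a b c => ?_).unique
      ((hx.cup hy M').cup hz M)
    refine Eq.trans ?_ (congrArg (secMap (aug I) U) (hf U a b c)).symm
    refine Eq.trans ?_ (M.mul_aug U _ c)
    exact congrArg (fun t => (M.mul 0 0 0 rfl).map U t (secMap (aug I) U c)) (M'.mul_aug U a b)
  · refine hx.lof_cup M (by omega) (hy.cup hz M')
      (key f (triRight M.toBiPairing M'.toBiPairing) fun U a b c => ?_)
    refine Eq.trans ?_ (congrArg (secMap (aug I) U) (hf U a b c)).symm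
    refine Eq.trans ?_ (M.mul_aug U a _)
    exact congrArg (fun t => (M.mul 0 0 0 rfl).map U (secMap (aug I) U a) t) (M'.mul_aug U b c)
  · have e := key f (triSwap M.toBiPairing M'.toBiPairing) fun U a b c => by
      refine Eq.trans ?_ (congrArg (secMap (aug I) U) (hf U a b c)).symm
      refine Eq.trans ?_ (M.mul_aug U b _)
      refine (one_smul ℤ _).trans ?_
      exact congrArg (fun t => (M.mul 0 0 0 rfl).map U (secMap (aug I) U b) t) (M'.mul_aug U a c)
    obtain ⟨δ, hδ⟩ := hy.cup' M (n := p + q + r) (by omega) (hx.cup hz M')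
    rw [← hy.lof_cup M (by omega) (hx.cup hz M') hδ, ← map_zsmul]
    exact congrArg _ (e.unique (hδ.zsmul _))

end VectSheaf

/-! ### Cohomology on a Noetherian space and systems with zero colimit -/

namespace Psh

/-- The presheaf `ℂ_W`, extended by zero: its sections over `V` are `ℂ` if `V ⊆ W` and `0`
otherwise. -/
def freeOn (W : Opens X) : Psh X where
  obj V := ModuleCat.of ℂ (PLift (V.unop ≤ W) →₀ ℂ)
  map f := ModuleCat.ofHom (Finsupp.lmapDomain ℂ ℂ fun h => ⟨(leOfHom f.unop).trans h.down⟩)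
  map_id V := by
    ext : 1
    refine Finsupp.lhom_ext' fun a => LinearMap.ext_ring ?_
    simp
  map_comp f g := by
    ext : 1
    refine Finsupp.lhom_ext' fun a => LinearMap.ext_ring ?_
    simp

/-- The section `1` of `ℂ_W` over `V ⊆ W`. -/
def freeOnOne {V W : Opens X} (h : V ≤ W) : (freeOn W).sec V :=
  (Finsupp.single ⟨h⟩ 1 : PLift (V ≤ W) →₀ ℂ)

/-- The morphism `ℂ_W ⟶ P` given by a section of `P` over `W`. -/
def freeOnLift {P : Psh X} {W : Opens X} (x : P.sec W) : freeOn W ⟶ P where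
  app V := ModuleCat.ofHom (Finsupp.linearCombination ℂ
    fun h : PLift (V.unop ≤ W) => (P.res h.down x : P.sec V.unop))
  naturality V V' f := by
    ext : 1
    refine Finsupp.lhom_ext' fun a => LinearMap.ext_ring ?_
    have : (P.res (leOfHom f.unop)) (P.res a.down x) = P.res ((leOfHom f.unop).trans a.down) x :=
      res_res _ _ _
    have e := (Finsupp.linearCombination_single ℂ (v := fun h : PLift (V'.unop ≤ W) =>
      (P.res h.down x : P.sec V'.unop)) 1 ⟨(leOfHom f.unop).trans a.down⟩)
    have e' := (Finsupp.linearCombination_single ℂ (v := fun h : PLift (V.unop ≤ W) =>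
      (P.res h.down x : P.sec V.unop)) 1 a)
    refine (congrArg (Finsupp.linearCombination ℂ fun h : PLift (V'.unop ≤ W) =>
      (P.res h.down x : P.sec V'.unop)) Finsupp.mapDomain_single).trans ?_
    refine e.trans (Eq.trans ?_ (congrArg (P.res (leOfHom f.unop)) e').symm)
    rw [one_smul, one_smul]
    exact this.symm

lemma freeOnLift_one {P : Psh X} {V W : Opens X} (x : P.sec W) (h : V ≤ W) :
    app (freeOnLift x) V (freeOnOne h) = P.res h x := by
  refine (Finsupp.linearCombination_single ℂ _ _).trans ?_
  rw [one_smul]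

lemma freeOn_eq_smul_one {V W : Opens X} (s : (freeOn W).sec V) (h : V ≤ W) :
    ∃ c : ℂ, s = c • freeOnOne h := by
  let s' : PLift (V ≤ W) →₀ ℂ := s
  refine ⟨s' ⟨h⟩, ?_⟩
  refine Finsupp.ext (fun a => ?_ : ∀ a : PLift (V ≤ W), _)
  obtain rfl : a = ⟨h⟩ := Subsingleton.elim _ _
  change s' _ = (s' ⟨h⟩ • Finsupp.single (⟨h⟩ : PLift (V ≤ W)) (1 : ℂ)) ⟨h⟩
  simp

lemma freeOn_eq_zero {V W : Opens X} (s : (freeOn W).sec V) (h : ¬ V ≤ W) : s = 0 :=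
  Finsupp.ext (fun a => absurd (PLift.down a) h : ∀ _ : PLift (V ≤ W), _)

lemma freeOnOne_ne_zero {V W : Opens X} (h : V ≤ W) : freeOnOne h ≠ 0 :=
  Finsupp.single_ne_zero.2 one_ne_zero

/-- Injective presheaves are flasque. -/
lemma res_surjective (P : Psh X) [Injective P] {U W : Opens X} (h : W ≤ U) :
    Function.Surjective (P.res h) := by
  intro x
  obtain ⟨g, hg⟩ := exists_extension (freeOnLift (freeOnOne h)) (freeOnLift x) fun V a ha => by
    by_cases hV : V ≤ W
    · obtain ⟨c, rfl⟩ := freeOn_eq_smul_one a hV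
      rw [map_smul, freeOnLift_one] at ha
      have e : (freeOn U).res hV (freeOnOne h) = freeOnOne (hV.trans h) :=
        (Finsupp.mapDomain_single)
      rw [e, smul_eq_zero] at ha
      rw [ha.resolve_right (freeOnOne_ne_zero _), zero_smul, map_zero]
    · rw [freeOn_eq_zero a hV, map_zero]
  refine ⟨app g U (freeOnOne le_rfl), ?_⟩
  have e : (freeOn U).res h (freeOnOne le_rfl) = freeOnOne h := Finsupp.mapDomain_single
  have e' := congrArg (fun f => app f W (freeOnOne le_rfl)) hg
  simp only [app_comp, freeOnLift_one, res_self] at e'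
  rw [← app_res, e, e']

end Psh

/-- Induction on the open subsets of an open set of a Noetherian space. -/
lemma Opens.noetherian_induction [NoetherianSpace X] (U : Opens X) (R : Opens X → Prop)
    (bot : R ⊥) (sup : ∀ V W : Opens X, V ≤ U → W ≤ U → R V → R W → R (V ⊔ W))
    (loc : ∀ p ∈ U, ∃ W ≤ U, p ∈ W ∧ R W) : R U := by
  have := (NoetherianSpace.isCompact (U : Set X)).induction_on
    (p := fun S => ∃ W ≤ U, S ⊆ (W : Set X) ∧ R W) ⟨⊥, bot_le, Set.empty_subset _, bot⟩
    (fun s t hst ⟨W, hW, h, hR⟩ => ⟨W, hW, hst.trans h, hR⟩)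
    (fun s t ⟨V, hV, h, hR⟩ ⟨W, hW, h', hR'⟩ => ⟨V ⊔ W, sup_le hV hW, by
      rw [Opens.coe_sup]; exact Set.union_subset_union h h', sup V W hV hW hR hR'⟩)
    (fun p hp => by
      obtain ⟨W, hW, hpW, hR⟩ := loc p hp
      exact ⟨W, mem_nhdsWithin_of_mem_nhds (W.isOpen.mem_nhds hpW), W, hW, subset_rfl, hR⟩)
  obtain ⟨W, hW, h, hR⟩ := this
  rwa [le_antisymm hW h] at hR

/-- For a sequence of maps `T 0 → T 1 → ⋯`, the element `x` of `T N` satisfies `S` at some later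
stage. -/
inductive Later {T : ℕ → Type*} (t : ∀ N, T N → T (N + 1)) (S : ∀ N, T N → Prop) :
    ∀ N, T N → Prop
  | now (N : ℕ) (x : T N) : S N x → Later t S N x
  | next (N : ℕ) (x : T N) : Later t S (N + 1) (t N x) → Later t S N x

namespace Later

variable {T T' : ℕ → Type*} {t : ∀ N, T N → T (N + 1)} {t' : ∀ N, T' N → T' (N + 1)}
  {S S' : ∀ N, T N → Prop} {N : ℕ} {x : T N}

lemma bind (h : Later t S N x) (H : ∀ N x, S N x → Later t S' N x) : Later t S' N x := by
  induction h with
  | now N x h => exact H N x h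
  | next N x _ ih => exact next N x ih

lemma map (hS : ∀ N x, S N x → S (N + 1) (t N x)) (h : Later t S N x) :
    Later t S (N + 1) (t N x) := by
  cases h with
  | now _ _ h => exact now _ _ (hS _ _ h)
  | next _ _ h => exact h

lemma and (hS : ∀ N x, S N x → S (N + 1) (t N x)) (hS' : ∀ N x, S' N x → S' (N + 1) (t N x))
    (h : Later t S N x) (h' : Later t S' N x) : Later t (fun N x => S N x ∧ S' N x) N x := by
  induction h with
  | now N x h =>
    induction h' with
    | now N x h' => exact now _ _ ⟨h, h'⟩
    | next N x _ ih => exact next _ _ (ih (hS _ _ h))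
  | next N x _ ih => exact next _ _ (ih (h'.map hS'))

lemma transfer {S' : ∀ N, T' N → Prop} (h : Later t S N x) (R : ∀ N, T N → T' N → Prop)
    (hR : ∀ N x y, R N x y → R (N + 1) (t N x) (t' N y))
    (hS : ∀ N x y, R N x y → S N x → S' N y) {y : T' N} (hxy : R N x y) : Later t' S' N y := by
  induction h with
  | now N x h => exact now _ _ (hS _ _ _ hxy h)
  | next N x _ ih => exact next _ _ (ih (hR _ _ _ hxy))

lemma of_map (f : ∀ N, T N → T' N) (hf : ∀ N x, f (N + 1) (t N x) = t' N (f N x))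
    {S' : ∀ N, T' N → Prop} {y : T' N} (h : Later t' S' N y) (x : T N) (hxy : f N x = y) :
    Later t (fun N x => S' N (f N x)) N x :=
  h.transfer (fun N y x => f N x = y) (fun N y x h => by rw [hf, h])
    (fun N y x h => h ▸ id) hxy

end Later

namespace VectSheaf

lemma exists_aug_eq {F : VectSheaf X} (I : InjectiveResolution F) (U : Opens X)
    (x : sec (I.cocomplex.X 0) U) (hx : app ((seq I).d 0) U x = 0) :
    ∃ s : F.sec U, secMap (aug I) U s = x := by
  have : Mono (ShortComplex.mk _ _ I.ι_f_zero_comp_complex_d).f := mono_aug I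
  exact (ShortComplex.moduleCat_exact_iff _).1
    (I.exact₀.map_of_mono_of_preservesKernel (secFunctor X U) this
      (by dsimp; infer_instance)) x hx

section System

variable (Q : ℕ → VectSheaf X) (τ : ∀ N, Q N ⟶ Q (N + 1))

/-- The cocycles of `Γ(U, I_N^n)`, `I_N` being the chosen injective resolution of `Q N`. -/
def Cocycle (n : ℕ) (U : Opens X) (N : ℕ) : Type :=
  {x : ((seq (injectiveResolution (Q N))).obj n).sec U //
    app ((seq (injectiveResolution (Q N))).d n) U x = 0}

/-- The extension of `τ N` to the chosen injective resolutions. -/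
def liftSystem (N n : ℕ) :
    (seq (injectiveResolution (Q N))).obj n ⟶ (seq (injectiveResolution (Q (N + 1)))).obj n :=
  ((InjectiveResolution.desc (τ N) (injectiveResolution (Q (N + 1)))
    (injectiveResolution (Q N))).f n).hom

lemma liftSystem_comm (N n : ℕ) :
    liftSystem Q τ N n ≫ (seq (injectiveResolution (Q (N + 1)))).d n =
      (seq (injectiveResolution (Q N))).d n ≫ liftSystem Q τ N (n + 1) :=
  desc_seq_comm _ n

lemma liftSystem_d (N n : ℕ) (U : Opens X) (x : ((seq (injectiveResolution (Q N))).obj n).sec U) :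
    app ((seq (injectiveResolution (Q (N + 1)))).d n) U (app (liftSystem Q τ N n) U x) =
      app (liftSystem Q τ N (n + 1)) U (app ((seq (injectiveResolution (Q N))).d n) U x) :=
  congrArg (fun f => app f U x) (liftSystem_comm Q τ N n)

variable {Q}

/-- The maps induced by `liftSystem` on cocycles. -/
def Cocycle.next {n : ℕ} {U : Opens X} (N : ℕ) (x : Cocycle Q n U N) : Cocycle Q n U (N + 1) :=
  ⟨app (liftSystem Q τ N n) U x.1, by rw [liftSystem_d, x.2, map_zero]⟩

/-- The restriction of cocycles. -/
def Cocycle.res {n : ℕ} {U W : Opens X} (h : W ≤ U) (N : ℕ) (x : Cocycle Q n U N) :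
    Cocycle Q n W N :=
  ⟨Psh.res _ h x.1, by rw [app_res, x.2, map_zero]⟩

lemma Cocycle.res_next {n : ℕ} {U W : Opens X} (h : W ≤ U) (N : ℕ) (x : Cocycle Q n U N) :
    (x.next τ N).res h (N + 1) = (x.res h N).next τ N := Subtype.ext (app_res _ h x.1).symm

/-- The cocycle `x` is a coboundary. -/
def Cocycle.IsCob {n : ℕ} {U : Opens X} (N : ℕ) (x : Cocycle Q n U N) : Prop :=
  (seq (injectiveResolution (Q N))).IsCob x.1

lemma Cocycle.IsCob.next {n : ℕ} {U : Opens X} (N : ℕ) (x : Cocycle Q n U N)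
    (hx : Cocycle.IsCob N x) : Cocycle.IsCob (N + 1) (x.next τ N) :=
  PshSeq.IsCob.map _ (liftSystem_comm Q τ N) hx

/-- The Mayer–Vietoris step: if `x` becomes a coboundary on `U` and on `V`, the difference of the
two primitives being eventually a coboundary on `U ∩ V`, then `x` is eventually a coboundary on
`U ∪ V`. -/
lemma later_isCob_of_difference {n : ℕ} {U V : Opens X} {N : ℕ} {c : Cocycle Q n (U ⊓ V) N}
    (hc : Later (Cocycle.next τ) Cocycle.IsCob N c) (x : Cocycle Q (n + 1) (U ⊔ V) N)
    (j₁ : ((seq (injectiveResolution (Q N))).obj n).sec U)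
    (j₂ : ((seq (injectiveResolution (Q N))).obj n).sec V)
    (h₁ : app ((seq (injectiveResolution (Q N))).d n) U j₁ = Psh.res _ le_sup_left x.1)
    (h₂ : app ((seq (injectiveResolution (Q N))).d n) V j₂ = Psh.res _ le_sup_right x.1)
    (h : c.1 = Psh.res _ inf_le_left j₁ - Psh.res _ inf_le_right j₂) :
    Later (Cocycle.next τ) Cocycle.IsCob N x := by
  induction hc with
  | now N c hc =>
    refine Later.now _ _ ?_
    have hJ := isInjSep_seq (injectiveResolution (Q N))
    obtain ⟨l, hl⟩ := hc
    have := hJ.hat.inj n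
    obtain ⟨m, rfl⟩ := res_surjective ((seq (injectiveResolution (Q N))).hat.obj n)
      (inf_le_left : U ⊓ V ≤ U) l
    rw [app_res, h] at hl
    obtain ⟨j, hj₁, hj₂⟩ := exists_glue ((injectiveResolution (Q N)).cocomplex.X n)
      (j₁ - app ((seq (injectiveResolution (Q N))).hat.d n) U m) j₂ (by
        rw [map_sub]
        exact (congrArg _ hl).trans (sub_sub_cancel _ _))
    refine PshSeq.isCob_succ_iff.2 ⟨j, ?_⟩
    rw [← sub_eq_zero]
    refine hJ.sep (n + 1) _ _ fun p hp => ?_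
    rcases hp with hp | hp
    · refine ⟨U, le_sup_left, hp, ?_⟩
      rw [map_sub, ← app_res]
      refine sub_eq_zero.2 ((congrArg _ hj₁).trans ?_)
      rw [map_sub, h₁]
      have e := congrArg (fun f => app f U m) (hJ.hat.d_d n)
      exact (congrArg _ e).trans (sub_zero _)
    · refine ⟨V, le_sup_right, hp, ?_⟩
      rw [map_sub, ← app_res]
      exact sub_eq_zero.2 ((congrArg _ hj₂).trans h₂)
  | next N c _ ih =>
    refine Later.next _ _ (ih (x.next τ N) (app (liftSystem Q τ N n) U j₁)
      (app (liftSystem Q τ N n) V j₂) ?_ ?_ ?_)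
    · rw [liftSystem_d, h₁, app_res]; rfl
    · rw [liftSystem_d, h₂, app_res]; rfl
    · change app (liftSystem Q τ N n) _ c.1 = _
      rw [h, map_sub, app_res, app_res]

/-- Let `Q 0 → Q 1 → ⋯` be a sequence of sheaves on a Noetherian space such that every section
becomes zero at a later stage. Then every cohomology class becomes zero at a later stage. -/
theorem later_isCob [NoetherianSpace X]
    (hQ : ∀ (U : Opens X) (N : ℕ) (s : (Q N).sec U),
      Later (fun N => secMap (τ N) U) (fun _ s => s = 0) N s)
    (n : ℕ) (U : Opens X) (N : ℕ) (x : Cocycle Q n U N) :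
    Later (Cocycle.next τ) Cocycle.IsCob N x := by
  induction n generalizing U N with
  | zero =>
    obtain ⟨s, hs⟩ := exists_aug_eq _ U x.1 x.2
    refine (hQ U N s).transfer (fun N s (x : Cocycle Q 0 U N) =>
      secMap (aug (injectiveResolution (Q N))) U s = x.1) ?_ ?_ hs
    · intro N s x hs
      refine Eq.trans ?_ (congrArg (app (liftSystem Q τ N 0) U) hs)
      exact (congrArg (fun f => secMap f U s) (InjectiveResolution.desc_commutes_zero (τ N)
        (injectiveResolution (Q (N + 1))) (injectiveResolution (Q N)))).symm
    · intro N s x hs h0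
      refine PshSeq.isCob_zero_iff.2 ?_
      rw [← hs, h0, map_zero]
  | succ n ih =>
    have key : ∀ V W : Opens X, ∀ (N : ℕ) (x : Cocycle Q (n + 1) (V ⊔ W) N),
        Later (Cocycle.next τ) Cocycle.IsCob N (x.res le_sup_left N) →
        Later (Cocycle.next τ) Cocycle.IsCob N (x.res le_sup_right N) →
        Later (Cocycle.next τ) Cocycle.IsCob N x := by
      intro V W N x hV hW
      have hV' := hV.of_map (fun N x => Cocycle.res le_sup_left N x)
        (fun N x => x.res_next τ _ N) x rfl
      have hW' := hW.of_map (fun N x => Cocycle.res le_sup_right N x)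
        (fun N x => x.res_next τ _ N) x rfl
      refine (hV'.and ?_ ?_ hW').bind ?_
      · intro N x hx
        rw [x.res_next τ]
        exact hx.next τ
      · intro N x hx
        rw [x.res_next τ]
        exact hx.next τ
      · rintro N x ⟨h₁, h₂⟩
        obtain ⟨j₁, hj₁⟩ := PshSeq.isCob_succ_iff.1 h₁
        obtain ⟨j₂, hj₂⟩ := PshSeq.isCob_succ_iff.1 h₂
        refine later_isCob_of_difference τ (ih (V ⊓ W) N
          ⟨Psh.res _ inf_le_left j₁ - Psh.res _ inf_le_right j₂, ?_⟩) x j₁ j₂ hj₁ hj₂ rfl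
        rw [map_sub, app_res, app_res, hj₁, hj₂]
        simp [Cocycle.res]
    have := Opens.noetherian_induction U
      (fun W => ∀ h : W ≤ U, Later (Cocycle.next τ) Cocycle.IsCob N (x.res h N)) ?_ ?_ ?_
    · have h := this le_rfl
      have e : x.res le_rfl N = x := Subtype.ext (res_self _ _)
      rwa [e] at h
    · intro h
      refine Later.now _ _ ?_
      have : (x.res h N).1 = 0 := (isInjSep_seq (injectiveResolution (Q N))).sep _ _ _
        fun p hp => absurd hp (by simp)
      unfold Cocycle.IsCob
      rw [this]
      exact PshSeq.IsCob.zero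
    · intro V W hV hW h₁ h₂ h
      refine key V W N _ ?_ ?_
      · convert h₁ hV using 1
        exact Subtype.ext (res_res _ _ _)
      · convert h₂ hW using 1
        exact Subtype.ext (res_res _ _ _)
    · intro p hp
      obtain ⟨W, hW, hpW, w, hw⟩ :=
        (locExact_augSeq (injectiveResolution (Q N))).succ (n + 1) U x.1 x.2 p hp
      exact ⟨W, hW, hpW, fun _ => Later.now _ _ ⟨w, hw⟩⟩

end System

/-- Let `f 0, f 1, …` be morphisms of sheaves on a Noetherian space such that every section is
killed by almost all of them. Then every cohomology class is killed by almost all of them. -/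
theorem exists_cohMap_eq_zero [NoetherianSpace X] {P F : VectSheaf X} (f : ℕ → (P ⟶ F))
    (hf : ∀ (U : Opens X) (s : P.sec U), ∀ p ∈ U, ∃ (W : Opens X) (h : W ≤ U), p ∈ W ∧
      ∃ N₀, ∀ N ≥ N₀, secMap (f N) W (P.res h s) = 0) {n : ℕ} (u : P.coh n) :
    ∃ N₀, ∀ N ≥ N₀, cohMap (f N) n u = 0 := by
  let Pr : VectSheaf X := ∏ᶜ fun _ : ℕ => F
  let g : ∀ N, P ⟶ Pr := fun N => Limits.Pi.lift fun M => f (N + M)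
  let σ : Pr ⟶ Pr := Limits.Pi.lift fun M => Limits.Pi.π _ (M + 1)
  have hσ : ∀ N, g N ≫ σ = g (N + 1) := fun N => Limits.Pi.hom_ext _ _ fun M => by
    simp only [g, σ, Category.assoc, Limits.Pi.lift_π]
    rw [show N + (M + 1) = N + 1 + M by omega]
  let Q : ℕ → VectSheaf X := fun N => Abelian.image (g N)
  let e : ∀ N, P ⟶ Q N := fun N => Abelian.factorThruImage (g N)
  let i : ∀ N, Q N ⟶ Pr := fun N => Abelian.image.ι (g N)
  have hei : ∀ N, e N ≫ i N = g N := fun N => Abelian.image.fac (g N)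
  have sq : ∀ N, CommSq (e (N + 1)) (e N) (i (N + 1)) (i N ≫ σ) := fun N =>
    ⟨by rw [hei, ← Category.assoc, hei, hσ]⟩
  let τ : ∀ N, Q N ⟶ Q (N + 1) := fun N => (sq N).lift
  have hτ : ∀ N, e N ≫ τ N = e (N + 1) := fun N => (sq N).fac_left
  let ρ : ∀ N M, Q N ⟶ F := fun N M => i N ≫ Limits.Pi.π _ M
  have heρ : ∀ N M, e N ≫ ρ N M = f (N + M) := fun N M => by
    simp only [ρ]
    rw [← Category.assoc, hei, Limits.Pi.lift_π]
  have hτρ : ∀ N M, τ N ≫ ρ (N + 1) M = ρ N (M + 1) := fun N M => by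
    rw [← cancel_epi (e N), ← Category.assoc, hτ, heρ, heρ, show N + 1 + M = N + (M + 1) by omega]
  -- a section of `Q N` vanishes if its images under all the `ρ N M` do
  have hQ0 : ∀ N U (s : (Q N).sec U), (∀ M, secMap (ρ N M) U s = 0) → s = 0 := by
    intro N U s hs
    refine secMap_injective (i N) U ?_
    rw [map_zero]
    have : Limits.PreservesLimits (secFunctor X U) := by unfold secFunctor; infer_instance
    refine Limits.Concrete.isLimit_ext _ (Limits.isLimitOfPreserves (secFunctor X U)
      (Limits.limit.isLimit (Discrete.functor fun _ : ℕ => F))) _ _ fun ⟨M⟩ => ?_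
    exact (hs M).trans (map_zero _).symm
  have hQe : ∀ U (s : P.sec U) k N, secMap (e (N + k)) U s = 0 →
      Later (fun N => secMap (τ N) U) (fun _ s => s = 0) N (secMap (e N) U s) := by
    intro U s k
    induction k with
    | zero => exact fun N h => Later.now _ _ h
    | succ k ih =>
      intro N h
      refine Later.next _ _ ?_
      have := ih (N + 1) (by rwa [show N + 1 + k = N + (k + 1) by omega])
      rw [← hτ] at this
      exact this
  have hQ : ∀ (U : Opens X) (N : ℕ) (s : (Q N).sec U),
      Later (fun N => secMap (τ N) U) (fun _ s => s = 0) N s := by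
    intro U N s
    have res_next : ∀ {U W : Opens X} (h : W ≤ U) (N) (s : (Q N).sec U),
        (Q (N + 1)).res h (secMap (τ N) U s) = secMap (τ N) W ((Q N).res h s) :=
      fun h N s => (app_res (τ N).hom h s).symm
    have := Opens.noetherian_induction U (fun W => ∀ h : W ≤ U,
      Later (fun N => secMap (τ N) W) (fun _ s => s = 0) N ((Q N).res h s)) ?_ ?_ ?_
    · have h := this le_rfl
      have e : (Q N).res le_rfl s = s := res_self (P := (Q N).obj) _ _
      rwa [e] at h
    · exact fun h => Later.now _ _ (isSep_of_sheaf (Q N) _ _ fun p hp => absurd hp (by simp))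
    · intro V W hV hW h₁ h₂ h
      have h₁' := (h₁ hV).of_map (t := fun N => secMap (τ N) (V ⊔ W))
        (fun N s => (Q N).res le_sup_left s) (fun N s => res_next _ N s)
        ((Q N).res h s) (res_res (P := (Q N).obj) _ _ _)
      have h₂' := (h₂ hW).of_map (t := fun N => secMap (τ N) (V ⊔ W))
        (fun N s => (Q N).res le_sup_right s) (fun N s => res_next _ N s)
        ((Q N).res h s) (res_res (P := (Q N).obj) _ _ _)
      refine (h₁'.and ?_ ?_ h₂').bind ?_
      · intro N s hs
        rw [res_next, hs, map_zero]
      · intro N s hs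
        rw [res_next, hs, map_zero]
      · rintro N s ⟨hs, hs'⟩
        refine Later.now _ _ (isSep_of_sheaf (Q N) _ _ fun p hp => ?_)
        rcases hp with hp | hp
        · exact ⟨V, le_sup_left, hp, hs⟩
        · exact ⟨W, le_sup_right, hp, hs'⟩
    · intro p hp
      obtain ⟨W, hW, ⟨t, ht⟩, hpW⟩ := (TopCat.Presheaf.isLocallySurjective_iff _).1
        ((TopCat.Sheaf.isLocallySurjective_iff_epi (e N)).2
          (inferInstanceAs (Epi (Abelian.factorThruImage (g N))))) U s p hp
      obtain ⟨W', hW', hpW', N₀, hN₀⟩ := hf W t p hpW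
      refine ⟨W', hW'.trans hW, hpW', fun h => ?_⟩
      have e1 : (Q N).res h s = secMap (e N) W' (P.res hW' t) := by
        refine Eq.trans ?_ (app_res (e N).hom hW' t).symm
        refine (res_res (P := (Q N).obj) hW hW' s).symm.trans ?_
        exact congrArg ((Q N).res hW') ht.symm
      rw [e1]
      refine hQe W' _ N₀ N (hQ0 _ _ _ fun M => ?_)
      refine Eq.trans ?_ (hN₀ (N + N₀ + M) (by omega))
      exact congrArg (fun f => secMap f W' (P.res hW' t)) (heρ (N + N₀) M)
  have main : ∀ N (x : Cocycle Q n ⊤ N), Later (Cocycle.next τ) Cocycle.IsCob N x →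
      ∀ α, Represents (injectiveResolution (Q N)) x.1 α →
        ∃ M₀, ∀ M ≥ M₀, cohMap (ρ N M) n α = 0 := by
    intro N x hx
    induction hx with
    | now N x hx =>
      intro α hα
      obtain rfl := hα.unique (represents_zero_iff.2 hx)
      exact ⟨0, fun M _ => map_zero _⟩
    | next N x _ ih =>
      intro α hα
      obtain ⟨M₀, hM₀⟩ := ih _ (hα.map (InjectiveResolution.desc (τ N) _ _)
        (InjectiveResolution.desc_commutes_zero _ _ _))
      refine ⟨M₀ + 1, fun M hM => ?_⟩
      obtain ⟨M, rfl⟩ : ∃ M', M = M' + 1 := ⟨M - 1, by omega⟩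
      rw [← hτρ, cohMap_comp]
      exact hM₀ M (by omega)
  obtain ⟨x, hx⟩ := exists_represents (injectiveResolution (Q 0)) (cohMap (e 0) n u)
  obtain ⟨N₀, hN₀⟩ := main 0 ⟨x, hx.d_eq_zero⟩ (later_isCob τ hQ n ⊤ 0 _) _ hx
  refine ⟨N₀, fun N hN => ?_⟩
  have := hN₀ N hN
  rwa [← cohMap_comp, heρ, zero_add] at this

end VectSheaf

/-! ### The Čech complex -/

namespace VectSheaf

variable {ι : Type} (U : ι → Opens X) (F : VectSheaf X)

lemma inf_iInf_le_inf_iInf {m n : ℕ} {W W' : Opens X} (hW : W' ≤ W) (σ : Fin n → ι)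
    (θ : Fin m → Fin n) : W' ⊓ ⨅ k, U (σ k) ≤ W ⊓ ⨅ k, U (σ (θ k)) :=
  inf_le_inf hW (le_iInf fun l => iInf_le (fun l => U (σ l)) (θ l))

variable {U F}

/-- The value `f(i_{θ 0}, …, i_{θ p})` of a cochain on a face of the simplex `σ = (i₀, …, i_n)`,
restricted to `W ∩ U_{i₀} ∩ … ∩ U_{i_n}`. -/
def face {p n : ℕ} {W : Opens X} (f : CechCochain U F p W) (σ : Fin (n + 1) → ι)
    (θ : Fin (p + 1) → Fin (n + 1)) : F.sec (W ⊓ ⨅ k, U (σ k)) :=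
  F.res (inf_iInf_le_inf_iInf U le_rfl σ θ) (f (σ ∘ θ))

lemma sheaf_res_res {U V W : Opens X} (h : V ≤ U) (h' : W ≤ V) (x : F.sec U) :
    F.res h' (F.res h x) = F.res (h'.trans h) x := Psh.res_res (P := F.obj) h h' x

lemma sheaf_res_self {U : Opens X} (h : U ≤ U) (x : F.sec U) : F.res h x = x :=
  Psh.res_self (P := F.obj) h x

lemma secMap_res {G : VectSheaf X} (g : F ⟶ G) {U W : Opens X} (h : W ≤ U) (x : F.sec U) :
    secMap g W (F.res h x) = G.res h (secMap g U x) := Psh.app_res g.hom h x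

lemma res_face {p m n : ℕ} {W : Opens X} (f : CechCochain U F p W) (σ : Fin (n + 1) → ι)
    (η : Fin (m + 1) → Fin (n + 1)) (θ : Fin (p + 1) → Fin (m + 1)) :
    F.res (inf_iInf_le_inf_iInf U le_rfl σ η) (face f (σ ∘ η) θ) = face f σ (η ∘ θ) :=
  sheaf_res_res _ _ _

lemma cechD_apply {p : ℕ} {W : Opens X} (f : CechCochain U F p W) (σ : Fin (p + 2) → ι) :
    cechD f σ = ∑ k : Fin (p + 2), (-1 : ℤ) ^ (k : ℕ) • face f σ k.succAbove := rfl

lemma face_cechD {p n : ℕ} {W : Opens X} (f : CechCochain U F p W) (σ : Fin (n + 1) → ι)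
    (η : Fin (p + 2) → Fin (n + 1)) :
    face (cechD f) σ η = ∑ k : Fin (p + 2), (-1 : ℤ) ^ (k : ℕ) • face f σ (η ∘ k.succAbove) := by
  unfold face
  rw [cechD_apply, map_sum]
  refine Finset.sum_congr rfl fun k _ => ?_
  rw [map_zsmul]
  exact congrArg _ (res_face f σ η _)

variable (U F)

/-- The cosimplicial vector space of Čech cochains on `W`. -/
def cechCosimplicial (W : Opens X) : CosimplicialObject (ModuleCat.{0} ℂ) where
  obj n := ModuleCat.of ℂ (CechCochain U F n.len W)
  map θ := ModuleCat.ofHom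
    { toFun := fun f σ => face f σ θ.toOrderHom
      map_add' := fun f g => funext fun σ => map_add _ _ _
      map_smul' := fun c f => funext fun σ => map_smul _ _ _ }
  map_id n := by
    ext f σ
    exact sheaf_res_self _ _
  map_comp θ η := by
    ext f σ
    exact (res_face f σ η.toOrderHom θ.toOrderHom).symm

variable {U F}

lemma cechD_cechD {p : ℕ} {W : Opens X} (f : CechCochain U F p W) : cechD (cechD f) = 0 := by
  have key : ∀ (n : ℕ) (g : CechCochain U F n W),
      (AlgebraicTopology.AlternatingCofaceMapComplex.objD (cechCosimplicial U F W) n).hom g =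
        cechD g := by
    intro n g
    refine funext fun σ => ?_
    exact map_sum (AddMonoidHom.mk' (fun φ : (cechCosimplicial U F W).obj (.mk n) ⟶
      (cechCosimplicial U F W).obj (.mk (n + 1)) => (φ.hom g : CechCochain U F (n + 1) W) σ)
        fun _ _ => rfl) _ _
  have := AlgebraicTopology.AlternatingCofaceMapComplex.d_squared (cechCosimplicial U F W) p
  have := congrArg (fun φ => φ.hom f) this
  rw [← key, ← key]
  exact this

lemma cechD_cechAug {W : Opens X} (a : F.sec W) : cechD (cechAug (U := U) a) = 0 := by
  refine funext fun σ => ?_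
  rw [cechD_apply, Fin.sum_univ_two]
  simp only [face, cechAug, sheaf_res_res]
  simp

lemma cechD_res {p : ℕ} {W W' : Opens X} (h : W' ≤ W) (f : CechCochain U F p W) :
    cechD (cechRes h f) = cechRes h (cechD f) := by
  refine funext fun σ => ?_
  simp only [cechRes, cechD_apply, map_sum, map_zsmul, face, sheaf_res_res]

/-- The map on Čech cochains induced by a morphism of sheaves. -/
def cechMap {G : VectSheaf X} (g : F ⟶ G) {p : ℕ} {W : Opens X} (f : CechCochain U F p W) :
    CechCochain U G p W := fun σ => secMap g _ (f σ)

lemma cechD_cechMap {G : VectSheaf X} (g : F ⟶ G) {p : ℕ} {W : Opens X}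
    (f : CechCochain U F p W) : cechD (cechMap g f) = cechMap g (cechD f) := by
  refine funext fun σ => ?_
  simp only [cechMap, cechD_apply, map_sum, map_zsmul, face, secMap_res]
  rfl

variable (U F)

/-- The presheaf `W ↦ C^p(W)` of Čech cochains. -/
def cechPsh (p : ℕ) : Psh X where
  obj W := ModuleCat.of ℂ (CechCochain U F p W.unop)
  map h := ModuleCat.ofHom
    { toFun := cechRes (leOfHom h.unop)
      map_add' := fun f g => funext fun σ => map_add _ _ _
      map_smul' := fun c f => funext fun σ => map_smul _ _ _ }
  map_id W := by
    ext f σ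
    exact sheaf_res_self _ _
  map_comp h h' := by
    ext f σ
    exact (sheaf_res_res _ _ _).symm

/-- The Čech differential as a morphism of presheaves. -/
def cechDHom (p : ℕ) : cechPsh U F p ⟶ cechPsh U F (p + 1) :=
  homMk (fun _ =>
    { toFun := fun f => cechD f
      map_add' := fun f g => funext fun σ => by
        refine Eq.trans ?_ (Finset.sum_add_distrib)
        refine Finset.sum_congr rfl fun k _ => ?_
        rw [← smul_add]
        exact congrArg _ (map_add _ _ _)
      map_smul' := fun c f => funext fun σ => by
        change _ = c • ∑ k : Fin (p + 2), (-1 : ℤ) ^ (k : ℕ) • face f σ k.succAbove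
        rw [Finset.smul_sum]
        refine Finset.sum_congr rfl fun k _ => ?_
        rw [smul_comm]
        exact congrArg _ (map_smul _ _ _) })
    fun h f => cechD_res h f

/-- The augmentation `F ⟶ C⁰` as a morphism of presheaves. -/
def cechAugHom : F.obj ⟶ cechPsh U F 0 :=
  homMk (fun _ =>
    { toFun := fun a => cechAug a
      map_add' := fun _ _ => funext fun _ => map_add _ _ _
      map_smul' := fun _ _ => funext fun _ => map_smul _ _ _ })
    fun _ _ => funext fun _ => (sheaf_res_res (F := F) _ _ _).trans (sheaf_res_res _ _ _).symm

/-- The Čech resolution `F → C⁰ → C¹ → ⋯`, with `F` in degree `0`. -/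
abbrev cechSeq : PshSeq X where
  obj n := match n with
    | 0 => F.obj
    | n + 1 => cechPsh U F n
  d n := match n with
    | 0 => cechAugHom U F
    | n + 1 => cechDHom U F n

/-- The Čech complex `C⁰ → C¹ → ⋯`. -/
abbrev cechSeqPos : PshSeq X where
  obj n := cechPsh U F n
  d n := cechDHom U F n

variable {U F} in
/-- The morphism of Čech resolutions induced by a morphism of sheaves. -/
def cechSeqMap {G : VectSheaf X} (g : F ⟶ G) :
    ∀ n, (cechSeq U F).obj n ⟶ (cechSeq U G).obj n
  | 0 => g.hom
  | n + 1 => homMk (P := cechPsh U F n) (Q := cechPsh U G n) (fun _ =>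
    { toFun := fun f => cechMap g f
      map_add' := fun _ _ => funext fun _ => map_add _ _ _
      map_smul' := fun _ _ => funext fun _ => map_smul _ _ _ })
    fun _ _ => funext fun _ => secMap_res g _ _

variable {U F}

lemma cechSeqMap_comm {G : VectSheaf X} (g : F ⟶ G) : ∀ n,
    cechSeqMap g n ≫ (cechSeq U G).d n = (cechSeq U F).d n ≫ cechSeqMap g (n + 1)
  | 0 => hom_ext fun _ _ => funext fun _ => (secMap_res g _ _).symm
  | _ + 1 => hom_ext fun _ f => cechD_cechMap g f

lemma cechSeqMap_comp_eq_zero {G H : VectSheaf X} (g : F ⟶ G) (h : G ⟶ H) (hgh : g ≫ h = 0) :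
    ∀ n, cechSeqMap (U := U) g n ≫ cechSeqMap h n = 0
  | 0 => congrArg (fun f => f.hom) hgh
  | _ + 1 => hom_ext fun _ f => funext fun σ => congrArg (fun k => secMap k _ (f σ)) hgh

lemma cechSeq_d_d : ∀ n, (cechSeq U F).d n ≫ (cechSeq U F).d (n + 1) = 0
  | 0 => hom_ext fun _ a => cechD_cechAug a
  | _ + 1 => hom_ext fun _ f => cechD_cechD f

/-! ### Contractions of the Čech complex -/

/-- A retraction of the augmentation `F → C⁰` over the open subsets of `W₀`. -/
structure CechRetraction (U : ι → Opens X) (F : VectSheaf X) (W₀ : Opens X) where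
  map : ∀ W : Opens X, W ≤ W₀ → CechCochain U F 0 W →ₗ[ℂ] F.sec W
  map_res : ∀ {W W' : Opens X} (hW : W ≤ W₀) (h : W' ≤ W) (f : CechCochain U F 0 W),
    map W' (h.trans hW) (cechRes h f) = F.res h (map W hW f)
  map_aug : ∀ (W : Opens X) (hW : W ≤ W₀) (a : F.sec W), map W hW (cechAug a) = a

/-- On the subsets of a member of the cover, evaluation at this member is a retraction. -/
def CechRetraction.ofLE {W₀ : Opens X} (i : ι) (h : W₀ ≤ U i) : CechRetraction U F W₀ where
  map W hW := (F.res (le_inf le_rfl (le_iInf fun _ => hW.trans h))).comp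
    (LinearMap.proj (R := ℂ) (φ := fun σ : Fin 1 → ι => F.sec (W ⊓ ⨅ k, U (σ k))) fun _ => i)
  map_res _ _ _ := (sheaf_res_res _ _ _).trans (sheaf_res_res _ _ _).symm
  map_aug _ _ _ := (sheaf_res_res _ _ _).trans (sheaf_res_self _ _)

lemma exists_mem_of_iSup_eq_top (hU : (⨆ i, U i) = ⊤) (p : X) : ∃ i, p ∈ U i := by
  have : p ∈ ⨆ i, U i := hU ▸ Opens.mem_top p
  simpa using this

lemma eq_zero_of_cechAug_eq_zero (hU : (⨆ i, U i) = ⊤) {W : Opens X} (a : F.sec W)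
    (ha : cechAug (U := U) a = 0) : a = 0 := by
  refine isSep_of_sheaf F W a fun p hp => ?_
  obtain ⟨i, hi⟩ := exists_mem_of_iSup_eq_top hU p
  refine ⟨W ⊓ ⨅ _ : Fin 1, U i, inf_le_left, ⟨hp, ?_⟩, congrFun ha fun _ => i⟩
  simpa using hi

/-- If `F` is injective, the augmentation `F ⟶ C⁰` has a retraction. -/
lemma nonempty_cechRetraction [Injective F] (hU : (⨆ i, U i) = ⊤) :
    Nonempty (CechRetraction U F ⊤) := by
  obtain ⟨g, hg⟩ := exists_extension (cechAugHom U F) (𝟙 F.obj)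
    fun W a ha => eq_zero_of_cechAug_eq_zero hU a ha
  exact ⟨⟨fun W _ => app g W, fun _ h f => app_res g h f,
    fun W _ a => congrArg (fun f => app f W a) hg⟩⟩

namespace CechRetraction

variable {W : Opens X}

lemma slice_le (W : Opens X) {p : ℕ} (σ : Fin (p + 1) → ι) (τ : Fin 1 → ι) :
    (W ⊓ ⨅ k, U (σ k)) ⊓ ⨅ k, U (τ k) ≤
      W ⊓ ⨅ k, U ((Fin.cons (τ 0) σ : Fin (p + 2) → ι) k) := by
  refine le_inf (inf_le_left.trans inf_le_left) (le_iInf fun k => Fin.cases ?_ (fun k => ?_) k)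
  · exact inf_le_right.trans (iInf_le (fun k => U (τ k)) 0)
  · exact (inf_le_left.trans inf_le_right).trans (iInf_le (fun k => U (σ k)) k)

/-- The family `j ↦ f(j, i₀, …, i_p)` as a `0`-cochain on `W ∩ U_{i₀} ∩ … ∩ U_{i_p}`. -/
def slice {p : ℕ} (f : CechCochain U F (p + 1) W) (σ : Fin (p + 1) → ι) :
    CechCochain U F 0 (W ⊓ ⨅ k, U (σ k)) := fun τ =>
  F.res (slice_le W σ τ)
    (f (Fin.cons (τ 0) σ))

lemma exists_cechAug_eq (r : CechRetraction U F W) (f : CechCochain U F 0 W) (hf : cechD f = 0) :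
    ∃ a : F.sec W, cechAug a = f := by
  refine ⟨r.map W le_rfl f, funext fun σ => ?_⟩
  have e : cechRes inf_le_left f = cechAug (W := W ⊓ ⨅ k, U (σ k)) (f σ) := by
    refine funext fun τ => ?_
    have := congrFun hf (Fin.cons (τ 0) σ)
    rw [cechD_apply, Fin.sum_univ_two] at this
    have h := congrArg (F.res (slice_le W σ τ)) this
    simp only [Fin.val_zero, pow_zero, one_smul, Fin.val_one, pow_one, neg_smul, map_add, map_neg,
      Pi.zero_apply, map_zero, face, sheaf_res_res] at h
    have e0 : (Fin.cons (τ 0) σ : Fin 2 → ι) ∘ (0 : Fin 2).succAbove = σ := by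
      funext k; simp
    have e1 : (Fin.cons (τ 0) σ : Fin 2 → ι) ∘ (1 : Fin 2).succAbove = τ := by
      funext k; fin_cases k; rfl
    have congr : ∀ {τ τ' : Fin 1 → ι} (_ : τ = τ') {V : Opens X} (h : V ≤ W ⊓ ⨅ k, U (τ k))
        (h' : V ≤ W ⊓ ⨅ k, U (τ' k)), F.res h (f τ) = F.res h' (f τ') := by
      rintro _ _ rfl _ _ _; rfl
    rw [congr e0 _ (inf_le_left), congr e1 _ (inf_le_inf_right _ inf_le_left)] at h
    exact (add_neg_eq_zero.1 h).symm
  have := r.map_aug (W ⊓ ⨅ k, U (σ k)) inf_le_left (f σ)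
  rw [← e, r.map_res le_rfl] at this
  exact this

lemma exists_cechD_eq (r : CechRetraction U F W) {p : ℕ} (f : CechCochain U F (p + 1) W)
    (hf : cechD f = 0) :
    ∃ g : CechCochain U F p W, cechD g = f := by
  refine ⟨fun σ => r.map _ inf_le_left (slice f σ), funext fun σ => ?_⟩
  have e : cechAug (W := W ⊓ ⨅ k, U (σ k)) (f σ) = ∑ l : Fin (p + 2), (-1 : ℤ) ^ (l : ℕ) •
      cechRes (inf_iInf_le_inf_iInf U le_rfl σ l.succAbove) (slice f (σ ∘ l.succAbove)) := by
    refine funext fun τ => ?_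
    have := congrFun hf (Fin.cons (τ 0) σ)
    rw [cechD_apply, Fin.sum_univ_succ] at this
    have h := congrArg (F.res (slice_le W σ τ)) this
    have congr : ∀ {τ τ' : Fin (p + 2) → ι} (_ : τ = τ') {V : Opens X}
        (h : V ≤ W ⊓ ⨅ k, U (τ k)) (h' : V ≤ W ⊓ ⨅ k, U (τ' k)),
        F.res h (f τ) = F.res h' (f τ') := by
      rintro _ _ rfl _ _ _; rfl
    simp only [map_add, map_sum, map_neg, map_zsmul, Pi.zero_apply, map_zero, face, sheaf_res_res,
      Fin.val_zero, pow_zero, one_smul, Fin.val_succ, pow_succ, mul_neg_one, neg_smul,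
      Finset.sum_neg_distrib] at h
    rw [add_neg_eq_zero] at h
    rw [Finset.sum_apply]
    refine Eq.trans ?_ (h.trans (Finset.sum_congr rfl fun l _ => congrArg _ ?_))
    · exact congr (by funext k; simp) _ _
    · refine Eq.trans ?_ (sheaf_res_res _ _ _).symm
      exact congr (by
        funext k
        refine Fin.cases ?_ (fun k => ?_) k <;> simp) _ _
  have := r.map_aug (W ⊓ ⨅ k, U (σ k)) inf_le_left (f σ)
  rw [e, map_sum] at this
  refine Eq.trans (Finset.sum_congr rfl fun l _ => ?_) this
  rw [map_zsmul, r.map_res inf_le_left]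
  rfl

end CechRetraction

/-- The Čech complex is a resolution. -/
lemma locExact_cechSeq (hU : (⨆ i, U i) = ⊤) : (cechSeq U F).LocExact where
  zero W a ha p hp := by
    refine ⟨W, le_rfl, hp, ?_⟩
    rw [eq_zero_of_cechAug_eq_zero hU a ha, map_zero]
  succ n W f hf p hp := by
    obtain ⟨i, hi⟩ := exists_mem_of_iSup_eq_top hU p
    refine ⟨W ⊓ U i, inf_le_left, ⟨hp, hi⟩, ?_⟩
    have hf' : app ((cechSeq U F).d (n + 1)) (W ⊓ U i)
        (((cechSeq U F).obj (n + 1)).res inf_le_left f) = 0 := by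
      rw [app_res, hf, map_zero]
    let r : CechRetraction U F (W ⊓ U i) := CechRetraction.ofLE i inf_le_right
    cases n with
    | zero => exact r.exists_cechAug_eq _ hf'
    | succ n => exact r.exists_cechD_eq _ hf'

/-- The Čech complex of an injective sheaf is exact on global sections. -/
lemma exists_cechSeq_d_eq [Injective F] (hU : (⨆ i, U i) = ⊤) (n : ℕ)
    (f : ((cechSeq U F).obj (n + 1)).sec ⊤) (hf : app ((cechSeq U F).d (n + 1)) ⊤ f = 0) :
    ∃ g, app ((cechSeq U F).d n) ⊤ g = f := by
  obtain ⟨r⟩ := nonempty_cechRetraction (F := F) hU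
  cases n with
  | zero => exact r.exists_cechAug_eq _ hf
  | succ n => exact r.exists_cechD_eq _ hf

end VectSheaf

/-! ### The cup product of Čech cochains -/

namespace VectSheaf

variable {ι : Type} {U : ι → Opens X} {F : VectSheaf X}

lemma sum_fin_eq_add {M : Type*} [AddCommMonoid M] {a b n : ℕ} (h : a + b = n) (t : Fin n → M) :
    ∑ k, t k = ∑ k : Fin a, t ⟨k, by omega⟩ + ∑ l : Fin b, t ⟨a + l, by omega⟩ := by
  subst h
  exact Fin.sum_univ_add t

lemma val_succAbove_eq_ite {n : ℕ} (k : Fin (n + 1)) (l : Fin n) :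
    (k.succAbove l : ℕ) = if (l : ℕ) < k then (l : ℕ) else l + 1 := by
  unfold Fin.succAbove
  split_ifs with h h' h' <;> simp_all [Fin.lt_def]

/-- The cup product of cochains of degrees `p` and `q` as a cochain of degree `n = p + q`. -/
def cechCupTo (m : Pairing F F F) {p q n : ℕ} (h : p + q = n) {W : Opens X}
    (f : CechCochain U F p W) (g : CechCochain U F q W) : CechCochain U F n W :=
  fun σ => m.map _ (face f σ fun l => ⟨l, by omega⟩) (face g σ fun l => ⟨p + l, by omega⟩)

lemma face_cechCupTo (m : Pairing F F F) {p q n k : ℕ} (h : p + q = n) {W : Opens X}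
    (f : CechCochain U F p W) (g : CechCochain U F q W) (σ : Fin (k + 1) → ι)
    (θ : Fin (n + 1) → Fin (k + 1)) : face (cechCupTo m h f g) σ θ =
      m.map _ (face f σ (θ ∘ fun l => ⟨l, by omega⟩))
        (face g σ (θ ∘ fun l => ⟨p + l, by omega⟩)) := by
  refine (m.res_map _ _ _).trans ?_
  exact congrArg₂ (fun x y => m.map _ x y) (res_face f σ θ _) (res_face g σ θ _)

lemma cechD_cechCupTo (m : Pairing F F F) {p q n : ℕ} (h : p + q = n) {W : Opens X}
    (f : CechCochain U F p W) (g : CechCochain U F q W) :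
    cechD (cechCupTo m h f g) = cechCupTo m (p := p + 1) (n := n + 1) (by omega) (cechD f) g +
      (-1 : ℤ) ^ p • cechCupTo m (q := q + 1) (n := n + 1) (by omega) f (cechD g) := by
  refine funext fun σ => ?_
  have e1 : cechCupTo m (p := p + 1) (n := n + 1) (by omega) (cechD f) g σ =
      ∑ k : Fin (p + 1), (-1 : ℤ) ^ (k : ℕ) •
        m.map _ (face f σ ((fun l : Fin (p + 2) => ⟨l, by omega⟩) ∘ k.castSucc.succAbove))
          (face g σ fun l => ⟨p + 1 + l, by omega⟩) +
      (-1 : ℤ) ^ (p + 1) • m.map _ (face f σ fun l => ⟨l, by omega⟩)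
        (face g σ fun l => ⟨p + 1 + l, by omega⟩) := by
    rw [cechCupTo, face_cechD, map_sum, LinearMap.sum_apply, Fin.sum_univ_castSucc]
    simp only [map_zsmul, LinearMap.smul_apply]
    congr 3
    · congr 2
      refine funext fun l => Fin.ext ?_
      simp only [Function.comp_apply, val_succAbove_eq_ite, Fin.val_last, l.isLt, if_true]
  have e2 : cechCupTo m (q := q + 1) (n := n + 1) (by omega) f (cechD g) σ =
      m.map _ (face f σ fun l => ⟨l, by omega⟩) (face g σ fun l => ⟨p + 1 + l, by omega⟩) +
      ∑ k : Fin (q + 1), (-1 : ℤ) ^ (k.succ : ℕ) • m.map _ (face f σ fun l => ⟨l, by omega⟩)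
        (face g σ ((fun l : Fin (q + 2) => ⟨p + l, by omega⟩) ∘ k.succ.succAbove)) := by
    rw [cechCupTo, face_cechD, map_sum, Fin.sum_univ_succ]
    simp only [map_zsmul, Fin.val_zero, pow_zero, one_smul]
    congr 3
    · refine funext fun l => Fin.ext ?_
      simp only [Function.comp_apply, val_succAbove_eq_ite, Fin.val_zero, Nat.not_lt_zero,
        if_false]
      omega
  refine ((cechD_apply _ σ).trans
    (sum_fin_eq_add (a := p + 1) (b := q + 1) (n := n + 2) (by omega) _)).trans ?_
  change _ = _ + (-1 : ℤ) ^ p • cechCupTo m (q := q + 1) (n := n + 1) (by omega) f (cechD g) σ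
  have cancel : ∀ A S T : F.sec (W ⊓ ⨅ k, U (σ k)), A + (-1 : ℤ) ^ (p + 1) • T +
      (-1 : ℤ) ^ p • (T + S) = A + (-1 : ℤ) ^ p • S := fun A S T => by
    rw [smul_add, pow_succ, mul_neg_one, neg_smul]
    abel
  rw [e1, e2, cancel, Finset.smul_sum]
  simp only [face_cechCupTo]
  congr 1
  · refine Finset.sum_congr rfl fun k _ => ?_
    congr 3
    · congr 1
      refine funext fun l => Fin.ext ?_
      simp only [Function.comp_apply, val_succAbove_eq_ite, Fin.val_castSucc]
    · refine funext fun l => Fin.ext ?_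
      simp only [Function.comp_apply, val_succAbove_eq_ite]
      split_ifs <;> omega
  · refine Finset.sum_congr rfl fun k _ => ?_
    rw [smul_smul, ← pow_add]
    refine congrArg₂ (fun (c : ℤ) v => c • v) (congrArg _ ?_)
      (congrArg₂ (fun x y => m.map _ x y) (congrArg _ ?_) (congrArg _ ?_))
    · simp only [Fin.val_succ]
      omega
    · refine funext fun l => Fin.ext ?_
      simp only [Function.comp_apply, val_succAbove_eq_ite]
      split_ifs <;> omega
    · refine funext fun l => Fin.ext ?_
      simp only [Function.comp_apply, val_succAbove_eq_ite, Fin.val_succ]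
      split_ifs <;> omega

/-- The cup product as a pairing of the Čech resolution with itself. -/
def cechBiPairing (m : Pairing F F F) :
    BiPairing (cechSeq U F) (cechSeq U F) (cechSeqPos U F) where
  map p q n h W := LinearMap.mk₂ ℂ (fun (f : CechCochain U F p W) (g : CechCochain U F q W) =>
      cechCupTo m h f g)
    (fun f f' g => funext fun σ => by
      refine (congrArg (fun x => m.map _ x _) (map_add (F.res _) _ _)).trans ?_
      rw [map_add]; rfl)
    (fun c f g => funext fun σ => by
      refine (congrArg (fun x => m.map _ x _) (map_smul (F.res _) _ _)).trans ?_
      rw [map_smul]; rfl)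
    (fun f g g' => funext fun σ => by
      refine (congrArg (fun x => m.map _ _ x) (map_add (F.res _) _ _)).trans ?_
      rw [map_add]; rfl)
    (fun c f g => funext fun σ => by
      refine (congrArg (fun x => m.map _ _ x) (map_smul (F.res _) _ _)).trans ?_
      rw [map_smul]; rfl)
  res_map p q n h W W' hW f g := funext fun σ => by
    refine Eq.trans ?_ (m.res_map _ _ _).symm
    exact congrArg₂ (fun x y => m.map _ x y)
      ((sheaf_res_res _ _ _).trans (sheaf_res_res _ _ _).symm)
      ((sheaf_res_res _ _ _).trans (sheaf_res_res _ _ _).symm)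
  leibniz p q n h W f g := cechD_cechCupTo m h f g

/-! ### From Čech cohomology to sheaf cohomology -/

variable {I : InjectiveResolution F}

/-- A morphism from the Čech resolution to an injective resolution, in terms of presheaves. -/
def CechMorphism.hom (φ : CechMorphism U I) (p : ℕ) : cechPsh U F p ⟶ (seq I).obj p :=
  homMk (φ.map p) (φ.map_res p)

lemma CechMorphism.hom_comm (φ : CechMorphism U I) (p : ℕ) :
    φ.hom p ≫ (seq I).d p = cechDHom U F p ≫ φ.hom (p + 1) :=
  hom_ext fun W f => (φ.map_d p W f).symm

/-- A morphism of complexes of presheaves as a `CechMorphism`. -/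
def CechMorphism.mk' (θ : ∀ p, cechPsh U F p ⟶ (seq I).obj p)
    (h₀ : cechAugHom U F ≫ θ 0 = (aug I).hom)
    (hθ : ∀ p, θ p ≫ (seq I).d p = cechDHom U F p ≫ θ (p + 1)) : CechMorphism U I where
  map p W := app (θ p) W
  map_res p _ _ h f := app_res (θ p) h f
  map_d p W f := (congrArg (fun g => app g W f) (hθ p)).symm
  map_aug W a := congrArg (fun g => app g W a) h₀

lemma nonempty_cechMorphism (hU : (⨆ i, U i) = ⊤) (I : InjectiveResolution F) :
    Nonempty (CechMorphism U I) := by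
  obtain ⟨θ, h₀, hθ⟩ := (locExact_cechSeq (F := F) hU).exists_lift (isInjSep_seq I) (aug I).hom
    (aug_d I)
  exact ⟨CechMorphism.mk' θ h₀ hθ⟩

lemma CechMorphism.exists_represents (φ : CechMorphism U I) {p : ℕ} (f : CechCochain U F p ⊤)
    (hf : cechD f = 0) : ∃ α, Represents I (φ.map p ⊤ f) α := by
  refine exists_represents_of_d_eq_zero _ ((φ.map_d p ⊤ f).symm.trans ?_)
  rw [hf, map_zero]

/-- The class of a Čech cocycle depends neither on the injective resolution nor on the morphism
from the Čech resolution. -/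
lemma CechMorphism.represents (hU : (⨆ i, U i) = ⊤) {I' : InjectiveResolution F}
    (φ : CechMorphism U I) (φ' : CechMorphism U I') {p : ℕ} (f : CechCochain U F p ⊤)
    (hf : cechD f = 0) {α : F.coh p} (h : Represents I (φ.map p ⊤ f) α) :
    Represents I' (φ'.map p ⊤ f) α := by
  let ψ := InjectiveResolution.desc (𝟙 F) I' I
  have h' := h.map ψ (InjectiveResolution.desc_commutes_zero (𝟙 F) I' I)
  rw [cohMap_id] at h'
  refine h'.of_isCob_sub ?_
  let D : ∀ n, cechPsh U F n ⟶ (seq I').obj n := fun n => φ'.hom n - φ.hom n ≫ (ψ.f n).hom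
  refine (locExact_cechSeq (F := F) hU).exists_d_eq (isInjSep_seq I').hat 0 D ?_ (fun n => ?_)
    (p := p) f hf
  · refine Limits.zero_comp.trans ?_
    refine hom_ext fun W a => ?_
    have e : secMap (ψ.f 0) W (secMap (aug I) W a) = secMap (aug I') W a :=
      congrArg (fun g => secMap g W a)
        ((InjectiveResolution.desc_commutes_zero (𝟙 F) I' I).trans (Category.id_comp _))
    have e1 := φ.map_aug W a
    have e2 := φ'.map_aug W a
    refine (sub_eq_zero.2 ?_).symm
    exact e2.trans (e.symm.trans (congrArg (secMap (ψ.f 0) W) e1).symm)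
  · change D n ≫ (seq I').d n = cechDHom U F n ≫ D (n + 1)
    simp only [D, Preadditive.sub_comp, Preadditive.comp_sub]
    rw [φ'.hom_comm, Category.assoc, desc_seq_comm, ← Category.assoc, φ.hom_comm, Category.assoc]

theorem existsUnique_isCechClass (hU : (⨆ i, U i) = ⊤) {p : ℕ} (f : CechCochain U F p ⊤)
    (hf : cechD f = 0) : ∃! α, IsCechClass f α := by
  obtain ⟨φ⟩ := nonempty_cechMorphism hU (injectiveResolution F)
  obtain ⟨α, hα⟩ := φ.exists_represents f hf
  refine ⟨α, ⟨hf, _, φ, hα⟩, ?_⟩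
  rintro β ⟨-, I', φ', hβ⟩
  exact (φ'.represents hU φ f hf hβ).unique hα

/-- The canonical map from Čech cohomology to sheaf cohomology is multiplicative. -/
theorem IsCechClass.cup (hU : (⨆ i, U i) = ⊤) (m : Pairing F F F) {p q : ℕ}
    {f : CechCochain U F p ⊤} {g : CechCochain U F q ⊤} {α : F.coh p} {β : F.coh q}
    (hf : IsCechClass f α) (hg : IsCechClass g β) :
    IsCechClass (cechCup m f g) (VectSheaf.cup m p q α β) := by
  obtain ⟨hdf, I, φ, hα⟩ := hf
  obtain ⟨hdg, I', φ', hβ'⟩ := hg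
  have hβ := φ'.represents hU φ g hdg hβ'
  obtain ⟨M⟩ := nonempty_pairingExtension m I
  have hd : cechD (cechCup m f g) = 0 := by
    refine (cechD_cechCupTo m rfl f g).trans ?_
    rw [hdf, hdg]
    have e1 : cechCupTo m (p := p + 1) (n := p + q + 1) (by omega)
        (0 : CechCochain U F (p + 1) ⊤) g = 0 := LinearMap.congr_fun (map_zero
      ((cechBiPairing (U := U) m).map (p + 1) q (p + q + 1) (by omega) ⊤)) g
    have e2 : cechCupTo m (q := q + 1) (n := p + q + 1) (by omega) f
        (0 : CechCochain U F (q + 1) ⊤) = 0 :=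
      map_zero ((cechBiPairing (U := U) m).map p (q + 1) (p + q + 1) (by omega) ⊤ f)
    rw [e1, e2, smul_zero, add_zero]
  refine ⟨hd, I, φ, (Represents.cup hα hβ M).of_isCob_sub ?_⟩
  let N := ((cechBiPairing (U := U) m).postcomp φ.hom φ.hom_comm).sub
    (M.toBiPairing.precomp φ.hom φ.hom_comm φ.hom φ.hom_comm)
  refine N.isCob_of_aug_eq_zero (locExact_cechSeq hU) (locExact_cechSeq hU) (cechSeq_d_d 0)
    (isInjSep_seq I) (fun W a b => ?_) rfl f hdf g hdg
  have e1 : cechCupTo m (U := U) (rfl : 0 + 0 = 0) (cechAug a) (cechAug b) =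
      cechAug (m.map W a b) := funext fun σ => by
    refine Eq.trans ?_ (m.res_map _ _ _).symm
    exact congrArg₂ (fun x y => m.map _ x y) (sheaf_res_res _ _ _) (sheaf_res_res _ _ _)
  have e2 := (φ.map_aug W (m.map W a b))
  refine sub_eq_zero.2 ?_
  refine (congrArg (φ.map 0 W) e1).trans (e2.trans ?_)
  refine (M.mul_aug W a b).symm.trans ?_
  exact congrArg₂ (fun x y => (M.mul 0 0 0 rfl).map W x y) (φ.map_aug W a).symm
    (φ.map_aug W b).symm

end VectSheaf

/-! ### Acyclic covers -/

/-- A double complex `L^{p,q}` whose rows are exact, apart from the row `q = 0`, whose columns are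
exact, apart from the column `p = 0`, and a chain map `Φ` from the total complex of the part
`p, q ≥ 1` to the column `p = 0` which extends the identity. Here a sequence `L⁰ → L¹ → ⋯` is
called exact if `0 → L⁰ → L¹ → ⋯` is. In the application `L^{p+1,q+1}` consists of the Čech
`p`-cochains with values in `I^q`, the row `q = 0` is the Čech complex of a sheaf `F` and the column
`p = 0` is an injective resolution `F → I^•`, on global sections. -/
structure DoubleResolution where
  /-- the term in degree `(p, q)` -/
  L : ℕ → ℕ → Type
  [grp : ∀ p q, AddCommGroup (L p q)]
  /-- the horizontal differential -/
  d₁ : ∀ p q, L p q →+ L (p + 1) q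
  /-- the vertical differential -/
  d₂ : ∀ p q, L p q →+ L p (q + 1)
  comm : ∀ p q x, d₁ p (q + 1) (d₂ p q x) = d₂ (p + 1) q (d₁ p q x)
  d₁_d₁ : ∀ p q x, d₁ (p + 1) q (d₁ p q x) = 0
  d₂_d₂ : ∀ p q x, d₂ p (q + 1) (d₂ p q x) = 0
  inj₁ : ∀ q x, d₁ 0 (q + 1) x = 0 → x = 0
  exact₁ : ∀ p q x, d₁ (p + 1) (q + 1) x = 0 → ∃ w, d₁ p (q + 1) w = x
  inj₂ : ∀ p x, d₂ (p + 1) 0 x = 0 → x = 0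
  exact₂ : ∀ p q x, d₂ (p + 1) (q + 1) x = 0 → ∃ w, d₂ (p + 1) q w = x
  /-- the chain map from the total complex to the column `p = 0` -/
  Φ : ∀ p q n, p + q = n → L (p + 1) (q + 1) →+ L 0 (n + 1)
  Φ_d : ∀ p q n (h : p + q = n) x, d₂ 0 (n + 1) (Φ p q n h x) =
    Φ (p + 1) q (n + 1) (by omega) (d₁ (p + 1) (q + 1) x) +
      (-1 : ℤ) ^ p • Φ p (q + 1) (n + 1) (by omega) (d₂ (p + 1) (q + 1) x)
  Φ_d₁ : ∀ q x, Φ 0 q q (zero_add q) (d₁ 0 (q + 1) x) = x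

namespace DoubleResolution

attribute [instance] grp

variable (D : DoubleResolution)

/-- The element `x` of the column `p = 0` is a coboundary of the complex
`0 → L^{0,1} → L^{0,2} → ⋯`. -/
def IsCob : ∀ n, D.L 0 (n + 1) → Prop
  | 0, x => x = 0
  | n + 1, x => ∃ w, D.d₂ 0 (n + 1) w = x

variable {D}

lemma IsCob.add {n : ℕ} {x y : D.L 0 (n + 1)} (hx : D.IsCob n x) (hy : D.IsCob n y) :
    D.IsCob n (x + y) := by
  cases n with
  | zero => exact (congrArg₂ (· + ·) hx hy).trans (add_zero 0)
  | succ n =>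
    obtain ⟨w, rfl⟩ := hx
    obtain ⟨v, rfl⟩ := hy
    exact ⟨w + v, map_add _ _ _⟩

lemma IsCob.zsmul {n : ℕ} {x : D.L 0 (n + 1)} (hx : D.IsCob n x) (c : ℤ) :
    D.IsCob n (c • x) := by
  cases n with
  | zero => exact (congrArg (c • ·) hx).trans (smul_zero c)
  | succ n =>
    obtain ⟨w, rfl⟩ := hx
    exact ⟨c • w, map_zsmul _ _ _⟩

variable (D)

/-- Every class of a biclosed element comes from the row `q = 0`, up to sign. -/
lemma exists_of_biclosed (q : ℕ) : ∀ (p n : ℕ) (h : p + q = n) (c : D.L (p + 1) (q + 1)),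
    D.d₁ _ _ c = 0 → D.d₂ _ _ c = 0 → ∃ f : D.L (n + 1) 0, D.d₁ _ _ f = 0 ∧
      D.IsCob n (D.Φ n 0 n rfl (D.d₂ _ _ f) - D.Φ p q n h c) := by
  induction q with
  | zero =>
    intro p n h c h₁ h₂
    obtain rfl : p = n := h
    obtain ⟨f, rfl⟩ := D.exact₂ p 0 c h₂
    refine ⟨f, D.inj₂ _ _ (by rw [← D.comm, h₁]), ?_⟩
    rw [sub_self]
    cases p with
    | zero => rfl
    | succ p => exact ⟨0, map_zero _⟩
  | succ q ih =>
    intro p n h c h₁ h₂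
    obtain ⟨n, rfl⟩ : ∃ n', n = n' + 1 := ⟨p + q, by omega⟩
    obtain ⟨k, rfl⟩ := D.exact₂ p (q + 1) c h₂
    have hk := D.Φ_d p q n (by omega) k
    obtain ⟨f, hf, w, hw⟩ := ih (p + 1) (n + 1) (by omega) (D.d₁ _ _ k) (D.d₁_d₁ _ _ _)
      (by rw [← D.comm, h₁])
    rw [eq_sub_iff_add_eq] at hw
    -- `c = d₂ k` is replaced by `d₁ k`: their images under `Φ` differ by a sign and a coboundary
    refine ⟨(-(-1 : ℤ) ^ p) • f, by rw [map_zsmul, hf, smul_zero],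
      (-(-1 : ℤ) ^ p) • (w + D.Φ p q n (by omega) k), ?_⟩
    rw [map_zsmul, map_zsmul, map_zsmul, map_add, hk, ← hw, smul_add, smul_add, smul_add,
      smul_smul, neg_mul, ← pow_add, Even.neg_one_pow ⟨p, rfl⟩, neg_one_smul]
    abel

/-- Every cocycle of the column `p = 0` is cohomologous to the image of a cocycle of the row
`q = 0`. -/
theorem exists_row_cocycle (n : ℕ) (x : D.L 0 (n + 1)) (hx : D.d₂ _ _ x = 0) :
    ∃ f : D.L (n + 1) 0, D.d₁ _ _ f = 0 ∧ D.IsCob n (D.Φ n 0 n rfl (D.d₂ _ _ f) - x) := by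
  obtain ⟨f, hf, h⟩ := D.exists_of_biclosed n 0 n (zero_add n) (D.d₁ _ _ x) (D.d₁_d₁ _ _ _)
    (by rw [← D.comm, hx, map_zero])
  exact ⟨f, hf, by rwa [D.Φ_d₁] at h⟩

/-- If `Φ` sends a biclosed element to a coboundary, then it is `d₂` of a `d₁`-cocycle or, except
in the first column, `d₁` of a `d₂`-cocycle. -/
lemma exists_of_isCob_zero (q n : ℕ) (h : 0 + q = n) (c : D.L 1 (q + 1)) (h₁ : D.d₁ _ _ c = 0)
    (h₂ : D.d₂ _ _ c = 0) (hc : D.IsCob n (D.Φ 0 q n h c)) :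
    match q, c with
    | 0, c => c = 0
    | q + 1, c => ∃ v : D.L 1 (q + 1), D.d₁ _ _ v = 0 ∧ D.d₂ _ _ v = c := by
  obtain rfl : q = n := by omega
  obtain ⟨x, rfl⟩ := D.exact₁ 0 q c h₁
  rw [D.Φ_d₁] at hc
  cases q with
  | zero => exact (congrArg _ hc).trans (map_zero _)
  | succ q =>
    obtain ⟨w, rfl⟩ := hc
    exact ⟨D.d₁ _ _ w, D.d₁_d₁ _ _ _, (D.comm _ _ _).symm⟩

lemma isCob_step {p q n : ℕ} (h : p + q = n) (u : D.L (p + 1) (q + 1))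
    (hc : D.IsCob (n + 1) (D.Φ (p + 1) q (n + 1) (by omega) (D.d₁ _ _ u))) :
    D.IsCob (n + 1) (D.Φ p (q + 1) (n + 1) (by omega) (D.d₂ _ _ u)) := by
  have e := D.Φ_d p q n h u
  have : D.Φ p (q + 1) (n + 1) (by omega) (D.d₂ _ _ u) =
      (-1 : ℤ) ^ p • (D.d₂ _ _ (D.Φ p q n h u) -
        D.Φ (p + 1) q (n + 1) (by omega) (D.d₁ _ _ u)) := by
    rw [e, add_sub_cancel_left, smul_smul, ← pow_add, Even.neg_one_pow ⟨p, rfl⟩, one_smul]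
  rw [this]
  refine IsCob.zsmul ?_ _
  have := IsCob.add (n := n + 1) ⟨D.Φ p q n h u, rfl⟩ (hc.zsmul (-1))
  rwa [neg_one_zsmul, ← sub_eq_add_neg] at this

lemma exists_of_isCob_succ (p : ℕ) : ∀ (q n : ℕ) (h : p + 1 + q = n) (c : D.L (p + 2) (q + 1)),
    D.d₁ _ _ c = 0 → D.d₂ _ _ c = 0 → D.IsCob n (D.Φ (p + 1) q n h c) →
      ∃ u : D.L (p + 1) (q + 1), D.d₁ _ _ u = c ∧ D.d₂ _ _ u = 0 := by
  induction p with
  | zero =>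
    intro q n h c h₁ h₂ hc
    obtain ⟨n, rfl⟩ : ∃ n', n = n' + 1 := ⟨q, by omega⟩
    obtain ⟨u, rfl⟩ := D.exact₁ 1 q c h₁
    obtain ⟨v, hv₁, hv₂⟩ := D.exists_of_isCob_zero (q + 1) (n + 1) (by omega) (D.d₂ _ _ u)
      (by rw [D.comm, h₂]) (D.d₂_d₂ _ _ _) (D.isCob_step (by omega) u hc)
    exact ⟨u - v, by rw [map_sub, hv₁, sub_zero], by rw [map_sub, hv₂, sub_self]⟩
  | succ p ih =>
    intro q n h c h₁ h₂ hc
    obtain ⟨n, rfl⟩ : ∃ n', n = n' + 1 := ⟨p + 1 + q, by omega⟩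
    obtain ⟨u, rfl⟩ := D.exact₁ (p + 2) q c h₁
    obtain ⟨u', hu₁, hu₂⟩ := ih (q + 1) (n + 1) (by omega) (D.d₂ _ _ u)
      (by rw [D.comm, h₂]) (D.d₂_d₂ _ _ _) (D.isCob_step (by omega) u hc)
    obtain ⟨t, rfl⟩ := D.exact₂ p (q + 1) u' hu₂
    exact ⟨u - D.d₁ _ _ t, by rw [map_sub, D.d₁_d₁, sub_zero],
      by rw [map_sub, ← hu₁, D.comm, sub_self]⟩

/-- A cocycle of the row `q = 0` whose image in the column `p = 0` is a coboundary is a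
coboundary. -/
theorem exists_of_isCob (n : ℕ) (f : D.L (n + 1) 0) (hf : D.d₁ _ _ f = 0)
    (h : D.IsCob n (D.Φ n 0 n rfl (D.d₂ _ _ f))) :
    match n, f with
    | 0, f => f = 0
    | n + 1, f => ∃ g : D.L (n + 1) 0, D.d₁ _ _ g = f := by
  have h₁ : D.d₁ _ _ (D.d₂ _ _ f) = 0 := by rw [D.comm, hf, map_zero]
  cases n with
  | zero => exact D.inj₂ _ _ (D.exists_of_isCob_zero 0 0 rfl _ h₁ (D.d₂_d₂ _ _ _) h)
  | succ n =>
    obtain ⟨u, hu₁, hu₂⟩ := D.exists_of_isCob_succ n 0 (n + 1) rfl _ h₁ (D.d₂_d₂ _ _ _) h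
    obtain ⟨g, rfl⟩ := D.exact₂ n 0 u hu₂
    refine ⟨g, ?_⟩
    rw [← sub_eq_zero]
    refine D.inj₂ _ _ ?_
    rw [map_sub, ← D.comm, hu₁, sub_self]

end DoubleResolution

namespace VectSheaf

variable {ι : Type} {U : ι → Opens X} {F : VectSheaf X}

/-- The terms of an augmented injective resolution, as sheaves. -/
abbrev augSheaf (I : InjectiveResolution F) : ℕ → VectSheaf X
  | 0 => F
  | n + 1 => I.cocomplex.X n

/-- The differentials of an augmented injective resolution. -/
abbrev augD (I : InjectiveResolution F) : ∀ n, augSheaf I n ⟶ augSheaf I (n + 1)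
  | 0 => aug I
  | n + 1 => I.cocomplex.d n (n + 1)

lemma augD_augD (I : InjectiveResolution F) : ∀ n, augD I n ≫ augD I (n + 1) = 0
  | 0 => I.ι_f_zero_comp_complex_d
  | n + 1 => I.cocomplex.d_comp_d n (n + 1) (n + 2)

instance injective_augSheaf (I : InjectiveResolution F) (n : ℕ) :
    Injective (augSheaf I (n + 1)) :=
  inferInstanceAs (Injective (I.cocomplex.X n))

lemma exists_augD_eq {V : Opens X} (h : ∀ i, 0 < i → Subsingleton (cohOn V F i))
    (I : InjectiveResolution F) : ∀ (q : ℕ) (x : (augSheaf I (q + 1)).sec V),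
      secMap (augD I (q + 1)) V x = 0 → ∃ w, secMap (augD I q) V w = x
  | 0, x, hx => exists_aug_eq I V x hx
  | q + 1, x, hx => exists_d_eq_of_subsingleton (h (q + 1) q.succ_pos) x hx

lemma cechMap_injective {G : VectSheaf X} (g : F ⟶ G) [Mono g] {p : ℕ} {W : Opens X}
    (f : CechCochain U F p W) (hf : cechMap g f = 0) : f = 0 :=
  funext fun σ => secMap_injective g _ ((congrFun hf σ).trans (map_zero _).symm)

lemma IsAcyclicCover.exists_cechMap_eq (hF : IsAcyclicCover U F) (I : InjectiveResolution F)
    {p q : ℕ} (f : CechCochain U (augSheaf I (q + 1)) p ⊤) (hf : cechMap (augD I (q + 1)) f = 0) :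
    ∃ g : CechCochain U (augSheaf I q) p ⊤, cechMap (augD I q) g = f := by
  have : ∀ σ, ∃ w, secMap (augD I q) (⊤ ⊓ ⨅ k, U (σ k)) w = f σ := fun σ =>
    exists_augD_eq (by rw [top_inf_eq]; exact hF p σ) I q (f σ) (congrFun hf σ)
  choose w hw using this
  exact ⟨w, funext hw⟩

variable (U) in
/-- The global sections of the Čech resolutions of the terms of `F → I^•`. -/
abbrev cechGrid (I : InjectiveResolution F) (p q : ℕ) : Type :=
  Psh.sec ((cechSeq U (augSheaf I q)).obj p) ⊤

variable (U) in
/-- The Čech differential. -/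
abbrev cechGridD₁ (I : InjectiveResolution F) (p q : ℕ) :
    cechGrid U I p q →+ cechGrid U I (p + 1) q :=
  (app ((cechSeq U (augSheaf I q)).d p) ⊤).toAddMonoidHom

variable (U) in
/-- The differential coming from `F → I^•`. -/
abbrev cechGridD₂ (I : InjectiveResolution F) (p q : ℕ) :
    cechGrid U I p q →+ cechGrid U I p (q + 1) :=
  (app (cechSeqMap (augD I q) p) ⊤).toAddMonoidHom

/-- For an acyclic cover, some morphism from the Čech resolution to an injective resolution
induces an isomorphism in cohomology. -/
theorem IsAcyclicCover.exists_cechMorphism (hF : IsAcyclicCover U F) (hU : (⨆ i, U i) = ⊤)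
    (I : InjectiveResolution F) : ∃ φ : CechMorphism U I,
      (∀ (n : ℕ) (x : sec (I.cocomplex.X n) ⊤), app ((seq I).d n) ⊤ x = 0 →
        ∃ f : CechCochain U F n ⊤, cechD f = 0 ∧ (seq I).IsCob (φ.map n ⊤ f - x)) ∧
      ∀ (n : ℕ) (f : CechCochain U F n ⊤), cechD f = 0 → (seq I).IsCob (φ.map n ⊤ f) →
        IsCechCoboundary f := by
  obtain ⟨Φ, hΦ₀, hΦ⟩ := PshSeq.exists_lift_bicomplex
    (fun q => cechSeq U (I.cocomplex.X q)) (fun q => locExact_cechSeq hU)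
    (fun p q => cechSeqMap (I.cocomplex.d q (q + 1)) p) (fun p q => cechSeqMap_comm _ p)
    (fun p q => cechSeqMap_comp_eq_zero _ _ (I.cocomplex.d_comp_d q (q + 1) (q + 2)) p)
    (isInjSep_seq I) (fun q => 𝟙 _) (fun q => (Category.id_comp _).trans (Category.comp_id _).symm)
  have hΦ₀' : ∀ q (x : sec (I.cocomplex.X q) ⊤), app (Φ 0 q q (zero_add q)) ⊤
      (app ((cechSeq U (I.cocomplex.X q)).d 0) ⊤ x) = x := fun q x =>
    congrArg (fun f : (I.cocomplex.X q).obj ⟶ (I.cocomplex.X q).obj => app f ⊤ x) (hΦ₀ q)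
  have hΦ' : ∀ p q n h (x : ((cechSeq U (I.cocomplex.X q)).obj (p + 1)).sec ⊤),
      app ((seq I).d n) ⊤ (app (Φ p q n h) ⊤ x) =
        app (Φ (p + 1) q (n + 1) (by omega)) ⊤
          (app ((cechSeq U (I.cocomplex.X q)).d (p + 1)) ⊤ x) +
        (-1 : ℤ) ^ p • app (Φ p (q + 1) (n + 1) (by omega)) ⊤
          (app (cechSeqMap (I.cocomplex.d q (q + 1)) (p + 1)) ⊤ x) := fun p q n h x =>
    congrArg (fun f : (cechSeq U (I.cocomplex.X q)).obj (p + 1) ⟶ (seq I).obj (n + 1) =>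
      app f ⊤ x) (hΦ p q n h)
  let Ψ : ∀ p q n, p + q = n → (cechGrid U I (p + 1) (q + 1) →+ cechGrid U I 0 (n + 1)) :=
    fun p q n h => (app (Φ p q n h) ⊤).toAddMonoidHom
  let D : DoubleResolution := {
    L := cechGrid U I
    d₁ := cechGridD₁ U I
    d₂ := cechGridD₂ U I
    comm := fun p q x => congrArg (fun f => app f ⊤ x) (cechSeqMap_comm (augD I q) p)
    d₁_d₁ := fun p q x => congrArg (fun f => app f ⊤ x) (cechSeq_d_d p)
    d₂_d₂ := fun p q x =>
      congrArg (fun f => app f ⊤ x) (cechSeqMap_comp_eq_zero _ _ (augD_augD I q) p)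
    inj₁ := fun q x hx => eq_zero_of_cechAug_eq_zero hU x hx
    exact₁ := fun p q x hx => exists_cechSeq_d_eq hU p x hx
    inj₂ := fun p x hx => cechMap_injective (aug I) x hx
    exact₂ := fun p q x hx => hF.exists_cechMap_eq I (p := p) x hx
    Φ := Ψ
    Φ_d := hΦ'
    Φ_d₁ := hΦ₀' }
  have hcob : ∀ (n : ℕ) (x : sec (I.cocomplex.X n) ⊤), D.IsCob n x ↔ (seq I).IsCob x
    | 0, x => (PshSeq.isCob_zero_iff (J := seq I) (x := x)).symm
    | n + 1, x => Iff.rfl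
  let φ : CechMorphism U I := CechMorphism.mk' (fun p => cechSeqMap (aug I) (p + 1) ≫ Φ p 0 p rfl)
    (by
      refine (Category.assoc _ _ _).symm.trans ?_
      refine (congrArg (· ≫ Φ 0 0 0 rfl) (cechSeqMap_comm (aug I) 0).symm).trans ?_
      refine (Category.assoc _ _ _).trans ?_
      exact (congrArg ((aug I).hom ≫ ·) (hΦ₀ 0)).trans (Category.comp_id _))
    (fun p => by
      refine hom_ext fun W f => ?_
      refine (congrArg (fun t => app t W (app (cechSeqMap (aug I) (p + 1)) W f))
        (hΦ p 0 p rfl)).trans ?_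
      rw [app_add, app_zsmul]
      have e1 := congrArg (fun t => app t W f) (cechSeqMap_comm (U := U) (aug I) (p + 1))
      have e2 := congrArg (fun t => app t W f)
        (cechSeqMap_comp_eq_zero (U := U) _ _ (augD_augD I 0) (p + 1))
      have e3 : app (cechSeqMap (I.cocomplex.d 0 (0 + 1)) (p + 1) ≫ Φ p (0 + 1) (p + 1) (by omega))
          W (app (cechSeqMap (aug I) (p + 1)) W f) = 0 :=
        (congrArg (app (Φ p (0 + 1) (p + 1) (by omega)) W) e2).trans (map_zero _)
      rw [e3, smul_zero, add_zero]
      exact congrArg (app (Φ (p + 1) 0 (p + 1) (by omega)) W) e1)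
  refine ⟨φ, fun n x hx => ?_, fun n f hf h => ?_⟩
  · obtain ⟨f, hf, h⟩ := D.exists_row_cocycle n x hx
    exact ⟨f, hf, (hcob n _).1 h⟩
  · have := D.exists_of_isCob n f hf ((hcob n _).2 h)
    cases n with
    | zero => exact this
    | succ n => exact this

theorem IsAcyclicCover.exists_isCechClass (hF : IsAcyclicCover U F) (hU : (⨆ i, U i) = ⊤) {p : ℕ}
    (α : F.coh p) : ∃ f : CechCochain U F p ⊤, IsCechClass f α := by
  obtain ⟨φ, hφ, -⟩ := hF.exists_cechMorphism hU (injectiveResolution F)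
  obtain ⟨x, hx⟩ := exists_represents (injectiveResolution F) α
  obtain ⟨f, hf, h⟩ := hφ p x hx.d_eq_zero
  exact ⟨f, hf, _, φ, hx.of_isCob_sub h⟩

theorem IsAcyclicCover.isCechCoboundary (hF : IsAcyclicCover U F) (hU : (⨆ i, U i) = ⊤) {p : ℕ}
    (f : CechCochain U F p ⊤) (hf : IsCechClass f 0) : IsCechCoboundary f := by
  obtain ⟨φ, -, hφ⟩ := hF.exists_cechMorphism hU (injectiveResolution F)
  obtain ⟨hd, I', φ', h⟩ := hf
  exact hφ p f hd (represents_zero_iff.1 (φ'.represents hU φ f hd h))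

end VectSheaf

/-! ### Products with global sections and triple products -/

namespace VectSheaf

variable {F : VectSheaf X} {I : InjectiveResolution F}

/-- A chain endomorphism of `I^•` which extends the endomorphism `g` of `F`, given on sections,
induces `cohMap g`. -/
lemma represents_of_comm (g : F ⟶ F) (θ : ∀ p, (seq I).obj p ⟶ (seq I).obj p)
    (hθ : ∀ p, θ p ≫ (seq I).d p = (seq I).d p ≫ θ (p + 1))
    (h₀ : ∀ U (a : F.sec U), app (θ 0) U (secMap (aug I) U a) = secMap (aug I) U (secMap g U a))
    {p : ℕ} {x : sec (I.cocomplex.X p) ⊤} {α : F.coh p} (hx : Represents I x α) :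
    Represents I (app (θ p) ⊤ x) (cohMap g p α) := by
  let ψ := InjectiveResolution.desc g I I
  have hψ : I.ι.f 0 ≫ ψ.f 0 = g ≫ I.ι.f 0 := InjectiveResolution.desc_commutes_zero g I I
  refine (hx.map ψ hψ).of_isCob_sub ?_
  let D : ∀ n, (seq I).obj n ⟶ (seq I).obj n := fun n => θ n - (ψ.f n).hom
  refine (locExact_augSeq I).exists_d_eq (isInjSep_seq I).hat 0 D ?_ (fun n => ?_) (p := p) x
    hx.d_eq_zero
  · refine Limits.zero_comp.trans (hom_ext fun U a => ?_)
    refine (sub_eq_zero.2 ((h₀ U a).trans ?_)).symm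
    exact (congrArg (fun f => secMap f U a) hψ).symm
  · change D n ≫ (seq I).d n = (seq I).d n ≫ D (n + 1)
    simp only [D, Preadditive.sub_comp, Preadditive.comp_sub]
    rw [hθ, desc_seq_comm]

/-- The product of a class with the class of a global section. -/
lemma cup_cohZero {m : Pairing F F F} (s : F.sec ⊤) (g : F ⟶ F)
    (hg : ∀ U a, secMap g U a = m.map U a (F.res le_top s)) {p : ℕ} (α : F.coh p) :
    cup m p 0 α (cohZero F s) = cohMap g p α := by
  let I := injectiveResolution F
  obtain ⟨x, hx⟩ := exists_represents I α
  obtain ⟨M⟩ := nonempty_pairingExtension m I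
  have hd : ∀ U, secMap (I.cocomplex.d 0 (0 + 1)) U (secMap (aug I) U (F.res le_top s)) = 0 :=
    fun U => congrArg (fun f => app f U (F.res le_top s)) (aug_d I)
  refine (hx.cup (represents_aug (I := I) s) M).unique ?_
  let θ : ∀ p, (seq I).obj p ⟶ (seq I).obj p := fun p => homMk
    (fun U => ((M.mul p 0 p rfl).map U).flip (secMap (aug I) U (F.res le_top s)))
    (fun {U W} h a => by
      refine Eq.trans ?_ ((M.mul p 0 p rfl).res_map h _ _).symm
      rw [← secMap_res, sheaf_res_res]
      rfl)
  have := represents_of_comm g θ (fun p => hom_ext fun U a => ?_)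
    (fun U a => (M.mul_aug U a _).trans (congrArg _ (hg U a).symm)) hx
  · have e : F.res le_top s = s := sheaf_res_self _ s
    change Represents I ((M.mul p 0 p rfl).map ⊤ x (secMap (aug I) ⊤ (F.res le_top s))) _ at this
    rwa [e] at this
  · have := M.leibniz p 0 p rfl U a (secMap (aug I) U (F.res le_top s))
    rw [hd, map_zero, smul_zero] at this
    exact this.trans (add_zero _)

/-- The product of the class of a global section with a class. -/
lemma lof_cohZero_cup {m : Pairing F F F} (s : F.sec ⊤) (g : F ⟶ F)
    (hg : ∀ U a, secMap g U a = m.map U (F.res le_top s) a) {q : ℕ} (β : F.coh q) :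
    DirectSum.lof ℂ ℕ (fun n => F.coh n) _ (cup m 0 q (cohZero F s) β) =
      DirectSum.lof ℂ ℕ (fun n => F.coh n) q (cohMap g q β) := by
  let I := injectiveResolution F
  obtain ⟨y, hy⟩ := exists_represents I β
  obtain ⟨M⟩ := nonempty_pairingExtension m I
  have hd : ∀ U, secMap (I.cocomplex.d 0 (0 + 1)) U (secMap (aug I) U (F.res le_top s)) = 0 :=
    fun U => congrArg (fun f => app f U (F.res le_top s)) (aug_d I)
  refine ((represents_aug (I := I) s).lof_cup M (zero_add q) hy ?_).symm
  let θ : ∀ q, (seq I).obj q ⟶ (seq I).obj q := fun q => homMk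
    (fun U => (M.mul 0 q q (zero_add q)).map U (secMap (aug I) U (F.res le_top s)))
    (fun {U W} h a => by
      refine Eq.trans ?_ ((M.mul 0 q q (zero_add q)).res_map h _ _).symm
      rw [← secMap_res, sheaf_res_res]
      rfl)
  have := represents_of_comm g θ (fun q => hom_ext fun U a => ?_)
    (fun U a => (M.mul_aug U _ a).trans (congrArg _ (hg U a).symm)) hy
  · have e : F.res le_top s = s := sheaf_res_self _ s
    change Represents I ((M.mul 0 q q _).map ⊤ (secMap (aug I) ⊤ (F.res le_top s)) y) _ at this
    rwa [e] at this
  · have := M.leibniz 0 q q (zero_add q) U (secMap (aug I) U (F.res le_top s)) a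
    rw [hd, map_zero, LinearMap.zero_apply, zero_add, pow_zero, one_smul] at this
    exact this

lemma cohMap_cohZero {G : VectSheaf X} (f : F ⟶ G) (s : F.sec ⊤) :
    cohMap f 0 (cohZero F s) = cohZero G (secMap f ⊤ s) :=
  (congrArg (fun φ => φ.hom s) ((secFunctor X ⊤).toRightDerivedZero.naturality f)).symm

/-- `cohMap` as an additive function of the morphism. -/
def cohMapHom {P : VectSheaf X} (n : ℕ) (u : P.coh n) : (P ⟶ F) →+ F.coh n :=
  AddMonoidHom.mk' (fun f => cohMap f n u) fun f g => cohMap_add f g n u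

/-- `secMap` as an additive function of the morphism. -/
def secMapHom {P : VectSheaf X} {U : Opens X} (s : P.sec U) : (P ⟶ F) →+ F.sec U :=
  AddMonoidHom.mk' (fun f => secMap f U s) fun _ _ => rfl

/-- Morphisms from `F ⊗ F ⊗ F` almost all of which kill any given `a ⊗ b ⊗ c` are almost all
zero on any given cohomology class. -/
theorem exists_cohMap_tripleTensor_eq_zero [NoetherianSpace X] (f : ℕ → (tripleTensor F ⟶ F))
    (hf : ∀ (U : Opens X) (a b c : F.sec U), ∃ N₀, ∀ N ≥ N₀, secMap (f N) U (tmul₃ a b c) = 0)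
    {n : ℕ} (u : (tripleTensor F).coh n) : ∃ N₀, ∀ N ≥ N₀, cohMap (f N) n u = 0 := by
  refine exists_cohMap_eq_zero f (fun U s p hp => ?_) u
  have hsurj : TopCat.Presheaf.IsLocallySurjective (toTripleTensor F) := by
    unfold toTripleTensor TopCat.Presheaf.IsLocallySurjective
    exact inferInstanceAs (Presheaf.IsLocallySurjective (Opens.grothendieckTopology X)
      (toSheafify (Opens.grothendieckTopology X) (tens (tens F.obj F.obj) F.obj)))
  obtain ⟨W, hW, ⟨t, ht⟩, hpW⟩ := (TopCat.Presheaf.isLocallySurjective_iff _).1 hsurj U s p hp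
  refine ⟨W, hW, hpW, ?_⟩
  have key : ∀ t : (tens (tens F.obj F.obj) F.obj).sec W, ∃ N₀, ∀ N ≥ N₀,
      secMap (f N) W (app (toTripleTensor F) W t) = 0 := by
    have zero : ∃ N₀, ∀ N ≥ N₀, secMap (f N) W (app (toTripleTensor F) W 0) = 0 :=
      ⟨0, fun N _ => by rw [map_zero, map_zero]⟩
    have add : ∀ s t, (∃ N₀, ∀ N ≥ N₀, secMap (f N) W (app (toTripleTensor F) W s) = 0) →
        (∃ N₀, ∀ N ≥ N₀, secMap (f N) W (app (toTripleTensor F) W t) = 0) →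
        ∃ N₀, ∀ N ≥ N₀, secMap (f N) W (app (toTripleTensor F) W (s + t)) = 0 := by
      rintro s t ⟨N₁, h₁⟩ ⟨N₂, h₂⟩
      refine ⟨max N₁ N₂, fun N hN => ?_⟩
      rw [map_add, map_add, h₁ N (le_of_max_le_left hN), h₂ N (le_of_max_le_right hN), add_zero]
    intro t
    induction t using tens_induction with
    | zero => exact zero
    | tmul s c =>
      induction s using tens_induction with
      | zero => rw [zero_tmul]; exact zero
      | tmul a b => exact hf W a b c
      | add s t hs ht => rw [add_tmul]; exact add _ _ hs ht
    | add s t hs ht => exact add _ _ hs ht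
  obtain ⟨N₀, hN₀⟩ := key t
  refine ⟨N₀, fun N hN => ?_⟩
  refine Eq.trans ?_ (hN₀ N hN)
  exact congrArg (secMap (f N) W) ht.symm

/-- A pairing composed with endomorphisms in both variables. -/
def Pairing.precomp (m : Pairing F F F) (f g : F ⟶ F) : Pairing F F F where
  map U := (m.map U).compl₁₂ (secMap f U) (secMap g U)
  res_map h a b := by
    simp only [LinearMap.compl₁₂_apply, secMap_res, m.res_map]

lemma cup_precomp (m : Pairing F F F) (f g : F ⟶ F) {p q : ℕ} (α : F.coh p) (β : F.coh q) :
    cup (m.precomp f g) p q α β = cup m p q (cohMap f p α) (cohMap g q β) := by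
  have := cohMap_cup (m := m.precomp f g) (m' := m) (f := f) (g := g) (k := 𝟙 F)
    (fun U a b => rfl) α β
  rwa [cohMap_id] at this

/-- The morphism `a ⊗ b ⊗ c ↦ m(m'(a, b), c)`. -/
def tripleLeft (m m' : Pairing F F F) : tripleTensor F ⟶ F :=
  tripleLift (fun U => (m'.map U).compr₂ (m.map U)) fun h a b c => by
    simp only [LinearMap.compr₂_apply, m.res_map, m'.res_map]

lemma tripleLeft_tmul₃ (m m' : Pairing F F F) (U : Opens X) (a b c : F.sec U) :
    secMap (tripleLeft m m') U (tmul₃ a b c) = m.map U (m'.map U a b) c := by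
  refine tripleLift_tmul₃ _ (fun h a b c => ?_) U a b c
  simp only [LinearMap.compr₂_apply, m.res_map, m'.res_map]

/-- The morphism `a ⊗ b ⊗ c ↦ m(a, m'(b, c))`. -/
def tripleRight (m m' : Pairing F F F) : tripleTensor F ⟶ F :=
  tripleLift (fun U => LinearMap.mk₂ ℂ (fun a b => m.map U a ∘ₗ m'.map U b)
    (fun a a' b => by ext; simp) (fun t a b => by ext; simp) (fun a b b' => by ext; simp)
    (fun t a b => by ext; simp)) fun h a b c => by
    simp only [LinearMap.mk₂_apply, LinearMap.comp_apply, m.res_map, m'.res_map]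

lemma tripleRight_tmul₃ (m m' : Pairing F F F) (U : Opens X) (a b c : F.sec U) :
    secMap (tripleRight m m') U (tmul₃ a b c) = m.map U a (m'.map U b c) := by
  refine tripleLift_tmul₃ _ (fun h a b c => ?_) U a b c
  simp only [LinearMap.mk₂_apply, LinearMap.comp_apply, m.res_map, m'.res_map]

/-- The morphism `a ⊗ b ⊗ c ↦ m(b, m'(a, c))`. -/
def tripleSwap (m m' : Pairing F F F) : tripleTensor F ⟶ F :=
  tripleLift (fun U => LinearMap.mk₂ ℂ (fun a b => m.map U b ∘ₗ m'.map U a)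
    (fun a a' b => by ext; simp) (fun t a b => by ext; simp) (fun a b b' => by ext; simp)
    (fun t a b => by ext; simp)) fun h a b c => by
    simp only [LinearMap.mk₂_apply, LinearMap.comp_apply, m.res_map, m'.res_map]

lemma tripleSwap_tmul₃ (m m' : Pairing F F F) (U : Opens X) (a b c : F.sec U) :
    secMap (tripleSwap m m') U (tmul₃ a b c) = m.map U b (m'.map U a c) := by
  refine tripleLift_tmul₃ _ (fun h a b c => ?_) U a b c
  simp only [LinearMap.mk₂_apply, LinearMap.comp_apply, m.res_map, m'.res_map]

end VectSheaf

/-! ### The Borcherds identity with truncated sums -/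

lemma finsum_eq_sum_range {M : Type*} [AddCommMonoid M] {f : ℕ → M} {N : ℕ}
    (h : ∀ l ≥ N, f l = 0) : ∑ᶠ l, f l = ∑ l ∈ Finset.range N, f l :=
  finsum_eq_sum_of_support_subset _ fun l hl => by
    simp only [Finset.coe_range, Set.mem_Iio]
    by_contra hN
    exact hl (h l (not_lt.1 hN))

/-- The difference of the `l`-th terms of the two sides of the Borcherds identity, for products
`mul` and with `s` in place of the sign `(-1)^n (-1)^{ij}`. -/
def borcherdsTerm {V : Type*} [AddCommGroup V] [Module ℂ V] (mul : ℤ → V →ₗ[ℂ] V →ₗ[ℂ] V)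
    (m n k s : ℤ) (l : ℕ) (a b c : V) : V :=
  Ring.choose m l • mul (m + k - l) (mul (n + l) a b) c -
    ((-1 : ℤ) ^ l * Ring.choose n l) •
      (mul (m + n - l) a (mul (k + l) b c) - s • mul (n + k - l) b (mul (m + l) a c))

lemma exists_sum_range_add_eq_zero {V : Type*} [AddCommGroup V] {f f₁ f₂ : ℕ → V}
    (h : ∀ l, f l = f₁ l + f₂ l)
    (h₁ : ∃ N₀, ∀ N ≥ N₀, ∑ l ∈ Finset.range N, f₁ l = 0)
    (h₂ : ∃ N₀, ∀ N ≥ N₀, ∑ l ∈ Finset.range N, f₂ l = 0) :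
    ∃ N₀, ∀ N ≥ N₀, ∑ l ∈ Finset.range N, f l = 0 := by
  obtain ⟨N₁, h₁⟩ := h₁
  obtain ⟨N₂, h₂⟩ := h₂
  refine ⟨max N₁ N₂, fun N hN => ?_⟩
  simp only [h, Finset.sum_add_distrib]
  rw [h₁ N (le_of_max_le_left hN), h₂ N (le_of_max_le_right hN), add_zero]

section Borcherds

variable {V : Type*} [AddCommGroup V] [Module ℂ V] {mul : ℤ → V →ₗ[ℂ] V →ₗ[ℂ] V}

/-- Given the nilpotency condition, the Borcherds identity says that its truncations hold from
some point on. In this form the identity is visibly linear in each variable. -/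
lemma borcherds_iff (nilpotent : ∀ a b : V, ∃ N : ℤ, ∀ n : ℤ, N ≤ n → mul n a b = 0)
    (m n k s : ℤ) (a b c : V) :
    (∑ᶠ l : ℕ, Ring.choose m l • mul (m + k - l) (mul (n + l) a b) c =
      ∑ᶠ l : ℕ, ((-1 : ℤ) ^ l * Ring.choose n l) •
        (mul (m + n - l) a (mul (k + l) b c) - s • mul (n + k - l) b (mul (m + l) a c))) ↔
    ∃ N₀ : ℕ, ∀ N ≥ N₀, ∑ l ∈ Finset.range N, borcherdsTerm mul m n k s l a b c = 0 := by
  obtain ⟨N₁, h₁⟩ := nilpotent a b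
  obtain ⟨N₂, h₂⟩ := nilpotent b c
  obtain ⟨N₃, h₃⟩ := nilpotent a c
  let M : ℕ := (N₁ - n).toNat + (N₂ - k).toNat + (N₃ - m).toNat
  have key : ∀ N ≥ M,
      (∑ᶠ l : ℕ, Ring.choose m l • mul (m + k - l) (mul (n + l) a b) c) -
        (∑ᶠ l : ℕ, ((-1 : ℤ) ^ l * Ring.choose n l) •
          (mul (m + n - l) a (mul (k + l) b c) - s • mul (n + k - l) b (mul (m + l) a c))) =
      ∑ l ∈ Finset.range N, borcherdsTerm mul m n k s l a b c := by
    intro N hN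
    rw [finsum_eq_sum_range (N := N), finsum_eq_sum_range (N := N), ← Finset.sum_sub_distrib]
    · rfl
    · intro l hl
      rw [h₂ _ (by omega), h₃ _ (by omega), map_zero, map_zero, smul_zero, sub_zero, smul_zero]
    · intro l hl
      rw [h₁ _ (by omega), map_zero, LinearMap.zero_apply, smul_zero]
  rw [← sub_eq_zero]
  refine ⟨fun h => ⟨M, fun N hN => (key N hN).symm.trans h⟩, fun ⟨N₀, h⟩ => ?_⟩
  rw [key (max M N₀) (le_max_left _ _)]
  exact h _ (le_max_right _ _)

/-- The truncated Borcherds identity holds from some point on. -/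
def BorcherdsEventually (mul : ℤ → V →ₗ[ℂ] V →ₗ[ℂ] V) (m n k s : ℤ) (a b c : V) : Prop :=
  ∃ N₀ : ℕ, ∀ N ≥ N₀, ∑ l ∈ Finset.range N, borcherdsTerm mul m n k s l a b c = 0

variable {m n k s : ℤ}

lemma BorcherdsEventually.add_left {a a' b c : V} (h : BorcherdsEventually mul m n k s a b c)
    (h' : BorcherdsEventually mul m n k s a' b c) :
    BorcherdsEventually mul m n k s (a + a') b c :=
  exists_sum_range_add_eq_zero (fun l => by
    simp only [borcherdsTerm, map_add, LinearMap.add_apply, smul_add, smul_sub]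
    abel) h h'

lemma BorcherdsEventually.add_middle {a b b' c : V} (h : BorcherdsEventually mul m n k s a b c)
    (h' : BorcherdsEventually mul m n k s a b' c) :
    BorcherdsEventually mul m n k s a (b + b') c :=
  exists_sum_range_add_eq_zero (fun l => by
    simp only [borcherdsTerm, map_add, LinearMap.add_apply, smul_add, smul_sub]
    abel) h h'

lemma BorcherdsEventually.add_right {a b c c' : V} (h : BorcherdsEventually mul m n k s a b c)
    (h' : BorcherdsEventually mul m n k s a b c') :
    BorcherdsEventually mul m n k s a b (c + c') :=
  exists_sum_range_add_eq_zero (fun l => by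
    simp only [borcherdsTerm, map_add, smul_add, smul_sub]
    abel) h h'

lemma BorcherdsEventually.zero_left (b c : V) : BorcherdsEventually mul m n k s 0 b c :=
  ⟨0, fun N _ => Finset.sum_eq_zero fun l _ => by simp [borcherdsTerm]⟩

lemma BorcherdsEventually.zero_middle (a c : V) : BorcherdsEventually mul m n k s a 0 c :=
  ⟨0, fun N _ => Finset.sum_eq_zero fun l _ => by simp [borcherdsTerm]⟩

lemma BorcherdsEventually.zero_right (a b : V) : BorcherdsEventually mul m n k s a b 0 :=
  ⟨0, fun N _ => Finset.sum_eq_zero fun l _ => by simp [borcherdsTerm]⟩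

end Borcherds

/-! ### Gradings from projections -/

/-- The ranges of complementary orthogonal projections form a direct sum decomposition. -/
lemma isInternal_range {V : Type*} [AddCommGroup V] [Module ℂ V] (P : ZMod 2 → V →ₗ[ℂ] V)
    (hP : ∀ i j v, P i (P j v) = if i = j then P i v else 0) (hsum : ∀ v, ∑ i, P i v = v) :
    DirectSum.IsInternal fun i => LinearMap.range (P i) := by
  have key : ∀ (x : ⨁ j, LinearMap.range (P j)) (i : ZMod 2),
      P i (DirectSum.coeAddMonoidHom (fun i => LinearMap.range (P i)) x) = x i := by
    intro x i
    induction x using DirectSum.induction_on with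
    | zero => simp
    | of j y =>
      obtain ⟨-, v, rfl⟩ := y
      rw [DirectSum.coeAddMonoidHom_of, DirectSum.coe_of_apply]
      simp only [hP]
      by_cases h : i = j
      · subst h; simp
      · simp [h, Ne.symm h]
    | add x y hx hy => simp only [map_add, hx, hy, DirectSum.add_apply, Submodule.coe_add]
  constructor
  · intro x y hxy
    refine DFinsupp.ext fun i => Subtype.ext ?_
    rw [← key, ← key, hxy]
  · intro v
    refine ⟨∑ i, DirectSum.of (fun i => LinearMap.range (P i)) i ⟨P i v, v, rfl⟩, ?_⟩
    rw [map_sum]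
    simp only [DirectSum.coeAddMonoidHom_of]
    exact hsum v

namespace VertexAlgebra

variable {V : Type*} [AddCommGroup V] [Module ℂ V] (A : VertexAlgebra V)

lemma proj_mem (i : ZMod 2) (a : V) : A.proj i a ∈ A.grading i := by
  obtain ⟨x, rfl⟩ := A.isInternal.2 a
  exact (A.proj_coe i x).symm ▸ (x i).2

lemma proj_proj (i j : ZMod 2) (a : V) :
    A.proj i (A.proj j a) = if i = j then A.proj i a else 0 := by
  rw [A.proj_of_mem i j (A.proj_mem j a)]
  split_ifs with h
  · rw [h]
  · rfl

lemma sum_proj (a : V) : ∑ i, A.proj i a = a := by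
  obtain ⟨x, rfl⟩ := A.isInternal.2 a
  induction x using DirectSum.induction_on with
  | zero => simp
  | of j b =>
    have e : (DirectSum.coeAddMonoidHom A.grading) (DirectSum.of (fun j => A.grading j) j b)
        = (b : V) := DirectSum.coeAddMonoidHom_of _ _ _
    rw [e]
    simp [A.proj_of_mem _ j b.2]
  | add x y hx hy => simp only [map_add, Finset.sum_add_distrib, hx, hy]

lemma proj_mul_proj (n : ℤ) (i j : ZMod 2) (a b : V) :
    A.proj (i + j) (A.mul n (A.proj i a) (A.proj j b)) = A.mul n (A.proj i a) (A.proj j b) := by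
  rw [A.proj_of_mem (i + j) (i + j) (A.mul_mem n i j _ _ (A.proj_mem i a) (A.proj_mem j b)),
    if_pos rfl]

end VertexAlgebra

namespace VertexAlgebraSheaf

open VectSheaf

variable (𝒱 : VertexAlgebraSheaf X)

/-! ### Parity in cohomology -/

lemma parityProj_comp (i j : ZMod 2) :
    𝒱.parityProj j ≫ 𝒱.parityProj i = if i = j then 𝒱.parityProj i else 0 := by
  have : ∀ U a, secMap (𝒱.parityProj j ≫ 𝒱.parityProj i) U a =
      secMap (if i = j then 𝒱.parityProj i else 0) U a := fun U a => by
    refine ((𝒱.alg U).proj_proj i j a).trans ?_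
    split_ifs <;> rfl
  exact Sheaf.hom_ext (Psh.hom_ext this)

lemma sum_parityProj : ∑ i, 𝒱.parityProj i = 𝟙 𝒱.sheaf := by
  have : ∀ U a, secMap (∑ i, 𝒱.parityProj i) U a = a := fun U a => by
    change secMapHom a (∑ i, 𝒱.parityProj i) = a
    rw [map_sum]
    exact (𝒱.alg U).sum_proj a
  exact Sheaf.hom_ext (Psh.hom_ext this)

lemma cohMap_parityProj_parityProj (i j : ZMod 2) {p : ℕ} (α : 𝒱.sheaf.coh p) :
    cohMap (𝒱.parityProj i) p (cohMap (𝒱.parityProj j) p α) =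
      if i = j then cohMap (𝒱.parityProj i) p α else 0 := by
  rw [← cohMap_comp, parityProj_comp]
  split_ifs
  · rfl
  · exact cohMap_zero _ _

lemma sum_cohMap_parityProj {p : ℕ} (α : 𝒱.sheaf.coh p) :
    ∑ i, cohMap (𝒱.parityProj i) p α = α := by
  refine (map_sum (cohMapHom p α) _ _).symm.trans ?_
  rw [sum_parityProj]
  exact cohMap_id p α

lemma cohMap_parityProj_of_mem (i : ZMod 2) {j : ZMod 2} {p : ℕ} {α : 𝒱.sheaf.coh p}
    (hα : α ∈ 𝒱.cohParity p j) :
    cohMap (𝒱.parityProj i) p α = if i = j then α else 0 := by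
  obtain ⟨α, rfl⟩ := hα
  rw [cohMap_parityProj_parityProj]
  split_ifs with h
  · rw [h]
  · rfl

lemma cohMap_parityProj_mem (i : ZMod 2) {p : ℕ} (α : 𝒱.sheaf.coh p) :
    cohMap (𝒱.parityProj i) p α ∈ 𝒱.cohParity p i := ⟨α, rfl⟩

/-- The products of cohomology classes of given parities have the expected parity. -/
lemma cup_mem_cohParity (n : ℤ) {p q : ℕ} {i j : ZMod 2} {α : 𝒱.sheaf.coh p} {β : 𝒱.sheaf.coh q}
    (hα : α ∈ 𝒱.cohParity p i) (hβ : β ∈ 𝒱.cohParity q j) :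
    cup (𝒱.product n) p q α β ∈ 𝒱.cohParity (p + q) (i + j) := by
  obtain ⟨α, rfl⟩ := hα
  obtain ⟨β, rfl⟩ := hβ
  have h := cohMap_cup (m := (𝒱.product n).precomp (𝒱.parityProj i) (𝒱.parityProj j))
    (m' := 𝒱.product n) (f := 𝒱.parityProj i) (g := 𝒱.parityProj j) (k := 𝒱.parityProj (i + j))
    (fun U a b => (𝒱.alg U).proj_mul_proj n i j a b) α β
  rw [← h]
  exact ⟨_, rfl⟩

/-- The projection of the total cohomology onto its part of parity `j`. -/
def totalProj (j : ZMod 2) : 𝒱.sheaf.totalCoh →ₗ[ℂ] 𝒱.sheaf.totalCoh :=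
  DirectSum.lmap fun p => cohMap (𝒱.parityProj (j - p)) p

lemma totalProj_lof (j : ZMod 2) (p : ℕ) (α : 𝒱.sheaf.coh p) :
    𝒱.totalProj j (DirectSum.lof ℂ ℕ (fun p => 𝒱.sheaf.coh p) p α) =
      DirectSum.lof ℂ ℕ (fun p => 𝒱.sheaf.coh p) p (cohMap (𝒱.parityProj (j - p)) p α) :=
  DirectSum.lmap_lof _ _ _

lemma range_totalProj (j : ZMod 2) : LinearMap.range (𝒱.totalProj j) = 𝒱.totalParity j := by
  apply le_antisymm
  · rintro - ⟨x, rfl⟩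
    induction x using DirectSum.induction_on with
    | zero => rw [map_zero]; exact zero_mem _
    | of p α =>
      refine Submodule.mem_iSup_of_mem p ?_
      exact ⟨_, ⟨α, rfl⟩, (𝒱.totalProj_lof j p α).symm⟩
    | add x y hx hy => rw [map_add]; exact add_mem hx hy
  · refine iSup_le fun p => ?_
    rintro - ⟨-, ⟨α, rfl⟩, rfl⟩
    exact ⟨_, 𝒱.totalProj_lof j p α⟩

lemma isInternal_totalParity : DirectSum.IsInternal 𝒱.totalParity := by
  have h := isInternal_range 𝒱.totalProj (fun i j v => ?_) (fun v => ?_)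
  · have e : 𝒱.totalParity = fun j => LinearMap.range (𝒱.totalProj j) :=
      funext fun j => (𝒱.range_totalProj j).symm
    rw [e]
    exact h
  · induction v using DirectSum.induction_on with
    | zero => simp
    | of p α =>
      have h1 := 𝒱.totalProj_lof j p α
      have h2 := 𝒱.totalProj_lof i p α
      have h3 := 𝒱.totalProj_lof i p (cohMap (𝒱.parityProj (j - p)) p α)
      rw [← h1, cohMap_parityProj_parityProj] at h3
      refine h3.trans ?_
      simp only [sub_left_inj]
      split_ifs
      · exact h2.symm
      · exact map_zero _
    | add x y hx hy =>
      simp only [map_add, hx, hy]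
      split_ifs <;> simp
  · induction v using DirectSum.induction_on with
    | zero => simp
    | of p α =>
      have h : ∀ i, 𝒱.totalProj i (DirectSum.of (fun p => 𝒱.sheaf.coh p) p α) = _ :=
        fun i => 𝒱.totalProj_lof i p α
      simp only [h]
      rw [← map_sum]
      refine congrArg _ (Eq.trans ?_ (𝒱.sum_cohMap_parityProj α))
      exact Equiv.sum_comp (Equiv.subRight (p : ZMod 2))
        (fun i => cohMap (𝒱.parityProj i) p α)
    | add x y hx hy => simp only [map_add, Finset.sum_add_distrib, hx, hy]

/-! ### The products on the total cohomology -/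

/-- The inclusion of `H^p` into the total cohomology. -/
abbrev incl (p : ℕ) : 𝒱.sheaf.coh p →ₗ[ℂ] 𝒱.sheaf.totalCoh :=
  DirectSum.lof ℂ ℕ (fun p => 𝒱.sheaf.coh p) p

/-- The `n`-th product of the total cohomology, with its sign, on `H^p × H^q`. -/
def totalMulAux (n : ℤ) (p q : ℕ) :
    𝒱.sheaf.coh p →ₗ[ℂ] 𝒱.sheaf.coh q →ₗ[ℂ] 𝒱.sheaf.totalCoh :=
  ∑ i : ZMod 2, koszulSign i q •
    ((cup (𝒱.product n) p q).compr₂ (𝒱.incl (p + q)) ∘ₗ cohMap (𝒱.parityProj i) p)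

/-- The `n`-th product of the total cohomology. -/
def totalMul (n : ℤ) : 𝒱.sheaf.totalCoh →ₗ[ℂ] 𝒱.sheaf.totalCoh →ₗ[ℂ] 𝒱.sheaf.totalCoh :=
  DirectSum.toModule ℂ ℕ _ fun p => LinearMap.flip
    (DirectSum.toModule ℂ ℕ _ fun q => (𝒱.totalMulAux n p q).flip)

lemma totalMul_incl_incl (n : ℤ) {p q : ℕ} (α : 𝒱.sheaf.coh p) (β : 𝒱.sheaf.coh q) :
    𝒱.totalMul n (𝒱.incl p α) (𝒱.incl q β) = ∑ i : ZMod 2, koszulSign i q •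
      𝒱.incl (p + q) (cup (𝒱.product n) p q (cohMap (𝒱.parityProj i) p α) β) := by
  simp only [totalMul, DirectSum.toModule_lof, LinearMap.flip_apply, totalMulAux]
  simp [LinearMap.sum_apply]

lemma totalMul_of_mem (n : ℤ) {p q : ℕ} {i : ZMod 2} {α : 𝒱.sheaf.coh p}
    (hα : α ∈ 𝒱.cohParity p i) (β : 𝒱.sheaf.coh q) :
    𝒱.totalMul n (𝒱.incl p α) (𝒱.incl q β) =
      koszulSign i q • 𝒱.incl (p + q) (cup (𝒱.product n) p q α β) := by
  rw [totalMul_incl_incl, Finset.sum_eq_single i]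
  · rw [𝒱.cohMap_parityProj_of_mem i hα, if_pos rfl]
  · intro j _ hj
    rw [𝒱.cohMap_parityProj_of_mem j hα, if_neg hj, map_zero, LinearMap.zero_apply, map_zero,
      smul_zero]
  · intro h
    exact absurd (Finset.mem_univ i) h

end VertexAlgebraSheaf

lemma koszulSign_natCast (p q : ℕ) : koszulSign (p : ZMod 2) (q : ZMod 2) = (-1) ^ (p * q) := by
  have key : ((p : ZMod 2) = 1 ∧ (q : ZMod 2) = 1) ↔ Odd (p * q) := by
    rw [ZMod.natCast_eq_one_iff_odd, ZMod.natCast_eq_one_iff_odd, Nat.odd_mul]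
  unfold koszulSign
  split_ifs with h
  · exact (Odd.neg_one_pow (key.1 h)).symm
  · exact (Even.neg_one_pow (Nat.not_odd_iff_even.1 fun h' => h (key.2 h'))).symm

lemma koszulSign_right_identity (i j q r : ZMod 2) :
    koszulSign j r * koszulSign i (q + r) = koszulSign i q * koszulSign (i + j) r := by
  revert i j q r
  decide

lemma koszulSign_swap_identity (i j p q r : ZMod 2) :
    koszulSign (i + p) (j + q) * (koszulSign i r * koszulSign j (p + r)) =
      koszulSign i j * (koszulSign i q * koszulSign (i + j) r) * koszulSign p q := by
  revert i j p q r
  decide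

namespace VertexAlgebraSheaf

open VectSheaf

variable (𝒱 : VertexAlgebraSheaf X)

/-! ### The vertex algebra structure on cohomology -/

/-- The vacuum vector of the cohomology. -/
def vacClass : 𝒱.sheaf.coh 0 := 𝒱.sheaf.cohZero (𝒱.alg ⊤).vac

lemma vacClass_mem : 𝒱.vacClass ∈ 𝒱.cohParity 0 0 := by
  refine ⟨𝒱.vacClass, (cohMap_cohZero _ _).trans ?_⟩
  have := (𝒱.alg ⊤).proj_of_mem 0 0 (𝒱.alg ⊤).vac_mem
  exact congrArg _ this

lemma cup_neg_one_vacClass {p : ℕ} (α : 𝒱.sheaf.coh p) :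
    cup (𝒱.product (-1)) p 0 α 𝒱.vacClass = α := by
  refine (cup_cohZero _ (𝟙 _) (fun U a => ?_) α).trans (cohMap_id p α)
  rw [𝒱.res_vac]
  exact ((𝒱.alg U).mul_vac a).symm

lemma cup_vacClass_of_nonneg {n : ℤ} (hn : 0 ≤ n) {p : ℕ} (α : 𝒱.sheaf.coh p) :
    cup (𝒱.product n) p 0 α 𝒱.vacClass = 0 := by
  refine (cup_cohZero _ 0 (fun U a => ?_) α).trans (cohMap_zero p α)
  rw [𝒱.res_vac]
  exact ((𝒱.alg U).mul_vac_of_nonneg n a hn).symm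

lemma incl_vacClass_cup (n : ℤ) {q : ℕ} (β : 𝒱.sheaf.coh q) :
    𝒱.incl _ (cup (𝒱.product n) 0 q 𝒱.vacClass β) = if n = -1 then 𝒱.incl q β else 0 := by
  split_ifs with h
  · refine (lof_cohZero_cup _ (𝟙 _) (fun U a => ?_) β).trans (congrArg _ (cohMap_id q β))
    rw [𝒱.res_vac]
    refine Eq.trans ?_ ((𝒱.alg U).vac_mul n a).symm
    rw [if_pos h]
    rfl
  · refine (lof_cohZero_cup _ 0 (fun U a => ?_) β).trans
      ((congrArg _ (cohMap_zero q β)).trans (map_zero _))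
    rw [𝒱.res_vac]
    refine Eq.trans ?_ ((𝒱.alg U).vac_mul n a).symm
    rw [if_neg h]
    rfl

/-- The products of two cohomology classes vanish from some point on. The sections `a ₍ₙ₎ b` of `𝒱`
vanish for `n ≫ 0` depending on `a` and `b`, so the morphisms `a ⊗ b ⊗ c ↦ (a ₍ₙ₎ b) ₍₋₁₎ c` are
eventually zero on every section of `𝒱 ⊗ 𝒱 ⊗ 𝒱`, hence on every cohomology class. -/
lemma exists_cup_eq_zero [NoetherianSpace X] {p q : ℕ} (α : 𝒱.sheaf.coh p) (β : 𝒱.sheaf.coh q) :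
    ∃ N : ℤ, ∀ n : ℤ, N ≤ n → cup (𝒱.product n) p q α β = 0 := by
  obtain ⟨u, hu⟩ := exists_tripleProduct α β 𝒱.vacClass
  obtain ⟨N₀, hN₀⟩ := exists_cohMap_tripleTensor_eq_zero
    (fun N : ℕ => tripleLeft (𝒱.product (-1)) (𝒱.product N)) (fun U a b c => by
      obtain ⟨N, hN⟩ := (𝒱.alg U).nilpotent a b
      refine ⟨N.toNat, fun M hM => ?_⟩
      rw [tripleLeft_tmul₃]
      have : (𝒱.product M).map U a b = 0 := hN M (by omega)
      rw [this, map_zero, LinearMap.zero_apply]) u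
  refine ⟨N₀, fun n hn => ?_⟩
  obtain ⟨N, rfl⟩ : ∃ N : ℕ, n = N := ⟨n.toNat, by omega⟩
  have h := (hu (𝒱.product (-1)) (𝒱.product N) _).1 (tripleLeft_tmul₃ _ _)
  rw [hN₀ N (by omega)] at h
  exact (h.trans (𝒱.cup_neg_one_vacClass _)).symm

lemma totalMul_nilpotent [NoetherianSpace X] (a b : 𝒱.sheaf.totalCoh) :
    ∃ N : ℤ, ∀ n : ℤ, N ≤ n → 𝒱.totalMul n a b = 0 := by
  induction a using DirectSum.induction_on with
  | zero => exact ⟨0, fun n _ => by rw [map_zero, LinearMap.zero_apply]⟩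
  | of p α =>
    induction b using DirectSum.induction_on with
    | zero => exact ⟨0, fun n _ => map_zero _⟩
    | of q β =>
      choose N hN using fun i => 𝒱.exists_cup_eq_zero (cohMap (𝒱.parityProj i) p α) β
      refine ⟨max (N 0) (N 1), fun n hn => (𝒱.totalMul_incl_incl n α β).trans ?_⟩
      refine Finset.sum_eq_zero fun i _ => ?_
      have hi : N i ≤ n := by
        have : i = 0 ∨ i = 1 := by revert i; decide
        obtain rfl | rfl := this
        · exact (le_max_left _ _).trans hn
        · exact (le_max_right _ _).trans hn
      rw [hN i n hi, map_zero, smul_zero]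
    | add x y hx hy =>
      obtain ⟨N₁, h₁⟩ := hx
      obtain ⟨N₂, h₂⟩ := hy
      refine ⟨max N₁ N₂, fun n hn => ?_⟩
      rw [map_add, h₁ n (le_of_max_le_left hn), h₂ n (le_of_max_le_right hn), add_zero]
  | add x y hx hy =>
    obtain ⟨N₁, h₁⟩ := hx
    obtain ⟨N₂, h₂⟩ := hy
    refine ⟨max N₁ N₂, fun n hn => ?_⟩
    rw [map_add, LinearMap.add_apply, h₁ n (le_of_max_le_left hn), h₂ n (le_of_max_le_right hn),
      add_zero]

/-- The Borcherds identity for the products of three cohomology classes. The truncations of the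
Borcherds identity for `𝒱` are morphisms `𝒱 ⊗ 𝒱 ⊗ 𝒱 ⟶ 𝒱`, which eventually kill any given section
and therefore any given cohomology class. -/
lemma borcherdsEventually_incl [NoetherianSpace X] (m n k : ℤ) {p q r : ℕ} {i j : ZMod 2}
    {α : 𝒱.sheaf.coh p} (hα : α ∈ 𝒱.cohParity p i) {β : 𝒱.sheaf.coh q}
    (hβ : β ∈ 𝒱.cohParity q j) (γ : 𝒱.sheaf.coh r) :
    BorcherdsEventually 𝒱.totalMul m n k ((n.negOnePow : ℤ) * koszulSign (i + p) (j + q))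
      (𝒱.incl p α) (𝒱.incl q β) (𝒱.incl r γ) := by
  obtain ⟨u, hu⟩ := exists_tripleProduct α β γ
  have hα' : cohMap (𝒱.parityProj i) p α = α := by
    rw [𝒱.cohMap_parityProj_of_mem i hα, if_pos rfl]
  have hβ' : cohMap (𝒱.parityProj j) q β = β := by
    rw [𝒱.cohMap_parityProj_of_mem j hβ, if_pos rfl]
  -- the projections make the signs in the Borcherds identity for sections independent of `a`, `b`
  let fL : ℤ → ℤ → (tripleTensor 𝒱.sheaf ⟶ 𝒱.sheaf) := fun n₁ n₂ =>
    tripleLeft (𝒱.product n₁) ((𝒱.product n₂).precomp (𝒱.parityProj i) (𝒱.parityProj j))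
  let fR : ℤ → ℤ → (tripleTensor 𝒱.sheaf ⟶ 𝒱.sheaf) := fun n₁ n₂ =>
    tripleRight ((𝒱.product n₁).precomp (𝒱.parityProj i) (𝟙 _))
      ((𝒱.product n₂).precomp (𝒱.parityProj j) (𝟙 _))
  let fS : ℤ → ℤ → (tripleTensor 𝒱.sheaf ⟶ 𝒱.sheaf) := fun n₁ n₂ =>
    tripleSwap ((𝒱.product n₁).precomp (𝒱.parityProj j) (𝟙 _))
      ((𝒱.product n₂).precomp (𝒱.parityProj i) (𝟙 _))
  let s : ℤ := (n.negOnePow : ℤ) * koszulSign i j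
  let t : ℕ → (tripleTensor 𝒱.sheaf ⟶ 𝒱.sheaf) := fun l =>
    Ring.choose m l • fL (m + k - l) (n + l) - ((-1 : ℤ) ^ l * Ring.choose n l) •
      (fR (m + n - l) (k + l) - s • fS (n + k - l) (m + l))
  obtain ⟨N₀, hN₀⟩ := exists_cohMap_tripleTensor_eq_zero
    (fun N => ∑ l ∈ Finset.range N, t l) (fun U a b c => by
      obtain ⟨N₀, hN₀⟩ := (borcherds_iff (𝒱.alg U).nilpotent m n k s _ _ c).1
        ((𝒱.alg U).borcherds m n k i j _ _ c ((𝒱.alg U).proj_mem i a) ((𝒱.alg U).proj_mem j b))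
      refine ⟨N₀, fun N hN => Eq.trans ?_ (hN₀ N hN)⟩
      change secMapHom (tmul₃ a b c) (∑ l ∈ Finset.range N, t l) = _
      rw [map_sum]
      refine Finset.sum_congr rfl fun l _ => ?_
      simp only [t, map_sub, map_zsmul]
      have hL : ∀ n₁ n₂, secMapHom (tmul₃ a b c) (fL n₁ n₂) = (𝒱.alg U).mul n₁
        ((𝒱.alg U).mul n₂ ((𝒱.alg U).proj i a) ((𝒱.alg U).proj j b)) c :=
          fun n₁ n₂ => tripleLeft_tmul₃ _ _ U a b c
      have hR : ∀ n₁ n₂, secMapHom (tmul₃ a b c) (fR n₁ n₂) = (𝒱.alg U).mul n₁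
        ((𝒱.alg U).proj i a) ((𝒱.alg U).mul n₂ ((𝒱.alg U).proj j b) c) :=
          fun n₁ n₂ => tripleRight_tmul₃ _ _ U a b c
      have hS : ∀ n₁ n₂, secMapHom (tmul₃ a b c) (fS n₁ n₂) = (𝒱.alg U).mul n₁
        ((𝒱.alg U).proj j b) ((𝒱.alg U).mul n₂ ((𝒱.alg U).proj i a) c) :=
          fun n₁ n₂ => tripleSwap_tmul₃ _ _ U a b c
      rw [hL, hR, hS]
      rfl) u
  -- the common sign of the three kinds of terms
  let ε : ℤ := koszulSign i q * koszulSign (i + j) r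
  have hL : ∀ n₁ n₂, 𝒱.totalMul n₁ (𝒱.totalMul n₂ (𝒱.incl p α) (𝒱.incl q β)) (𝒱.incl r γ) =
      ε • 𝒱.incl _ (cohMap (fL n₁ n₂) _ u) := by
    intro n₁ n₂
    rw [(hu _ _ (fL n₁ n₂)).1 (tripleLeft_tmul₃ _ _), cup_precomp, hα', hβ',
      𝒱.totalMul_of_mem n₂ hα, map_zsmul, LinearMap.smul_apply,
      𝒱.totalMul_of_mem n₁ (𝒱.cup_mem_cohParity n₂ hα hβ), smul_smul]
  have hR : ∀ n₁ n₂, 𝒱.totalMul n₁ (𝒱.incl p α) (𝒱.totalMul n₂ (𝒱.incl q β) (𝒱.incl r γ)) =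
      ε • 𝒱.incl _ (cohMap (fR n₁ n₂) _ u) := by
    intro n₁ n₂
    rw [(hu _ _ (fR n₁ n₂)).2.1 (tripleRight_tmul₃ _ _), cup_precomp, cup_precomp, hα', hβ',
      cohMap_id, cohMap_id, 𝒱.totalMul_of_mem n₂ hβ, map_zsmul, 𝒱.totalMul_of_mem n₁ hα, smul_smul,
      Nat.cast_add, koszulSign_right_identity]
  have hS : ∀ n₁ n₂, ((n.negOnePow : ℤ) * koszulSign (i + p) (j + q)) •
      𝒱.totalMul n₁ (𝒱.incl q β) (𝒱.totalMul n₂ (𝒱.incl p α) (𝒱.incl r γ)) =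
        (s * ε) • 𝒱.incl _ (cohMap (fS n₁ n₂) _ u) := by
    intro n₁ n₂
    rw [(hu _ _ (fS n₁ n₂)).2.2 (tripleSwap_tmul₃ _ _), cup_precomp, cup_precomp, hα', hβ',
      cohMap_id, cohMap_id, 𝒱.totalMul_of_mem n₂ hα, map_zsmul, 𝒱.totalMul_of_mem n₁ hβ, smul_smul,
      smul_smul, smul_smul, Nat.cast_add, ← koszulSign_natCast]
    congr 1
    rw [mul_assoc, mul_assoc, koszulSign_swap_identity]
    simp only [s, ε]
    ring
  refine ⟨N₀, fun N hN => ?_⟩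
  have h := congrArg (fun v => ε • 𝒱.incl _ v) (hN₀ N hN)
  refine Eq.trans ?_ (h.trans (by simp))
  change _ = ε • 𝒱.incl _ (cohMapHom _ u (∑ l ∈ Finset.range N, t l))
  rw [map_sum, map_sum, Finset.smul_sum]
  refine Finset.sum_congr rfl fun l _ => ?_
  simp only [t, map_sub, map_zsmul, borcherdsTerm]
  rw [hL, hR, hS]
  simp only [smul_sub, smul_smul]
  congr 1
  · rw [mul_comm]; rfl
  · congr 1
    · rw [mul_comm]; rfl
    · rw [mul_comm s, mul_left_comm]; rfl

lemma mem_totalParity_induction {j : ZMod 2} {C : 𝒱.sheaf.totalCoh → Prop}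
    {a : 𝒱.sheaf.totalCoh} (ha : a ∈ 𝒱.totalParity j)
    (incl : ∀ p (α : 𝒱.sheaf.coh p), α ∈ 𝒱.cohParity p (j - p) → C (𝒱.incl p α)) (zero : C 0)
    (add : ∀ x y, C x → C y → C (x + y)) : C a := by
  refine Submodule.iSup_induction _ (motive := C) ha ?_ zero add
  rintro p - ⟨α, hα, rfl⟩
  exact incl p α hα

lemma incl_mem_totalParity {p : ℕ} {i j : ZMod 2} (h : i + p = j) {α : 𝒱.sheaf.coh p}
    (hα : α ∈ 𝒱.cohParity p i) : 𝒱.incl p α ∈ 𝒱.totalParity j := by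
  subst h
  refine Submodule.mem_iSup_of_mem p ⟨α, ?_, rfl⟩
  rwa [add_sub_cancel_right]

lemma totalMul_mem_totalParity (n : ℤ) {i j : ZMod 2} {a b : 𝒱.sheaf.totalCoh}
    (ha : a ∈ 𝒱.totalParity i) (hb : b ∈ 𝒱.totalParity j) :
    𝒱.totalMul n a b ∈ 𝒱.totalParity (i + j) := by
  refine 𝒱.mem_totalParity_induction (C := fun a => 𝒱.totalMul n a b ∈ 𝒱.totalParity (i + j)) ha
    (fun p α hα => ?_) ?_ ?_
  · refine 𝒱.mem_totalParity_induction
      (C := fun b => 𝒱.totalMul n (𝒱.incl p α) b ∈ 𝒱.totalParity (i + j)) hb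
      (fun q β hβ => ?_) ?_ ?_
    · rw [𝒱.totalMul_of_mem n hα]
      refine zsmul_mem (𝒱.incl_mem_totalParity ?_ (𝒱.cup_mem_cohParity n hα hβ)) _
      push_cast
      ring
    · rw [map_zero]
      exact zero_mem _
    · intro x y hx hy
      rw [map_add]
      exact add_mem hx hy
  · rw [map_zero, LinearMap.zero_apply]
    exact zero_mem _
  · intro x y hx hy
    rw [map_add, LinearMap.add_apply]
    exact add_mem hx hy

lemma vacClass_totalMul (n : ℤ) (a : 𝒱.sheaf.totalCoh) :
    𝒱.totalMul n (𝒱.incl 0 𝒱.vacClass) a = if n = -1 then a else 0 := by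
  induction a using DirectSum.induction_on with
  | zero => rw [map_zero]; split_ifs <;> rfl
  | of q β =>
    refine (𝒱.totalMul_of_mem n 𝒱.vacClass_mem β).trans ?_
    rw [𝒱.incl_vacClass_cup]
    have : koszulSign 0 (q : ZMod 2) = 1 := by simp [koszulSign]
    rw [this, one_smul]
    rfl
  | add x y hx hy =>
    rw [map_add, hx, hy]
    split_ifs
    · rfl
    · exact add_zero 0

lemma totalMul_neg_one_vacClass (a : 𝒱.sheaf.totalCoh) :
    𝒱.totalMul (-1) a (𝒱.incl 0 𝒱.vacClass) = a := by
  induction a using DirectSum.induction_on with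
  | zero => rw [map_zero, LinearMap.zero_apply]
  | of p α =>
    refine (𝒱.totalMul_incl_incl (-1) α 𝒱.vacClass).trans ?_
    simp only [cup_neg_one_vacClass]
    have : ∀ i, koszulSign i ((0 : ℕ) : ZMod 2) = 1 := by simp [koszulSign]
    simp only [this, one_smul]
    refine (map_sum (𝒱.incl p) _ _).symm.trans ?_
    exact congrArg (𝒱.incl p) (𝒱.sum_cohMap_parityProj α)
  | add x y hx hy => rw [map_add, LinearMap.add_apply, hx, hy]

lemma totalMul_vacClass_of_nonneg {n : ℤ} (hn : 0 ≤ n) (a : 𝒱.sheaf.totalCoh) :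
    𝒱.totalMul n a (𝒱.incl 0 𝒱.vacClass) = 0 := by
  induction a using DirectSum.induction_on with
  | zero => rw [map_zero, LinearMap.zero_apply]
  | of p α =>
    refine (𝒱.totalMul_incl_incl n α 𝒱.vacClass).trans ?_
    refine Finset.sum_eq_zero fun i _ => ?_
    rw [𝒱.cup_vacClass_of_nonneg hn, map_zero, smul_zero]
  | add x y hx hy => rw [map_add, LinearMap.add_apply, hx, hy, add_zero]

lemma borcherdsEventually_totalMul [NoetherianSpace X] (m n k : ℤ) {i j : ZMod 2}
    {a b : 𝒱.sheaf.totalCoh} (ha : a ∈ 𝒱.totalParity i) (hb : b ∈ 𝒱.totalParity j)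
    (c : 𝒱.sheaf.totalCoh) :
    BorcherdsEventually 𝒱.totalMul m n k ((n.negOnePow : ℤ) * koszulSign i j) a b c := by
  refine 𝒱.mem_totalParity_induction (C := fun a => BorcherdsEventually 𝒱.totalMul m n k
    ((n.negOnePow : ℤ) * koszulSign i j) a b c) ha (fun p α hα => ?_)
    (BorcherdsEventually.zero_left b c) fun x y hx hy => BorcherdsEventually.add_left hx hy
  refine 𝒱.mem_totalParity_induction (C := fun b => BorcherdsEventually 𝒱.totalMul m n k
    ((n.negOnePow : ℤ) * koszulSign i j) (𝒱.incl p α) b c) hb (fun q β hβ => ?_)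
    (BorcherdsEventually.zero_middle _ c) fun x y hx hy => BorcherdsEventually.add_middle hx hy
  induction c using DirectSum.induction_on with
  | zero => exact BorcherdsEventually.zero_right _ _
  | of r γ =>
    have h := 𝒱.borcherdsEventually_incl m n k hα hβ γ
    rw [sub_add_cancel, sub_add_cancel] at h
    exact h
  | add x y hx hy => exact BorcherdsEventually.add_right hx hy

/-- The vertex algebra structure on the total cohomology. -/
def totalVertexAlgebra [NoetherianSpace X] : VertexAlgebra 𝒱.sheaf.totalCoh where
  grading := 𝒱.totalParity
  isInternal := 𝒱.isInternal_totalParity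
  vac := 𝒱.incl 0 𝒱.vacClass
  vac_mem := 𝒱.incl_mem_totalParity (by simp) 𝒱.vacClass_mem
  mul := 𝒱.totalMul
  mul_mem n _ _ _ _ ha hb := 𝒱.totalMul_mem_totalParity n ha hb
  nilpotent := 𝒱.totalMul_nilpotent
  vac_mul := 𝒱.vacClass_totalMul
  mul_vac := 𝒱.totalMul_neg_one_vacClass
  mul_vac_of_nonneg _ a hn := 𝒱.totalMul_vacClass_of_nonneg hn a
  borcherds m n k _ _ a b c ha hb :=
    (borcherds_iff 𝒱.totalMul_nilpotent m n k _ a b c).2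
      (𝒱.borcherdsEventually_totalMul m n k ha hb c)

/-- The products on the total cohomology are determined by their values on homogeneous classes. -/
lemma totalMul_unique (n : ℤ)
    (mul : 𝒱.sheaf.totalCoh →ₗ[ℂ] 𝒱.sheaf.totalCoh →ₗ[ℂ] 𝒱.sheaf.totalCoh)
    (h : ∀ (p q : ℕ) (i : ZMod 2) (α : 𝒱.sheaf.coh p) (β : 𝒱.sheaf.coh q),
      α ∈ 𝒱.cohParity p i → mul (𝒱.incl p α) (𝒱.incl q β) =
        koszulSign i q • 𝒱.incl (p + q) (cup (𝒱.product n) p q α β)) :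
    mul = 𝒱.totalMul n := by
  refine DirectSum.linearMap_ext ℂ fun p => LinearMap.ext fun α =>
    DirectSum.linearMap_ext ℂ fun q => LinearMap.ext fun β => ?_
  simp only [LinearMap.comp_apply]
  rw [𝒱.totalMul_incl_incl]
  conv_lhs => rw [← 𝒱.sum_cohMap_parityProj α, map_sum, map_sum, LinearMap.sum_apply]
  exact Finset.sum_congr rfl fun i _ => h p q i _ β (𝒱.cohMap_parityProj_mem i α)

end VertexAlgebraSheaf

end

open VectSheaf in
theorem lemma2p3 (X : TopCat.{0}) [NoetherianSpace X] (𝒱 : VertexAlgebraSheaf X) :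
    ∃ cup : ∀ (_ : ℤ) (p q : ℕ),
        𝒱.sheaf.coh p →ₗ[ℂ] 𝒱.sheaf.coh q →ₗ[ℂ] 𝒱.sheaf.coh (p + q),
      -- the products are the multiplications induced via injective resolutions
      (∀ n : ℤ, IsCupProduct (𝒱.product n) (cup n)) ∧
      -- the products are the multiplications induced by the cup product of Čech cochains
      (∀ (ι : Type) (U : ι → Opens X), (⨆ i, U i) = ⊤ →
        (∀ (p : ℕ) (f : CechCochain U 𝒱.sheaf p ⊤), cechD f = 0 → ∃! α, IsCechClass f α) ∧
        (∀ (n : ℤ) (p q : ℕ) (f : CechCochain U 𝒱.sheaf p ⊤) (g : CechCochain U 𝒱.sheaf q ⊤)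
          (α : 𝒱.sheaf.coh p) (β : 𝒱.sheaf.coh q), IsCechClass f α → IsCechClass g β →
            IsCechClass (cechCup (𝒱.product n) f g) (cup n p q α β)) ∧
        (IsAcyclicCover U 𝒱.sheaf → ∀ p : ℕ,
          (∀ α : 𝒱.sheaf.coh p, ∃ f : CechCochain U 𝒱.sheaf p ⊤, IsCechClass f α) ∧
          (∀ f : CechCochain U 𝒱.sheaf p ⊤, IsCechClass f 0 → IsCechCoboundary f))) ∧
      -- with these products the cohomology is a vertex algebra
      ∃! A : VertexAlgebra 𝒱.sheaf.totalCoh,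
        A.grading = 𝒱.totalParity ∧
        A.vac = DirectSum.lof ℂ ℕ (fun p => 𝒱.sheaf.coh p) 0
          (𝒱.sheaf.cohZero (𝒱.alg ⊤).vac) ∧
        ∀ (n : ℤ) (p q : ℕ) (i : ZMod 2) (α : 𝒱.sheaf.coh p) (β : 𝒱.sheaf.coh q),
          α ∈ 𝒱.cohParity p i →
            A.mul n (DirectSum.lof ℂ ℕ (fun p => 𝒱.sheaf.coh p) p α)
                (DirectSum.lof ℂ ℕ (fun p => 𝒱.sheaf.coh p) q β) =
              koszulSign i q • DirectSum.lof ℂ ℕ (fun p => 𝒱.sheaf.coh p) (p + q)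
                (cup n p q α β) := by
  refine ⟨fun n => VectSheaf.cup (𝒱.product n), fun n => isCupProduct_cup _,
    fun ι U hU => ⟨fun p f hf => existsUnique_isCechClass hU f hf,
      fun n p q f g α β hf hg => hf.cup hU _ hg,
      fun hac p => ⟨fun α => hac.exists_isCechClass hU α,
        fun f hf => hac.isCechCoboundary hU f hf⟩⟩,
    𝒱.totalVertexAlgebra, ⟨rfl, rfl, fun n p q i α β hα => 𝒱.totalMul_of_mem n hα β⟩, ?_⟩
  rintro A ⟨hgr, hvac, hmul⟩
  exact VertexAlgebra.ext hgr hvac (funext fun n => 𝒱.totalMul_unique n (A.mul n) (hmul n))
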